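/- Let $\Gamma$ be a divisible totally ordered abelian group and let $F$ be a field (of arbitrary characteristic and residue characteristic) with a Henselian valuation $v\colon F\to\Gamma\cup\{\infty\}$ (that is, the valuation ring $\{a\in F\mid v(a)\ge 0\}$ is a Henselian local ring). Let $\mathrm{gr}(F)=\bigoplus_{\gamma\in\Gamma}F^{\ge\gamma}/F^{>\gamma}$ be the associated graded field. A quadratic form is called nonsingular if its polar form $b(x,y)=q(x+y)-q(x)-q(y)$ is nondegenerate. A graded quadratic form on a finite-dimensional graded vector space $\mathsf V$ over a graded field $\mathsf F=\bigoplus_\gamma\mathsf F_\gamma$ is a quadratic form $q\colon \mathsf V\to\mathsf F$ with $q(\mathsf V_\gamma)\subseteq\mathsf F_{2\gamma}$ and $b(\mathsf V_\gamma,\mathsf V_\delta)\subseteq\mathsf F_{\gamma+\delta}$. A nonsingular (graded) form is hyperbolic if the space is a direct sum of two (graded) subspaces on which the form vanishes. For $K=F$ (resp. $K=\mathrm{gr}(F)$) let $I_q(K)$ be the quadratic Witt group: the Grothendieck group of the monoid, under orthogonal sum, of isometry classes of even-dimensional nonsingular quadratic forms (resp. graded quadratic forms) over $K$, modulo the subgroup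 generated by the classes of hyperbolic forms. Let $(V,q)$ be a finite-dimensional quadratic space over $F$. A $v$-norm on $V$ is a map $\alpha\colon V\to\Gamma\cup\{\infty\}$ such that $\alpha(x)=\infty$ if and only if $x=0$, $\alpha(x\lambda)=\alpha(x)+v(\lambda)$, $\alpha(x+y)\ge\min(\alpha(x),\alpha(y))$, and for which some base $(e_i)$ of $V$ satisfies $\alpha(\sum_i e_i\lambda_i)=\min_i\alpha(e_i\lambda_i)$ for all $\lambda_i\in F$. Put $V_\gamma=\{x\mid\alpha(x)\ge\gamma\}/\{x\mid\alpha(x)>\gamma\}$ and $\mathrm{gr}_\alpha(V)=\bigoplus_{\gamma\in\Gamma} V_\gamma$, a graded vector space over $\mathrm{gr}(F)$. If $v(b(x,y))\ge\alpha(x)+\alpha(y)$ and $v(q(x))\ge2\alpha(x)$ for all $x,y\in V$, then $q$ and $b$ induce maps $\tilde q_\alpha\colon V_\gamma\to F_{2\gamma}$ and $\tilde b_\alpha\colon V_\gamma\times V_\delta\to F_{\gamma+\delta}$, and hence a graded quadratic form on $\mathrm{gr}_\alpha(V)$, $$\tilde q_\alpha\Bigl(\sum_\gamma x_\gamma\Bigr)=\sum_\gamma\tilde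 q_\alpha(x_\gamma)+\sum_{\gamma<\delta}\tilde b_\alpha(x_\gamma,x_\delta).$$ The norm $\alpha$ is called a tame norm compatible with $q$ if these two inequalities hold and $\tilde q_\alpha$ is nonsingular. Let $I_{qt}(F)\subseteq I_q(F)$ be the subgroup of the Witt classes of the even-dimensional nonsingular quadratic forms that admit a tame compatible norm. Then there is a unique group isomorphism $$\partial\colon I_{qt}(F)\xrightarrow{\ \sim\ } I_q(\mathrm{gr}(F))$$ such that, for every even-dimensional nonsingular quadratic form $q$ over $F$ and every tame norm $\alpha$ compatible with $q$, $\partial$ carries the Witt class of $q$ to the Witt class of $\tilde q_\alpha$. -/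

import Mathlib

open scoped DirectSum

universe u w

namespace TameWitt

/-! ### Quadratic forms and Witt groups over a field -/

/-- A quadratic form is nonsingular if its polar form `b(x,y) = q(x+y) - q(x) - q(y)` is
nondegenerate. -/
def IsNonsingular {R M : Type*} [CommRing R] [AddCommGroup M] [Module R M]
    (q : QuadraticForm R M) : Prop :=
  ∀ x : M, (∀ y : M, QuadraticMap.polar q x y = 0) → x = 0

theorem IsNonsingular.prod {R M N : Type*} [CommRing R] [AddCommGroup M] [Module R M]
    [AddCommGroup N] [Module R N] {q : QuadraticForm R M} {r : QuadraticForm R N}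
    (hq : IsNonsingular q) (hr : IsNonsingular r) :
    IsNonsingular (QuadraticMap.prod q r) := by
  intro x hx
  refine Prod.ext (hq _ fun y => ?_) (hr _ fun y => ?_)
  · simpa using hx (y, 0)
  · simpa using hx (0, y)

/-- The quotient of the Grothendieck group of a commutative monoid `M` (of isometry classes of
forms, under orthogonal sum) by the subgroup generated by a set `H` (of hyperbolic classes). -/
abbrev WittQuotient (M : Type*) [AddCommMonoid M] (H : Set M) : Type _ :=
  Algebra.GrothendieckAddGroup M ⧸
    AddSubgroup.closure ((Algebra.GrothendieckAddGroup.of : M →+ _) '' H)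

/-- The class of an element of `M` in `WittQuotient M H`. -/
noncomputable def WittQuotient.mk {M : Type*} [AddCommMonoid M] (H : Set M) :
    M →+ WittQuotient M H :=
  (QuotientAddGroup.mk' _).comp Algebra.GrothendieckAddGroup.of

theorem WittQuotient.mk_eq_zero {M : Type*} [AddCommMonoid M] {H : Set M} {m : M} (hm : m ∈ H) :
    WittQuotient.mk H m = 0 :=
  (QuotientAddGroup.eq_zero_iff _).2 (AddSubgroup.subset_closure ⟨m, hm, rfl⟩)

/-- Even-dimensional nonsingular quadratic spaces over a field `F`. -/
structure QuadSpace (F : Type u) [Field F] where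
  carrier : Type u
  [addCommGroup : AddCommGroup carrier]
  [module : Module F carrier]
  [finite : FiniteDimensional F carrier]
  form : QuadraticForm F carrier
  even_finrank : Even (Module.finrank F carrier)
  nonsingular : IsNonsingular form

namespace QuadSpace

attribute [instance] addCommGroup module finite

variable {F : Type u} [Field F]

/-- The zero space. -/
def zero : QuadSpace F where
  carrier := PUnit
  form := 0
  even_finrank := by rw [Module.finrank_zero_of_subsingleton]; exact Even.zero
  nonsingular := fun _ _ => rfl

/-- The orthogonal sum. -/
def sum (X Y : QuadSpace F) : QuadSpace F where
  carrier := X.carrier × Y.carrier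
  form := QuadraticMap.prod X.form Y.form
  even_finrank := by
    rw [Module.finrank_prod]
    exact X.even_finrank.add Y.even_finrank
  nonsingular := X.nonsingular.prod Y.nonsingular

/-- The opposite space `(V, -q)`. -/
def neg (X : QuadSpace F) : QuadSpace F where
  carrier := X.carrier
  form := -X.form
  even_finrank := X.even_finrank
  nonsingular := by
    intro x hx
    refine X.nonsingular x fun y => ?_
    have := hx y
    rwa [FunLike.coe_neg, QuadraticMap.polar_neg, neg_eq_zero] at this

/-- Isometry of quadratic spaces. -/
instance isometrySetoid (F : Type u) [Field F] : Setoid (QuadSpace F) where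
  r X Y := X.form.Equivalent Y.form
  iseqv := ⟨fun X => QuadraticMap.Equivalent.refl X.form, fun h => h.symm, fun h k => h.trans k⟩

/-- A nonsingular form is hyperbolic if the space is a direct sum of two totally isotropic
subspaces, on which the form vanishes. -/
def IsHyperbolic (X : QuadSpace F) : Prop :=
  ∃ U W : Submodule F X.carrier, IsCompl U W ∧
    (∀ x ∈ U, X.form x = 0) ∧ (∀ x ∈ W, X.form x = 0)

end QuadSpace

/-- Isometry classes of even-dimensional nonsingular quadratic spaces over `F`. -/
def QuadClass (F : Type u) [Field F] : Type (u + 1) := Quotient (QuadSpace.isometrySetoid F)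

/-- The isometry class of a quadratic space. -/
def QuadSpace.isoClass {F : Type u} [Field F] (X : QuadSpace F) : QuadClass F := Quotient.mk _ X

/-- The orthogonal sum of isometry classes. -/
instance (F : Type u) [Field F] : Add (QuadClass F) where
  add := Quotient.map₂ QuadSpace.sum fun _ _ h _ _ k => QuadraticMap.Equivalent.prod h k

instance (F : Type u) [Field F] : Zero (QuadClass F) where
  zero := QuadSpace.zero.isoClass

instance (F : Type u) [Field F] : AddCommMonoid (QuadClass F) where
  add_assoc := by
    rintro ⟨X⟩ ⟨Y⟩ ⟨Z⟩
    exact Quotient.sound ⟨{ LinearEquiv.prodAssoc F X.carrier Y.carrier Z.carrier with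
      map_app' := fun x => (add_assoc _ _ _).symm }⟩
  zero_add := by
    rintro ⟨X⟩
    exact Quotient.sound ⟨{ LinearEquiv.uniqueProd (R := F) (M := X.carrier) (M₂ := PUnit.{u + 1}) with
      map_app' := fun x => (zero_add _).symm }⟩
  add_zero := by
    rintro ⟨X⟩
    exact Quotient.sound ⟨{ LinearEquiv.prodUnique (R := F) (M := X.carrier) (M₂ := PUnit.{u + 1}) with
      map_app' := fun x => (add_zero _).symm }⟩
  add_comm := by
    rintro ⟨X⟩ ⟨Y⟩
    exact Quotient.sound ⟨QuadraticMap.IsometryEquiv.prodComm _ _⟩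
  nsmul := nsmulRec

/-- The quadratic Witt group `I_q(F)`. -/
abbrev WittGroup (F : Type u) [Field F] : Type (u + 1) :=
  WittQuotient (QuadClass F) {c | ∃ X : QuadSpace F, X.IsHyperbolic ∧ c = X.isoClass}

/-- The Witt class of a quadratic space. -/
noncomputable def QuadSpace.wittClass {F : Type u} [Field F] (X : QuadSpace F) : WittGroup F :=
  WittQuotient.mk _ X.isoClass

section
variable {F : Type u} [Field F]

theorem wittClass_sum (X Y : QuadSpace F) :
    (X.sum Y).wittClass = X.wittClass + Y.wittClass :=
  map_add (WittQuotient.mk _) X.isoClass Y.isoClass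

theorem wittClass_zero : (QuadSpace.zero : QuadSpace F).wittClass = 0 :=
  map_zero (WittQuotient.mk _)

theorem exists_isCompl_prod_neg {V : Type u} [AddCommGroup V] [Module F V] [FiniteDimensional F V]
    (q : QuadraticForm F V) (hq : IsNonsingular q) :
    ∃ U W : Submodule F (V × V), IsCompl U W ∧
      (∀ x ∈ U, QuadraticMap.prod q (-q) x = 0) ∧ (∀ x ∈ W, QuadraticMap.prod q (-q) x = 0) := by
  obtain ⟨c, hc⟩ := LinearMap.BilinMap.toQuadraticMap_surjective q
  have hcx : ∀ x, c x x = q x := fun x => by rw [← hc]; rfl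
  have hinj : Function.Injective (QuadraticMap.polarBilin q) := by
    rw [injective_iff_map_eq_zero]
    intro x hx
    exact hq x fun y => by
      simpa using LinearMap.congr_fun hx y
  let B : V ≃ₗ[F] Module.Dual F V :=
    LinearEquiv.ofInjectiveOfFinrankEq (QuadraticMap.polarBilin q) hinj
      (Subspace.dual_finrank_eq).symm
  have hB : ∀ x y, B x y = QuadraticMap.polar q x y := fun x y => rfl
  let φ : V →ₗ[F] V := -(B.symm.toLinearMap ∘ₗ c)
  have hφ : ∀ x y, QuadraticMap.polar q (φ x) y = - c x y := fun x y => by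
    rw [← hB]; simp [φ]
  refine ⟨LinearMap.range (LinearMap.prod LinearMap.id LinearMap.id),
    LinearMap.range (LinearMap.prod (φ + LinearMap.id) φ), ?_, ?_, ?_⟩
  · constructor
    · rw [Submodule.disjoint_def]
      rintro _ ⟨x, rfl⟩ ⟨y, hy⟩
      have h1 : φ y + y = x := congrArg Prod.fst hy
      have h2 : φ y = x := congrArg Prod.snd hy
      have hy0 : y = 0 := by simpa using h1.trans h2.symm
      subst hy0
      rw [map_zero] at h2
      rw [← h2]; rfl
    · rw [codisjoint_iff, Submodule.eq_top_iff']
      rintro ⟨x, y⟩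
      refine Submodule.mem_sup.2 ⟨_, ⟨y - φ (x - y), rfl⟩, _, ⟨x - y, rfl⟩, ?_⟩
      ext
      · change y - φ (x - y) + (φ (x - y) + (x - y)) = x
        abel
      · change y - φ (x - y) + φ (x - y) = y
        abel
  · rintro _ ⟨x, rfl⟩
    change q x + -q x = 0
    exact add_neg_cancel _
  · rintro _ ⟨x, rfl⟩
    change q (φ x + x) + -q (φ x) = 0
    rw [QuadraticMap.map_add q, hφ, hcx]
    abel

theorem isHyperbolic_sum_neg (X : QuadSpace F) : (X.sum X.neg).IsHyperbolic :=
  exists_isCompl_prod_neg X.form X.nonsingular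

theorem wittClass_neg (X : QuadSpace F) : X.neg.wittClass = -X.wittClass := by
  rw [eq_neg_iff_add_eq_zero, add_comm, ← wittClass_sum]
  exact WittQuotient.mk_eq_zero ⟨_, isHyperbolic_sum_neg X, rfl⟩

end

/-! ### Graded quadratic forms and Witt groups over a graded field -/

/-- A graded field: a nontrivial commutative graded ring in which every nonzero homogeneous element
is invertible. -/
class IsGradedField {ι : Type w} [AddCommGroup ι] [DecidableEq ι] {A : Type u} [CommRing A]
    (𝒜 : ι → AddSubgroup A) [GradedRing 𝒜] : Prop where
  nontrivial : Nontrivial A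
  isUnit : ∀ (γ : ι) (a : A), a ∈ 𝒜 γ → a ≠ 0 → IsUnit a

/-- The grading of the zero module. -/
abbrev subsingletonDecomposition {ι : Type*} [DecidableEq ι] {M : Type*} [AddCommGroup M]
    [Subsingleton M] (ℳ : ι → AddSubgroup M) : DirectSum.Decomposition ℳ :=
  DirectSum.Decomposition.ofAddHom _ 0 (AddMonoidHom.ext fun _ => Subsingleton.elim _ _)
    (DirectSum.addHom_ext fun γ x => by rw [Subsingleton.elim x 0, map_zero, map_zero, map_zero])

/-- The componentwise grading of a product. -/
instance prodDecomposition {ι : Type*} [DecidableEq ι] {M N : Type*} [AddCommGroup M]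
    [AddCommGroup N] (ℳ : ι → AddSubgroup M) (𝒩 : ι → AddSubgroup N)
    [DirectSum.Decomposition ℳ] [DirectSum.Decomposition 𝒩] :
    DirectSum.Decomposition fun γ => (ℳ γ).prod (𝒩 γ) :=
  let iM : ∀ γ, ℳ γ →+ ((ℳ γ).prod (𝒩 γ) : AddSubgroup (M × N)) := fun γ =>
    AddMonoidHom.mk' (fun x => ⟨(x, 0), x.2, (𝒩 γ).zero_mem⟩) fun x y => by ext <;> simp
  let iN : ∀ γ, 𝒩 γ →+ ((ℳ γ).prod (𝒩 γ) : AddSubgroup (M × N)) := fun γ =>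
    AddMonoidHom.mk' (fun x => ⟨(0, x), (ℳ γ).zero_mem, x.2⟩) fun x y => by ext <;> simp
  DirectSum.Decomposition.ofAddHom _
    (AddMonoidHom.coprod
      ((DirectSum.map iM).comp (DirectSum.decomposeAddEquiv ℳ).toAddMonoidHom)
      ((DirectSum.map iN).comp (DirectSum.decomposeAddEquiv 𝒩).toAddMonoidHom))
    (by
      have hM : (DirectSum.coeAddMonoidHom fun γ => (ℳ γ).prod (𝒩 γ)).comp (DirectSum.map iM) =
          (AddMonoidHom.inl M N).comp (DirectSum.coeAddMonoidHom ℳ) := by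
        ext γ x
        all_goals simp [iM]
      have hN : (DirectSum.coeAddMonoidHom fun γ => (ℳ γ).prod (𝒩 γ)).comp (DirectSum.map iN) =
          (AddMonoidHom.inr M N).comp (DirectSum.coeAddMonoidHom 𝒩) := by
        ext γ x
        all_goals simp [iN]
      refine AddMonoidHom.ext fun z => ?_
      have h1 := DFunLike.congr_fun hM (DirectSum.decompose ℳ z.1)
      have h2 := DFunLike.congr_fun hN (DirectSum.decompose 𝒩 z.2)
      have e1 : DirectSum.coeAddMonoidHom ℳ (DirectSum.decompose ℳ z.1) = z.1 :=
        (DirectSum.decompose ℳ).symm_apply_apply z.1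
      have e2 : DirectSum.coeAddMonoidHom 𝒩 (DirectSum.decompose 𝒩 z.2) = z.2 :=
        (DirectSum.decompose 𝒩).symm_apply_apply z.2
      simp only [AddMonoidHom.comp_apply, e1, e2] at h1 h2
      simp only [AddMonoidHom.comp_apply, AddMonoidHom.coprod_apply, map_add]
      refine (congrArg₂ (· + ·) h1 h2).trans ?_
      simp)
    (by
      refine DirectSum.addHom_ext fun γ x => ?_
      obtain ⟨⟨x, y⟩, hx, hy⟩ := x
      have h1 := DirectSum.decompose_of_mem ℳ (x := x) hx
      have h2 := DirectSum.decompose_of_mem 𝒩 (x := y) hy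
      simp only [AddMonoidHom.comp_apply, DirectSum.coeAddMonoidHom_of, AddMonoidHom.coprod_apply,
        AddMonoidHom.id_apply]
      change DirectSum.map iM (DirectSum.decompose ℳ x) + DirectSum.map iN (DirectSum.decompose 𝒩 y)
        = _
      rw [h1, h2, DirectSum.map_of, DirectSum.map_of, ← map_add]
      congr 1
      ext <;> simp [iM, iN])

/-- Even-dimensional nonsingular graded quadratic spaces over a graded field. Over a graded field
the condition that the graded module is free holds automatically; the dimension is the rank. -/
structure GradedQuadSpace {ι : Type w} [AddCommGroup ι] [DecidableEq ι] {A : Type u} [CommRing A]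
    (𝒜 : ι → AddSubgroup A) [GradedRing 𝒜] [IsGradedField 𝒜] where
  carrier : Type u
  [addCommGroup : AddCommGroup carrier]
  [module : Module A carrier]
  [finite : Module.Finite A carrier]
  [free : Module.Free A carrier]
  /-- The homogeneous components of the graded vector space. -/
  deg : ι → AddSubgroup carrier
  [decomposition : DirectSum.Decomposition deg]
  [gradedSMul : SetLike.GradedSMul 𝒜 deg]
  form : QuadraticForm A carrier
  form_mem : ∀ γ x, x ∈ deg γ → form x ∈ 𝒜 (2 • γ)
  polar_mem : ∀ γ δ x y, x ∈ deg γ → y ∈ deg δ → QuadraticMap.polar form x y ∈ 𝒜 (γ + δ)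
  even_finrank : Even (Module.finrank A carrier)
  nonsingular : IsNonsingular form

namespace GradedQuadSpace

attribute [instance] addCommGroup module finite free decomposition gradedSMul

variable {ι : Type w} [AddCommGroup ι] [DecidableEq ι] {A : Type u} [CommRing A]
  (𝒜 : ι → AddSubgroup A) [GradedRing 𝒜] [IsGradedField 𝒜]

/-- The zero graded space. -/
def zero : GradedQuadSpace 𝒜 where
  carrier := PUnit
  deg := fun _ => ⊤
  decomposition := subsingletonDecomposition _
  gradedSMul := ⟨fun _ _ _ _ _ _ => AddSubgroup.mem_top _⟩
  form := 0
  form_mem := fun _ _ _ => AddSubgroup.zero_mem _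
  polar_mem := fun _ _ _ _ _ _ => by
    rw [show QuadraticMap.polar _ _ _ = (0 : A) by simp [QuadraticMap.polar]]
    exact AddSubgroup.zero_mem _
  even_finrank := by
    have := IsGradedField.nontrivial (𝒜 := 𝒜)
    rw [Module.finrank_zero_of_subsingleton]; exact Even.zero
  nonsingular := fun _ _ => rfl

variable {𝒜}

/-- The orthogonal sum, with the componentwise grading. -/
def sum (X Y : GradedQuadSpace 𝒜) : GradedQuadSpace 𝒜 where
  carrier := X.carrier × Y.carrier
  deg := fun γ => (X.deg γ).prod (Y.deg γ)
  gradedSMul := ⟨fun _ _ _ _ ha hx =>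
    ⟨X.gradedSMul.smul_mem ha hx.1, Y.gradedSMul.smul_mem ha hx.2⟩⟩
  form := QuadraticMap.prod X.form Y.form
  form_mem := fun γ x hx => add_mem (X.form_mem γ _ hx.1) (Y.form_mem γ _ hx.2)
  polar_mem := fun γ δ x y hx hy => by
    rw [QuadraticMap.polar_prod]
    exact add_mem (X.polar_mem γ δ _ _ hx.1 hy.1) (Y.polar_mem γ δ _ _ hx.2 hy.2)
  even_finrank := by
    have := IsGradedField.nontrivial (𝒜 := 𝒜)
    rw [Module.finrank_prod]
    exact X.even_finrank.add Y.even_finrank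
  nonsingular := X.nonsingular.prod Y.nonsingular

/-- Isometry of graded quadratic spaces: an isometry that identifies the gradings. -/
instance isometrySetoid (𝒜 : ι → AddSubgroup A) [GradedRing 𝒜] [IsGradedField 𝒜] :
    Setoid (GradedQuadSpace 𝒜) where
  r X Y := ∃ e : X.form.IsometryEquiv Y.form, ∀ γ x, x ∈ X.deg γ ↔ e x ∈ Y.deg γ
  iseqv :=
    ⟨fun X => ⟨QuadraticMap.IsometryEquiv.refl X.form, fun _ _ => Iff.rfl⟩,
      fun ⟨e, he⟩ => ⟨e.symm, fun γ x => by simp [he]⟩,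
      fun ⟨e, he⟩ ⟨f, hf⟩ => ⟨e.trans f, fun γ x => (he γ x).trans (hf γ (e x))⟩⟩

/-- A nonsingular graded form is hyperbolic if the space is a direct sum of two graded subspaces on
which the form vanishes. -/
def IsHyperbolic (X : GradedQuadSpace 𝒜) : Prop :=
  ∃ U W : Submodule A X.carrier, U.IsHomogeneous X.deg ∧ W.IsHomogeneous X.deg ∧ IsCompl U W ∧
    (∀ x ∈ U, X.form x = 0) ∧ (∀ x ∈ W, X.form x = 0)

end GradedQuadSpace

section
variable {ι : Type w} [AddCommGroup ι] [DecidableEq ι] {A : Type u} [CommRing A]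
  (𝒜 : ι → AddSubgroup A) [GradedRing 𝒜] [IsGradedField 𝒜]

/-- Isometry classes of even-dimensional nonsingular graded quadratic spaces. -/
def GradedQuadClass : Type (max (u + 1) w) := Quotient (GradedQuadSpace.isometrySetoid 𝒜)

variable {𝒜} in
/-- The isometry class of a graded quadratic space. -/
def GradedQuadSpace.isoClass (X : GradedQuadSpace 𝒜) : GradedQuadClass 𝒜 := Quotient.mk _ X

/-- The orthogonal sum of isometry classes. -/
instance : Add (GradedQuadClass 𝒜) where
  add := Quotient.map₂ GradedQuadSpace.sum fun _ _ ⟨e, he⟩ _ _ ⟨f, hf⟩ =>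
    ⟨QuadraticMap.IsometryEquiv.prod e f, fun γ x => and_congr (he γ x.1) (hf γ x.2)⟩

instance : Zero (GradedQuadClass 𝒜) where
  zero := (GradedQuadSpace.zero 𝒜).isoClass

instance : AddCommMonoid (GradedQuadClass 𝒜) where
  add_assoc := by
    rintro ⟨X⟩ ⟨Y⟩ ⟨Z⟩
    exact Quotient.sound ⟨{ LinearEquiv.prodAssoc A X.carrier Y.carrier Z.carrier with
      map_app' := fun x => (add_assoc _ _ _).symm }, fun γ x => and_assoc⟩
  zero_add := by
    rintro ⟨X⟩
    exact Quotient.sound ⟨{ LinearEquiv.uniqueProd (R := A) (M := X.carrier)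
      (M₂ := PUnit.{u + 1}) with map_app' := fun x => (zero_add _).symm },
      fun γ x => ⟨fun h => h.2, fun h => ⟨AddSubgroup.mem_top _, h⟩⟩⟩
  add_zero := by
    rintro ⟨X⟩
    exact Quotient.sound ⟨{ LinearEquiv.prodUnique (R := A) (M := X.carrier)
      (M₂ := PUnit.{u + 1}) with map_app' := fun x => (add_zero _).symm },
      fun γ x => ⟨fun h => h.1, fun h => ⟨h, AddSubgroup.mem_top _⟩⟩⟩
  add_comm := by
    rintro ⟨X⟩ ⟨Y⟩
    exact Quotient.sound ⟨QuadraticMap.IsometryEquiv.prodComm _ _, fun γ x => and_comm⟩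
  nsmul := nsmulRec

/-- The quadratic Witt group `I_q(𝖥)` of a graded field `𝖥`. -/
abbrev GradedWittGroup : Type (max (u + 1) w) :=
  WittQuotient (GradedQuadClass 𝒜)
    {c | ∃ X : GradedQuadSpace 𝒜, X.IsHyperbolic ∧ c = X.isoClass}

variable {𝒜} in
/-- The Witt class of a graded quadratic space. -/
noncomputable def GradedQuadSpace.wittClass (X : GradedQuadSpace 𝒜) : GradedWittGroup 𝒜 :=
  WittQuotient.mk _ X.isoClass

end

/-! ### Value functions and associated graded structures -/

theorem coe_add_le {Γ : Type w} [AddCommGroup Γ] [LinearOrder Γ] [IsOrderedAddMonoid Γ]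
    {γ δ : Γ} {a b : WithTop Γ} (ha : (γ : WithTop Γ) ≤ a) (hb : (δ : WithTop Γ) ≤ b) :
    ((γ + δ : Γ) : WithTop Γ) ≤ a + b := by
  rw [WithTop.coe_add]; exact add_le_add ha hb

theorem coe_add_lt {Γ : Type w} [AddCommGroup Γ] [LinearOrder Γ] [IsOrderedAddMonoid Γ]
    {γ δ : Γ} {a b : WithTop Γ} (ha : (γ : WithTop Γ) < a) (hb : (δ : WithTop Γ) ≤ b) :
    ((γ + δ : Γ) : WithTop Γ) < a + b := by
  induction a with
  | top => rw [top_add]; exact WithTop.coe_lt_top _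
  | coe a =>
    induction b with
    | top => rw [add_top]; exact WithTop.coe_lt_top _
    | coe b =>
      rw [← WithTop.coe_add, WithTop.coe_lt_coe]
      exact add_lt_add_of_lt_of_le (WithTop.coe_lt_coe.1 ha) (WithTop.coe_le_coe.1 hb)

section

variable {Γ : Type w} [AddCommGroup Γ] [LinearOrder Γ] [IsOrderedAddMonoid Γ]
  {F : Type u} [Field F] (v : AddValuation F (WithTop Γ))

/-- A `v`-value function `V → Γ ∪ {∞}`. -/
structure ValueFunction (V : Type u) [AddCommGroup V] [Module F V] where
  toFun : V → WithTop Γ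
  eq_top_iff : ∀ x, toFun x = ⊤ ↔ x = 0
  smul : ∀ (a : F) (x : V), toFun (a • x) = toFun x + v a
  min_le_add : ∀ x y, min (toFun x) (toFun y) ≤ toFun (x + y)

/-- The valuation `v`, as a value function on the vector space `F`. -/
def selfValue : ValueFunction v F where
  toFun := v
  eq_top_iff := fun _ => AddValuation.top_iff v
  smul := fun a x => by rw [smul_eq_mul, v.map_mul, add_comm]
  min_le_add := v.map_add

namespace ValueFunction

variable {v} {V W U : Type u} [AddCommGroup V] [Module F V] [AddCommGroup W] [Module F W]
  [AddCommGroup U] [Module F U]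

instance : CoeFun (ValueFunction v V) fun _ => V → WithTop Γ := ⟨toFun⟩

variable (α : ValueFunction v V) (β : ValueFunction v W) (θ : ValueFunction v U)

theorem map_zero : α 0 = ⊤ := (α.eq_top_iff 0).2 rfl

theorem map_neg (x : V) : α (-x) = α x := by
  rw [← neg_one_smul F, α.smul, v.map_neg, v.map_one, add_zero]

theorem le_add {γ : Γ} {x y : V} (hx : (γ : WithTop Γ) ≤ α x) (hy : (γ : WithTop Γ) ≤ α y) :
    (γ : WithTop Γ) ≤ α (x + y) := (le_min hx hy).trans (α.min_le_add x y)

/-- `V^{≥γ}` -/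
def ge (γ : Γ) : AddSubgroup V where
  carrier := {x | (γ : WithTop Γ) ≤ α x}
  zero_mem' := by simp [α.map_zero]
  add_mem' := fun {x y} hx hy => (le_min hx hy).trans (α.min_le_add x y)
  neg_mem' := fun {x} hx => by simpa [α.map_neg] using hx

/-- `V^{>γ}`, as a subgroup of `V^{≥γ}` -/
def gt (γ : Γ) : AddSubgroup (α.ge γ) where
  carrier := {x | (γ : WithTop Γ) < α x}
  zero_mem' := by simp [α.map_zero]
  add_mem' := fun {x y} hx hy => (lt_min hx hy).trans_le (α.min_le_add x y)
  neg_mem' := fun {x} hx => by simpa [α.map_neg] using hx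

/-- `V_γ = V^{≥γ} / V^{>γ}` -/
def Comp (γ : Γ) : Type u := α.ge γ ⧸ α.gt γ

instance (γ : Γ) : AddCommGroup (α.Comp γ) := inferInstanceAs (AddCommGroup (α.ge γ ⧸ α.gt γ))

/-- The canonical map `V^{≥γ} → V_γ`. -/
def proj (γ : Γ) : α.ge γ →+ α.Comp γ := QuotientAddGroup.mk' (α.gt γ)

theorem proj_surjective (γ : Γ) : Function.Surjective (α.proj γ) := QuotientAddGroup.mk'_surjective _

variable {α} in
theorem proj_eq_zero {γ : Γ} {x : α.ge γ} : α.proj γ x = 0 ↔ (γ : WithTop Γ) < α x :=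
  QuotientAddGroup.eq_zero_iff x

theorem proj_congr {γ δ : Γ} {x : α.ge γ} {y : α.ge δ} (h : γ = δ)
    (hxy : (x : V) = y) :
    GradedMonoid.mk (A := α.Comp) γ (α.proj γ x) = GradedMonoid.mk δ (α.proj δ y) := by
  subst h
  rw [Subtype.ext hxy]

/-- The graded vector space `gr_α(V) = ⨁ V_γ`. -/
abbrev Gr : Type (max u w) := ⨁ γ, α.Comp γ

/-- The element of degree `γ` defined by a vector of value at least `γ`. -/
def sym (γ : Γ) (x : V) (hx : (γ : WithTop Γ) ≤ α x) : α.Gr :=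
  DirectSum.of α.Comp γ (α.proj γ ⟨x, hx⟩)

variable {α} in
theorem sym_congr {γ δ : Γ} {x y : V} {hx : (γ : WithTop Γ) ≤ α x} {hy : (δ : WithTop Γ) ≤ α y}
    (h : γ = δ) (hxy : x = y) : α.sym γ x hx = α.sym δ y hy := by
  subst h hxy; rfl

theorem sym_add {γ : Γ} {x y : V} (hx : (γ : WithTop Γ) ≤ α x) (hy : (γ : WithTop Γ) ≤ α y) :
    α.sym γ (x + y) (α.le_add hx hy) = α.sym γ x hx + α.sym γ y hy :=
  (_root_.map_add ((DirectSum.of α.Comp γ).comp (α.proj γ)) ⟨x, hx⟩ ⟨y, hy⟩)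

/-- `gr_α(V)` is generated by its homogeneous elements. -/
theorem gr_induction {p : α.Gr → Prop} (h0 : p 0) (hs : ∀ γ x hx, p (α.sym γ x hx))
    (ha : ∀ x y, p x → p y → p (x + y)) (z : α.Gr) : p z := by
  induction z using DirectSum.induction_on with
  | zero => exact h0
  | of γ x => obtain ⟨⟨x, hx⟩, rfl⟩ := α.proj_surjective γ x; exact hs γ x hx
  | add x y hx hy => exact ha x y hx hy

variable {α β θ}

/-- The pairing `V_γ × W_δ → U_{γ+δ}` induced by a biadditive map. -/
def pairing (f : V →+ W →+ U) (hf : ∀ x y, α x + β y ≤ θ (f x y)) (γ δ : Γ) :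
    α.Comp γ →+ β.Comp δ →+ θ.Comp (γ + δ) :=
  QuotientAddGroup.lift (α.gt γ)
    (AddMonoidHom.mk'
      (fun x => QuotientAddGroup.lift (β.gt δ)
        (AddMonoidHom.mk'
          (fun y => θ.proj (γ + δ) ⟨f x y, (coe_add_le x.2 y.2).trans (hf x y)⟩)
          fun y y' => by
            rw [← _root_.map_add]; congr 1; ext; simp)
        fun y hy => proj_eq_zero.2 ((add_comm γ δ ▸ add_comm (α x) (β y) ▸
          coe_add_lt hy x.2).trans_le (hf x y)))
      fun x x' => by
        refine AddMonoidHom.ext fun y => ?_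
        obtain ⟨y, rfl⟩ := β.proj_surjective δ y
        change θ.proj (γ + δ) ⟨f (x + x' : α.ge γ) y, _⟩ = θ.proj (γ + δ) ⟨f x y, _⟩ +
          θ.proj (γ + δ) ⟨f x' y, _⟩
        rw [← _root_.map_add]; congr 1; ext; simp)
    fun x hx => by
      refine AddMonoidHom.ext fun y => ?_
      obtain ⟨y, rfl⟩ := β.proj_surjective δ y
      exact proj_eq_zero.2 ((coe_add_lt hx y.2).trans_le (hf x y))

theorem pairing_proj_proj (f : V →+ W →+ U) (hf : ∀ x y, α x + β y ≤ θ (f x y)) {γ δ : Γ}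
    (x : α.ge γ) (y : β.ge δ) :
    pairing f hf γ δ (α.proj γ x) (β.proj δ y) =
      θ.proj (γ + δ) ⟨f x y, (coe_add_le x.2 y.2).trans (hf x y)⟩ := rfl

/-- The biadditive map on graded spaces induced by a biadditive map. -/
def grPairing (f : V →+ W →+ U) (hf : ∀ x y, α x + β y ≤ θ (f x y)) : α.Gr →+ β.Gr →+ θ.Gr :=
  DirectSum.toAddMonoid fun γ => AddMonoidHom.flip <|
    DirectSum.toAddMonoid fun δ => AddMonoidHom.flip <|
      (AddMonoidHom.compHom (DirectSum.of θ.Comp (γ + δ))).comp (pairing f hf γ δ)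

theorem grPairing_of_of (f : V →+ W →+ U) (hf : ∀ x y, α x + β y ≤ θ (f x y)) (γ δ : Γ)
    (x : α.Comp γ) (y : β.Comp δ) :
    grPairing f hf (DirectSum.of _ γ x) (DirectSum.of _ δ y) =
      DirectSum.of _ (γ + δ) (pairing f hf γ δ x y) := by
  simp [grPairing]

theorem grPairing_sym_sym (f : V →+ W →+ U) (hf : ∀ x y, α x + β y ≤ θ (f x y)) {γ δ : Γ}
    {x : V} {y : W} (hx : (γ : WithTop Γ) ≤ α x) (hy : (δ : WithTop Γ) ≤ β y) :
    grPairing f hf (α.sym γ x hx) (β.sym δ y hy) =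
      θ.sym (γ + δ) (f x y) ((coe_add_le hx hy).trans (hf x y)) := by
  rw [sym, sym, grPairing_of_of, pairing_proj_proj]; rfl

end ValueFunction

open ValueFunction

/-- Scalar multiplication as a biadditive map. -/
def smulHom (F V : Type u) [Field F] [AddCommGroup V] [Module F V] : F →+ V →+ V :=
  AddMonoidHom.mk' (fun a => DistribSMul.toAddMonoidHom V a) fun a b => by
    ext x; exact add_smul a b x

variable {v} in
theorem le_smul {V : Type u} [AddCommGroup V] [Module F V] (α : ValueFunction v V) (a : F) (x : V) :
    selfValue v a + α x ≤ α (smulHom F V a x) := by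
  change v a + α x ≤ α (a • x)
  rw [α.smul, add_comm]

theorem zero_le_one : ((0 : Γ) : WithTop Γ) ≤ selfValue v (1 : F) := by
  change _ ≤ v 1
  rw [v.map_one, WithTop.coe_zero]

/-- The graded ring structure on the associated graded of `F`. -/
instance gMul : GradedMonoid.GMul (selfValue v).Comp where
  mul {γ δ} a b := pairing (smulHom F F) (le_smul (selfValue v)) γ δ a b

instance gOne : GradedMonoid.GOne (selfValue v).Comp where
  one := (selfValue v).proj 0 ⟨1, zero_le_one v⟩

instance gCommRing : DirectSum.GCommRing (selfValue v).Comp where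
  mul_zero a := _root_.map_zero _
  zero_mul b :=
    DFunLike.congr_fun (_root_.map_zero (pairing (smulHom F F) (le_smul (selfValue v)) _ _)) b
  mul_add a b c := _root_.map_add _ b c
  add_mul a b c :=
    DFunLike.congr_fun (_root_.map_add (pairing (smulHom F F) (le_smul (selfValue v)) _ _) a b) c
  one_mul := by
    rintro ⟨γ, a⟩
    obtain ⟨a, rfl⟩ := proj_surjective _ γ a
    exact proj_congr _ (zero_add γ) (one_mul (a : F))
  mul_one := by
    rintro ⟨γ, a⟩
    obtain ⟨a, rfl⟩ := proj_surjective _ γ a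
    exact proj_congr _ (add_zero γ) (mul_one (a : F))
  mul_assoc := by
    rintro ⟨γ, a⟩ ⟨δ, b⟩ ⟨ε, c⟩
    obtain ⟨a, rfl⟩ := proj_surjective _ γ a
    obtain ⟨b, rfl⟩ := proj_surjective _ δ b
    obtain ⟨c, rfl⟩ := proj_surjective _ ε c
    exact proj_congr _ (add_assoc γ δ ε) (mul_assoc (a : F) b c)
  mul_comm := by
    rintro ⟨γ, a⟩ ⟨δ, b⟩
    obtain ⟨a, rfl⟩ := proj_surjective _ γ a
    obtain ⟨b, rfl⟩ := proj_surjective _ δ b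
    exact proj_congr _ (add_comm γ δ) (mul_comm (a : F) b)
  natCast n := n • (selfValue v).proj 0 ⟨1, zero_le_one v⟩
  natCast_zero := zero_nsmul _
  natCast_succ n := succ_nsmul _ n
  intCast n := n • (selfValue v).proj 0 ⟨1, zero_le_one v⟩
  intCast_ofNat n := natCast_zsmul _ n
  intCast_negSucc_ofNat n := negSucc_zsmul _ n

/-- The graded ring `gr(F)`. -/
abbrev GrRing : Type (max u w) := (selfValue v).Gr

variable {v} in
/-- The graded `gr(F)`-module structure on `gr_α(V)`. -/
instance gModule {V : Type u} [AddCommGroup V] [Module F V] (α : ValueFunction v V) :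
    DirectSum.Gmodule (selfValue v).Comp α.Comp where
  smul {γ δ} a x := pairing (smulHom F V) (le_smul α) γ δ a x
  one_smul := by
    rintro ⟨γ, x⟩
    obtain ⟨x, rfl⟩ := proj_surjective _ γ x
    exact proj_congr _ (zero_add γ) (one_smul F (x : V))
  mul_smul := by
    rintro ⟨γ, a⟩ ⟨δ, b⟩ ⟨ε, c⟩
    obtain ⟨a, rfl⟩ := proj_surjective _ γ a
    obtain ⟨b, rfl⟩ := proj_surjective _ δ b
    obtain ⟨c, rfl⟩ := proj_surjective _ ε c
    exact proj_congr _ (add_assoc γ δ ε) (mul_smul (a : F) (b : F) (c : V))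
  smul_add a x y := _root_.map_add _ x y
  smul_zero a := _root_.map_zero _
  add_smul a b x := by rw [_root_.map_add]; rfl
  zero_smul x := by rw [_root_.map_zero]; rfl

end

/-! ### The gradings of `gr(F)` and `gr_α(V)` -/

/-- The canonical grading of a direct sum. -/
def sumGrading {ι : Type*} [DecidableEq ι] (G : ι → Type*) [∀ γ, AddCommGroup (G γ)] (γ : ι) :
    AddSubgroup (⨁ γ, G γ) :=
  (DirectSum.of G γ).range

/-- The inclusion of a summand, as a map to the homogeneous component. -/
def toGrading {ι : Type*} [DecidableEq ι] (G : ι → Type*) [∀ γ, AddCommGroup (G γ)] (γ : ι) :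
    G γ →+ sumGrading G γ :=
  AddMonoidHom.mk' (fun x => ⟨DirectSum.of G γ x, x, rfl⟩) fun x y => by
    ext1; exact map_add _ x y

instance sumDecomposition {ι : Type*} [DecidableEq ι] (G : ι → Type*) [∀ γ, AddCommGroup (G γ)] :
    DirectSum.Decomposition (sumGrading G) :=
  DirectSum.Decomposition.ofAddHom _ (DirectSum.map (toGrading G))
    (by
      refine DirectSum.addHom_ext fun γ x => ?_
      rw [AddMonoidHom.comp_apply, DirectSum.map_of]
      exact DirectSum.coeAddMonoidHom_of _ _ _)
    (by
      refine DirectSum.addHom_ext fun γ x => ?_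
      obtain ⟨_, x, rfl⟩ := x
      rw [AddMonoidHom.comp_apply, DirectSum.coeAddMonoidHom_of]
      exact DirectSum.map_of _ _ _)

section

variable {Γ : Type w} [AddCommGroup Γ] [LinearOrder Γ] [IsOrderedAddMonoid Γ]
  {F : Type u} [Field F] (v : AddValuation F (WithTop Γ))

/-- The grading of `gr(F)`. -/
abbrev grGrading : Γ → AddSubgroup (GrRing v) := sumGrading (selfValue v).Comp

instance : GradedRing (grGrading v) where
  one_mem := ⟨_, rfl⟩
  mul_mem := by
    rintro γ δ _ _ ⟨a, rfl⟩ ⟨b, rfl⟩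
    exact ⟨_, (DirectSum.of_mul_of a b).symm⟩

variable {v} {V : Type u} [AddCommGroup V] [Module F V] (α : ValueFunction v V)

namespace ValueFunction

/-- The grading of `gr_α(V)`. -/
abbrev deg : Γ → AddSubgroup α.Gr := sumGrading α.Comp

theorem mem_deg_iff {γ : Γ} {z : α.Gr} :
    z ∈ α.deg γ ↔ ∃ x, ∃ hx : (γ : WithTop Γ) ≤ α x, α.sym γ x hx = z := by
  constructor
  · rintro ⟨x, rfl⟩
    obtain ⟨⟨x, hx⟩, rfl⟩ := α.proj_surjective γ x
    exact ⟨x, hx, rfl⟩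
  · rintro ⟨x, hx, rfl⟩
    exact ⟨_, rfl⟩

theorem sym_eq_zero {γ : Γ} {x : V} {hx : (γ : WithTop Γ) ≤ α x} :
    α.sym γ x hx = 0 ↔ (γ : WithTop Γ) < α x := by
  rw [sym, ← _root_.map_zero (DirectSum.of α.Comp γ), (DirectSum.of_injective γ).eq_iff]
  exact proj_eq_zero

theorem sym_smul_sym {γ δ : Γ} {a : F} {x : V} (ha : (γ : WithTop Γ) ≤ selfValue v a)
    (hx : (δ : WithTop Γ) ≤ α x) :
    (selfValue v).sym γ a ha • α.sym δ x hx =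
      α.sym (γ + δ) (a • x) ((coe_add_le ha hx).trans (le_smul α a x)) :=
  DirectSum.Gmodule.of_smul_of _ _ _ _

end ValueFunction

theorem sym_mul_sym {γ δ : Γ} {a b : F} (ha : (γ : WithTop Γ) ≤ selfValue v a)
    (hb : (δ : WithTop Γ) ≤ selfValue v b) :
    (selfValue v).sym γ a ha * (selfValue v).sym δ b hb =
      (selfValue v).sym (γ + δ) (a * b) ((coe_add_le ha hb).trans (le_smul (selfValue v) a b)) :=
  DirectSum.of_mul_of _ _

instance : SetLike.GradedSMul (grGrading v) α.deg where
  smul_mem := by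
    intro γ δ a x ha hx
    obtain ⟨a, ha', rfl⟩ := (ValueFunction.mem_deg_iff _).1 ha
    obtain ⟨x, hx', rfl⟩ := (ValueFunction.mem_deg_iff _).1 hx
    exact (ValueFunction.mem_deg_iff _).2 ⟨_, _, (α.sym_smul_sym ha' hx').symm⟩

theorem one_eq_sym : (1 : GrRing v) = (selfValue v).sym 0 1 (zero_le_one v) := rfl

instance : IsGradedField (grGrading v) where
  nontrivial := ⟨0, 1, by
    rw [one_eq_sym, ne_comm, Ne, ValueFunction.sym_eq_zero, not_lt]
    change v 1 ≤ _
    rw [v.map_one, WithTop.coe_zero]⟩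
  isUnit := by
    intro γ a ha h0
    obtain ⟨a, ha', rfl⟩ := (ValueFunction.mem_deg_iff _).1 ha
    rw [Ne, ValueFunction.sym_eq_zero, not_lt] at h0
    have hva : v a = γ := le_antisymm h0 ha'
    have ha0 : a ≠ 0 := by rintro rfl; simp at hva
    have hinv : ((-γ : Γ) : WithTop Γ) ≤ selfValue v a⁻¹ := by
      change _ ≤ v a⁻¹
      have h1 : v a + v a⁻¹ = 0 := by rw [← v.map_mul, mul_inv_cancel₀ ha0, v.map_one]
      have h2 : v a⁻¹ ≠ ⊤ := by rw [Ne, AddValuation.top_iff]; exact inv_ne_zero ha0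
      lift v a⁻¹ to Γ using h2 with c
      rw [hva, ← WithTop.coe_add, ← WithTop.coe_zero, WithTop.coe_inj] at h1
      rw [WithTop.coe_le_coe]
      exact (neg_eq_of_add_eq_zero_right h1).le
    refine IsUnit.of_mul_eq_one ((selfValue v).sym (-γ) a⁻¹ hinv) ?_
    rw [sym_mul_sym, one_eq_sym]
    exact ValueFunction.sym_congr (add_neg_cancel γ) (mul_inv_cancel₀ ha0)

instance : Nontrivial (GrRing v) := IsGradedField.nontrivial (𝒜 := grGrading v)

end

/-! ### Compatible norms and the induced graded form -/

section

variable {Γ : Type w} [AddCommGroup Γ] [LinearOrder Γ] [IsOrderedAddMonoid Γ]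
  {F : Type u} [Field F] {v : AddValuation F (WithTop Γ)}
  {V : Type u} [AddCommGroup V] [Module F V]

namespace ValueFunction

/-- A `v`-value function is a `v`-norm if it is split by some base. -/
def IsNorm (α : ValueFunction v V) : Prop :=
  ∃ (ι : Type) (_ : Fintype ι) (e : Module.Basis ι F V), ∀ c : ι → F,
    α (∑ i, c i • e i) = Finset.univ.inf fun i => α (c i • e i)

/-- `α ≺ q`: the value function `α` is bounded by the quadratic form `q`. -/
structure BoundedBy (α : ValueFunction v V) (q : QuadraticForm F V) : Prop where
  polar_le : ∀ x y, α x + α y ≤ v (QuadraticMap.polar q x y)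
  form_le : ∀ x, 2 • α x ≤ v (q x)

variable {α : ValueFunction v V} {q : QuadraticForm F V} (h : α.BoundedBy q)

/-- The polar form as a biadditive map. -/
def polarHom (q : QuadraticForm F V) : V →+ V →+ F :=
  AddMonoidHom.mk' (fun x => (QuadraticMap.polarBilin q x).toAddMonoidHom) fun x y => by
    ext z; simp

theorem BoundedBy.polarHom_le (h : α.BoundedBy q) (x y : V) : α x + α y ≤ selfValue v (polarHom q x y) :=
  h.polar_le x y

theorem BoundedBy.le_form (h : α.BoundedBy q) {γ : Γ} {x : V} (hx : (γ : WithTop Γ) ≤ α x) :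
    ((2 • γ : Γ) : WithTop Γ) ≤ selfValue v (q x) := by
  rw [two_nsmul]
  exact (coe_add_le hx hx).trans (two_nsmul (α x) ▸ h.form_le x)

theorem BoundedBy.lt_form (h : α.BoundedBy q) {γ : Γ} {x : V} (hx : (γ : WithTop Γ) < α x) :
    ((2 • γ : Γ) : WithTop Γ) < selfValue v (q x) := by
  rw [two_nsmul]
  exact (coe_add_lt hx hx.le).trans_le (two_nsmul (α x) ▸ h.form_le x)

/-- The map `b̃_α : V_γ × V_δ → F_{γ+δ}` induced by the polar form. -/
def BoundedBy.compPolar (γ δ : Γ) : α.Comp γ →+ α.Comp δ →+ (selfValue v).Comp (γ + δ) :=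
  pairing (polarHom q) h.polarHom_le γ δ

/-- The map `q̃_α : V_γ → F_{2γ}` that carries the class of `x` to the class of `q(x)`. -/
def BoundedBy.compForm (γ : Γ) : α.Comp γ → (selfValue v).Comp (2 • γ) :=
  Quotient.lift (s := QuotientAddGroup.leftRel (α.gt γ))
    (fun x : α.ge γ => (selfValue v).proj (2 • γ) ⟨q x, h.le_form x.2⟩) fun x y hxy => by
      rw [← sub_eq_zero, ← neg_eq_zero, neg_sub, ← map_sub]
      rw [← Quotient.eq_iff_equiv, Quotient.eq, QuotientAddGroup.leftRel_apply] at hxy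
      refine proj_eq_zero.2 ?_
      set d : α.ge γ := -x + y with hd
      have hxd : y = x + d := by rw [hd]; abel
      change _ < v (q y - q x)
      have : q y - q x = q d + QuadraticMap.polar q x d := by
        rw [hxd, AddSubgroup.coe_add, QuadraticMap.map_add q]; ring
      rw [this]
      refine lt_of_lt_of_le (lt_min (h.lt_form hxy) ?_) (v.map_add _ _)
      rw [two_nsmul]
      refine lt_of_lt_of_le ?_ (h.polar_le x d)
      rw [add_comm (α x)]
      exact coe_add_lt hxy x.2

/-- The polar form `b̃_α` on `gr_α(V)`. -/
def BoundedBy.grPolar : LinearMap.BilinForm (GrRing v) α.Gr :=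
  LinearMap.mk₂ (GrRing v) (fun x y => grPairing (polarHom q) h.polarHom_le x y)
    (fun x y z => by rw [_root_.map_add]; rfl)
    (fun a x y => by
      induction a using gr_induction with
      | h0 => rw [zero_smul, _root_.map_zero, zero_smul]; rfl
      | ha a b iha ihb => rw [add_smul, _root_.map_add, add_smul, ← iha, ← ihb]; rfl
      | hs γ a ha =>
        induction x using gr_induction with
        | h0 => rw [smul_zero, _root_.map_zero]; exact (smul_zero _).symm
        | ha x z ihx ihz =>
          rw [smul_add, _root_.map_add, _root_.map_add, AddMonoidHom.add_apply, ihx, ihz,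
            AddMonoidHom.add_apply, smul_add]
        | hs δ x hx =>
          induction y using gr_induction with
          | h0 => rw [_root_.map_zero, _root_.map_zero, smul_zero]
          | ha y z ihy ihz => rw [_root_.map_add, _root_.map_add, ihy, ihz, smul_add]
          | hs ε y hy =>
            rw [sym_smul_sym, grPairing_sym_sym, grPairing_sym_sym, smul_eq_mul, sym_mul_sym]
            refine sym_congr (add_assoc _ _ _) ?_
            change QuadraticMap.polar q (a • x) y = a * QuadraticMap.polar q x y
            rw [QuadraticMap.polar_smul_left, smul_eq_mul])
    (fun x y z => _root_.map_add _ y z)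
    (fun a x y => by
      induction a using gr_induction with
      | h0 => rw [zero_smul, _root_.map_zero, zero_smul]
      | ha a b iha ihb => rw [add_smul, _root_.map_add, add_smul, ← iha, ← ihb]
      | hs γ a ha =>
        induction x using gr_induction with
        | h0 => rw [_root_.map_zero]; exact (smul_zero _).symm
        | ha x z ihx ihz =>
          rw [_root_.map_add, AddMonoidHom.add_apply, ihx, ihz, AddMonoidHom.add_apply, smul_add]
        | hs δ x hx =>
          induction y using gr_induction with
          | h0 => rw [smul_zero, _root_.map_zero, smul_zero]
          | ha y z ihy ihz => rw [smul_add, _root_.map_add, _root_.map_add, ihy, ihz, smul_add]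
          | hs ε y hy =>
            rw [sym_smul_sym, grPairing_sym_sym, grPairing_sym_sym, smul_eq_mul, sym_mul_sym]
            refine sym_congr (by abel) ?_
            change QuadraticMap.polar q x (a • y) = a * QuadraticMap.polar q x y
            rw [QuadraticMap.polar_smul_right, smul_eq_mul])

open scoped Classical in
/-- The underlying map of the induced form:
`q̃_α(∑ x_γ) = ∑ q̃_α(x_γ) + ∑_{γ < δ} b̃_α(x_γ, x_δ)`. -/
noncomputable def BoundedBy.grFun (x : α.Gr) : GrRing v :=
  ∑ γ ∈ DFinsupp.support x, DirectSum.of (selfValue v).Comp (2 • γ) (h.compForm γ (x γ)) +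
    ∑ γ ∈ DFinsupp.support x, ∑ δ ∈ DFinsupp.support x with γ < δ,
      DirectSum.of (selfValue v).Comp (γ + δ) (h.compPolar γ δ (x γ) (x δ))

theorem BoundedBy.compForm_zero (γ : Γ) : h.compForm γ 0 = 0 := by
  change (selfValue v).proj (2 • γ) ⟨q (0 : α.ge γ), _⟩ = 0
  rw [proj_eq_zero]
  change _ < v (q ((0 : α.ge γ) : V))
  rw [AddSubgroup.coe_zero, QuadraticMap.map_zero, v.map_zero]
  exact WithTop.coe_lt_top _

theorem BoundedBy.of_compForm_add (γ : Γ) (x y : α.Comp γ) :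
    DirectSum.of (selfValue v).Comp (2 • γ) (h.compForm γ (x + y)) =
      DirectSum.of (selfValue v).Comp (2 • γ) (h.compForm γ x) +
      DirectSum.of (selfValue v).Comp (2 • γ) (h.compForm γ y) +
      DirectSum.of (selfValue v).Comp (γ + γ) (h.compPolar γ γ x y) := by
  obtain ⟨⟨x, hx⟩, rfl⟩ := α.proj_surjective γ x
  obtain ⟨⟨y, hy⟩, rfl⟩ := α.proj_surjective γ y
  have hxy : ((2 • γ : Γ) : WithTop Γ) ≤ selfValue v (QuadraticMap.polar q x y) := by
    rw [two_nsmul]; exact (coe_add_le hx hy).trans (h.polar_le x y)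
  have e : DirectSum.of (selfValue v).Comp (γ + γ) (h.compPolar γ γ (α.proj γ ⟨x, hx⟩)
      (α.proj γ ⟨y, hy⟩)) = (selfValue v).sym (2 • γ) (QuadraticMap.polar q x y) hxy :=
    sym_congr (two_nsmul γ).symm rfl
  rw [e]
  change (selfValue v).sym (2 • γ) (q (x + y)) (h.le_form (α.le_add hx hy)) =
    (selfValue v).sym (2 • γ) (q x) (h.le_form hx) +
    (selfValue v).sym (2 • γ) (q y) (h.le_form hy) + _
  rw [← sym_add, ← sym_add _ ((selfValue v).le_add (h.le_form hx) (h.le_form hy))]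
  exact sym_congr rfl (QuadraticMap.map_add q x y)

theorem BoundedBy.of_compPolar_comm (γ δ : Γ) (x : α.Comp γ) (y : α.Comp δ) :
    DirectSum.of (selfValue v).Comp (γ + δ) (h.compPolar γ δ x y) =
      DirectSum.of (selfValue v).Comp (δ + γ) (h.compPolar δ γ y x) := by
  obtain ⟨⟨x, hx⟩, rfl⟩ := α.proj_surjective γ x
  obtain ⟨⟨y, hy⟩, rfl⟩ := α.proj_surjective δ y
  exact sym_congr (add_comm γ δ) (QuadraticMap.polar_comm q x y)

open scoped Classical in
theorem BoundedBy.grFun_eq_sum (x : α.Gr) (S : Finset Γ) (hS : DFinsupp.support x ⊆ S) :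
    h.grFun x =
      ∑ γ ∈ S, DirectSum.of (selfValue v).Comp (2 • γ) (h.compForm γ (x γ)) +
      ∑ γ ∈ S, ∑ δ ∈ S, if γ < δ then
        DirectSum.of (selfValue v).Comp (γ + δ) (h.compPolar γ δ (x γ) (x δ)) else 0 := by
  have hx : ∀ γ, γ ∉ DFinsupp.support x → x γ = 0 := fun γ hγ => DFinsupp.notMem_support_iff.1 hγ
  rw [BoundedBy.grFun]
  congr 1
  · refine Finset.sum_subset hS fun γ _ hγ => ?_
    rw [hx γ hγ, h.compForm_zero, _root_.map_zero]
  · simp only [Finset.sum_filter]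
    rw [← Finset.sum_subset hS fun γ _ hγ => ?_]
    · refine Finset.sum_congr rfl fun γ _ => Finset.sum_subset hS fun δ _ hδ => ?_
      rw [hx δ hδ, _root_.map_zero, _root_.map_zero, ite_self]
    · refine Finset.sum_eq_zero fun δ _ => ?_
      rw [hx γ hγ, _root_.map_zero, AddMonoidHom.zero_apply, _root_.map_zero, ite_self]

open scoped Classical in
theorem BoundedBy.grPolar_eq_sum (x y : α.Gr) (S : Finset Γ) (hx : DFinsupp.support x ⊆ S)
    (hy : DFinsupp.support y ⊆ S) :
    h.grPolar x y = ∑ γ ∈ S, ∑ δ ∈ S,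
        DirectSum.of (selfValue v).Comp (γ + δ) (h.compPolar γ δ (x γ) (y δ)) := by
  have key : ∀ z : α.Gr, DFinsupp.support z ⊆ S → z = ∑ γ ∈ S, DirectSum.of α.Comp γ (z γ) := by
    intro z hz
    rw [← Finset.sum_subset hz fun γ _ hγ => by
      rw [DFinsupp.notMem_support_iff.1 hγ, _root_.map_zero]]
    exact (DirectSum.sum_support_of z).symm
  conv_lhs => rw [key x hx, key y hy]
  change grPairing (polarHom q) h.polarHom_le _ _ = _
  simp only [_root_.map_sum, AddMonoidHom.finsetSum_apply, grPairing_of_of]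
  rw [Finset.sum_comm]
  rfl

theorem BoundedBy.grFun_add (x y : α.Gr) :
    h.grFun (x + y) = h.grFun x + h.grFun y + h.grPolar x y := by
  classical
  let S := DFinsupp.support x ∪ DFinsupp.support y
  have hx : DFinsupp.support x ⊆ S := Finset.subset_union_left
  have hy : DFinsupp.support y ⊆ S := Finset.subset_union_right
  have hxy : DFinsupp.support (x + y) ⊆ S := DFinsupp.support_add
  rw [h.grFun_eq_sum _ S hxy, h.grFun_eq_sum _ S hx, h.grFun_eq_sum _ S hy,
    h.grPolar_eq_sum x y S hx hy]
  have e1 : ∀ γ, DirectSum.of (selfValue v).Comp (2 • γ) (h.compForm γ ((x + y) γ)) =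
      DirectSum.of (selfValue v).Comp (2 • γ) (h.compForm γ (x γ)) +
      DirectSum.of (selfValue v).Comp (2 • γ) (h.compForm γ (y γ)) +
      DirectSum.of (selfValue v).Comp (γ + γ) (h.compPolar γ γ (x γ) (y γ)) := fun γ =>
    h.of_compForm_add γ (x γ) (y γ)
  set P : Γ → Γ → α.Gr → α.Gr → GrRing v := fun γ δ x y =>
    DirectSum.of (selfValue v).Comp (γ + δ) (h.compPolar γ δ (x γ) (y δ)) with hP
  have e2 : ∀ γ δ, P γ δ (x + y) (x + y) =
      P γ δ x x + P γ δ y y + P γ δ x y + P δ γ x y := by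
    intro γ δ
    have hc : P δ γ x y = P γ δ y x := h.of_compPolar_comm _ _ _ _
    rw [hc]
    simp only [hP, DirectSum.add_apply, _root_.map_add, AddMonoidHom.add_apply]
    abel
  have e3 : ∑ γ ∈ S, ∑ δ ∈ S, P γ δ x y = ∑ γ ∈ S, P γ γ x y +
      (∑ γ ∈ S, ∑ δ ∈ S, (if γ < δ then P γ δ x y else 0) +
       ∑ γ ∈ S, ∑ δ ∈ S, (if γ < δ then P δ γ x y else 0)) := by
    rw [Finset.sum_comm (f := fun γ δ => if γ < δ then P δ γ x y else 0),
      ← Finset.sum_add_distrib, ← Finset.sum_add_distrib]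
    refine Finset.sum_congr rfl fun γ hγ => ?_
    have : P γ γ x y = ∑ δ ∈ S, if γ = δ then P γ δ x y else 0 := by
      rw [Finset.sum_ite_eq, if_pos hγ]
    rw [this, ← Finset.sum_add_distrib, ← Finset.sum_add_distrib]
    refine Finset.sum_congr rfl fun δ _ => ?_
    rcases lt_trichotomy γ δ with hlt | heq | hgt
    · simp [hlt, hlt.ne, hlt.not_gt]
    · simp [heq]
    · simp [hgt, hgt.ne', hgt.not_gt]
  have e4 : ∑ γ ∈ S, ∑ δ ∈ S, (if γ < δ then P γ δ (x + y) (x + y) else 0) =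
      ∑ γ ∈ S, ∑ δ ∈ S, (if γ < δ then P γ δ x x else 0) +
      ∑ γ ∈ S, ∑ δ ∈ S, (if γ < δ then P γ δ y y else 0) +
      ∑ γ ∈ S, ∑ δ ∈ S, (if γ < δ then P γ δ x y else 0) +
      ∑ γ ∈ S, ∑ δ ∈ S, (if γ < δ then P δ γ x y else 0) := by
    simp only [← Finset.sum_add_distrib]
    refine Finset.sum_congr rfl fun γ _ => Finset.sum_congr rfl fun δ _ => ?_
    split_ifs
    · exact e2 γ δ
    · simp
  rw [e3, e4]
  simp only [e1, Finset.sum_add_distrib]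
  abel

theorem BoundedBy.grFun_sym {γ : Γ} {x : V} (hx : (γ : WithTop Γ) ≤ α x) :
    h.grFun (α.sym γ x hx) = (selfValue v).sym (2 • γ) (q x) (h.le_form hx) := by
  classical
  have hS : DFinsupp.support (α.sym γ x hx) ⊆ {γ} := DFinsupp.support_single_subset
  rw [h.grFun_eq_sum _ _ hS]
  simp only [Finset.sum_singleton, lt_irrefl, if_false, add_zero]
  rw [sym, DirectSum.of_eq_same]
  rfl

theorem BoundedBy.grPolar_sym_sym {γ δ : Γ} {x y : V} (hx : (γ : WithTop Γ) ≤ α x)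
    (hy : (δ : WithTop Γ) ≤ α y) :
    h.grPolar (α.sym γ x hx) (α.sym δ y hy) = (selfValue v).sym (γ + δ) (QuadraticMap.polar q x y)
      ((coe_add_le hx hy).trans (h.polar_le x y)) :=
  grPairing_sym_sym _ _ hx hy

theorem BoundedBy.grFun_zero : h.grFun 0 = 0 := by
  have := h.grFun_add 0 0
  simpa using this

theorem BoundedBy.grPolar_self (x : α.Gr) : h.grPolar x x = 2 * h.grFun x := by
  have hsymm : ∀ x y, h.grPolar x y = h.grPolar y x := fun x y => by
    have h1 := h.grFun_add x y
    have h2 := h.grFun_add y x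
    rw [add_comm y x, h1, add_comm (h.grFun y)] at h2
    exact add_left_cancel h2
  induction x using gr_induction with
  | h0 => rw [h.grFun_zero]; simp
  | ha x y ihx ihy =>
    rw [h.grFun_add, _root_.map_add, _root_.map_add, LinearMap.add_apply,
      LinearMap.add_apply, ihx, ihy, hsymm y x]
    ring
  | hs γ x hx =>
    rw [h.grPolar_sym_sym, h.grFun_sym, two_mul, ← sym_add]
    refine sym_congr (two_nsmul γ).symm ?_
    rw [QuadraticMap.polar_self, two_smul]

theorem BoundedBy.grFun_smul (a : GrRing v) (x : α.Gr) :
    h.grFun (a • x) = a * a * h.grFun x := by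
  induction a using gr_induction with
  | h0 => rw [zero_smul, h.grFun_zero]; simp
  | ha a b iha ihb =>
    rw [add_smul, h.grFun_add, iha, ihb, _root_.map_smul, _root_.map_smul, LinearMap.smul_apply,
      h.grPolar_self, smul_eq_mul, smul_eq_mul]
    ring
  | hs γ a ha =>
    induction x using gr_induction with
    | h0 => rw [smul_zero, h.grFun_zero, mul_zero]
    | ha x y ihx ihy =>
      rw [smul_add, h.grFun_add, ihx, ihy, _root_.map_smul, _root_.map_smul, LinearMap.smul_apply,
        h.grFun_add, smul_eq_mul, smul_eq_mul]
      ring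
    | hs δ x hx =>
      rw [sym_smul_sym, h.grFun_sym, h.grFun_sym, sym_mul_sym, sym_mul_sym]
      refine sym_congr (by abel) ?_
      rw [QuadraticMap.map_smul, smul_eq_mul]

/-- The graded quadratic form `q̃_α` on `gr_α(V)` induced by `q`. -/
noncomputable def BoundedBy.grForm : QuadraticForm (GrRing v) α.Gr where
  toFun := h.grFun
  toFun_smul a x := by rw [h.grFun_smul, smul_eq_mul]
  exists_companion' := ⟨h.grPolar, h.grFun_add⟩

theorem BoundedBy.polar_grForm (x y : α.Gr) :
    QuadraticMap.polar h.grForm x y = h.grPolar x y := by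
  change h.grFun (x + y) - h.grFun x - h.grFun y = _
  rw [h.grFun_add]; abel

/-- A `v`-norm `α` is a tame norm compatible with `q` if `α ≺ q` and the induced graded form is
nonsingular. -/
structure IsTameNorm (α : ValueFunction v V) (q : QuadraticForm F V) : Prop where
  isNorm : α.IsNorm
  bounded : α.BoundedBy q
  nonsingular : IsNonsingular bounded.grForm

/-! ### Bases, sums and opposites -/

theorem sym_sum {ι : Type*} (s : Finset ι) {γ : Γ} (x : ι → V)
    (hx : ∀ i, (γ : WithTop Γ) ≤ α (x i)) (hs : (γ : WithTop Γ) ≤ α (∑ i ∈ s, x i)) :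
    α.sym γ (∑ i ∈ s, x i) hs = ∑ i ∈ s, α.sym γ (x i) (hx i) := by
  have := _root_.map_sum ((DirectSum.of α.Comp γ).comp (α.proj γ))
    (fun i => (⟨x i, hx i⟩ : α.ge γ)) s
  refine Eq.trans ?_ this
  rw [AddMonoidHom.comp_apply, sym]
  congr 2
  ext
  simp

variable (α) in
/-- The homogeneous component of degree `γ`. -/
def part (γ : Γ) : α.Gr →+ α.Gr :=
  (DirectSum.of α.Comp γ).comp (DFinsupp.evalAddMonoidHom γ)

theorem part_sym (γ δ : Γ) {x : V} (hx : (δ : WithTop Γ) ≤ α x) :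
    α.part γ (α.sym δ x hx) = if δ = γ then α.sym δ x hx else 0 := by
  change DirectSum.of α.Comp γ (DirectSum.of α.Comp δ _ γ) = _
  split_ifs with hγ
  · subst hγ; rw [DirectSum.of_eq_same]; rfl
  · rw [DirectSum.of_eq_of_ne _ _ _ (Ne.symm hγ), _root_.map_zero]

theorem exists_part_eq (γ : Γ) (z : α.Gr) :
    ∃ x, ∃ hx : (γ : WithTop Γ) ≤ α x, α.part γ z = α.sym γ x hx := by
  obtain ⟨⟨x, hx⟩, h⟩ := α.proj_surjective γ (z γ)
  exact ⟨x, hx, congrArg (DirectSum.of α.Comp γ) h.symm⟩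

theorem eq_zero_of_part (z : α.Gr) (hz : ∀ γ, α.part γ z = 0) : z = 0 := by
  refine DFinsupp.ext fun γ => DirectSum.of_injective (β := α.Comp) γ ?_
  exact (hz γ).trans (_root_.map_zero _).symm

theorem part_smul_sym (γ δ : Γ) (a : GrRing v) {x : V} (hx : (δ : WithTop Γ) ≤ α x) :
    α.part γ (a • α.sym δ x hx) = (selfValue v).part (γ - δ) a • α.sym δ x hx := by
  induction a using gr_induction with
  | h0 => rw [zero_smul, _root_.map_zero, _root_.map_zero, zero_smul]
  | ha a b iha ihb => rw [add_smul, _root_.map_add, _root_.map_add, add_smul, iha, ihb]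
  | hs ε a ha =>
    rw [sym_smul_sym, part_sym, part_sym]
    have : ε + δ = γ ↔ ε = γ - δ := eq_sub_iff_add_eq.symm
    split_ifs with h1 h2 h2
    · rw [sym_smul_sym]
    · exact absurd (this.1 h1) h2
    · exact absurd (this.2 h2) h1
    · rw [zero_smul]

theorem IsNorm.exists_basis (hα : α.IsNorm) :
    ∃ (ι : Type) (_ : Fintype ι) (_ : Module.Basis ι F V),
      Nonempty (Module.Basis ι (GrRing v) α.Gr) := by
  obtain ⟨ι, _, e, he⟩ := hα
  have hne : ∀ i, α (e i) ≠ ⊤ := fun i => by rw [Ne, α.eq_top_iff]; exact e.ne_zero i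
  choose d hd using fun i => WithTop.ne_top_iff_exists.1 (hne i)
  have hle : ∀ (i) (γ : Γ) (c : F), (γ : WithTop Γ) ≤ α (c • e i) ↔ ((γ - d i : Γ) : WithTop Γ) ≤ v c := by
    intro i γ c
    rw [α.smul, ← hd]
    induction v c with
    | top => simp
    | coe t => rw [← WithTop.coe_add, WithTop.coe_le_coe, WithTop.coe_le_coe, sub_le_iff_le_add']
  have hlt : ∀ (i) (γ : Γ) (c : F), (γ : WithTop Γ) < α (c • e i) ↔ ((γ - d i : Γ) : WithTop Γ) < v c := by
    intro i γ c
    rw [α.smul, ← hd]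
    induction v c with
    | top =>
      rw [add_top]
      exact iff_of_true (WithTop.coe_lt_top _) (WithTop.coe_lt_top _)
    | coe t => rw [← WithTop.coe_add, WithTop.coe_lt_coe, WithTop.coe_lt_coe, sub_lt_iff_lt_add']
  let E : ι → α.Gr := fun i => α.sym (d i) (e i) (hd i).le
  have hE : ∀ (i) (γ : Γ) (c : F) (hc : ((γ - d i : Γ) : WithTop Γ) ≤ selfValue v c),
      (selfValue v).sym (γ - d i) c hc • E i = α.sym γ (c • e i) ((hle i γ c).2 hc) := by
    intro i γ c hc
    rw [sym_smul_sym]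
    exact sym_congr (sub_add_cancel _ _) rfl
  refine ⟨ι, inferInstance, e, ⟨Module.Basis.mk (v := E) ?_ ?_⟩⟩
  · rw [Fintype.linearIndependent_iff]
    intro a ha i
    refine eq_zero_of_part _ fun ε => ?_
    obtain ⟨γ, rfl⟩ : ∃ γ, ε = γ - d i := ⟨ε + d i, by abel⟩
    choose b hb hab using fun j => exists_part_eq (γ - d j) (a j)
    have h1 : ∑ j, α.sym γ (b j • e j) ((hle j γ (b j)).2 (hb j)) = 0 := by
      rw [← _root_.map_zero (α.part γ), ← ha, _root_.map_sum]
      refine Finset.sum_congr rfl fun j _ => ?_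
      rw [part_smul_sym, hab, hE]
    have hs : (γ : WithTop Γ) ≤ α (∑ j, b j • e j) := by
      rw [he]; exact Finset.le_inf fun j _ => (hle j γ (b j)).2 (hb j)
    rw [← sym_sum Finset.univ (fun j => b j • e j) _ hs, sym_eq_zero, he,
      Finset.lt_inf_iff (WithTop.coe_lt_top _)] at h1
    rw [hab, sym_eq_zero]
    exact (hlt i γ (b i)).1 (h1 i (Finset.mem_univ i))
  · intro z _
    induction z using gr_induction with
    | h0 => exact Submodule.zero_mem _
    | ha x y hx hy => exact Submodule.add_mem _ (hx trivial) (hy trivial)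
    | hs γ x hx =>
      have hxs : ∑ i, e.repr x i • e i = x := e.sum_repr x
      have hs : (γ : WithTop Γ) ≤ α (∑ i, e.repr x i • e i) := by rwa [hxs]
      have hi : ∀ i, (γ : WithTop Γ) ≤ α (e.repr x i • e i) := by
        intro i
        rw [he] at hs
        exact hs.trans (Finset.inf_le (Finset.mem_univ i))
      rw [← sym_congr (hx := hs) rfl hxs, sym_sum _ _ hi hs]
      refine Submodule.sum_mem _ fun i _ => ?_
      rw [← hE i γ _ ((hle i γ _).1 (hi i))]
      exact Submodule.smul_mem _ _ (Submodule.subset_span ⟨i, rfl⟩)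

theorem IsNorm.finite (hα : α.IsNorm) : Module.Finite (GrRing v) α.Gr := by
  obtain ⟨ι, _, _, ⟨E⟩⟩ := hα.exists_basis
  exact Module.Finite.of_basis E

theorem IsNorm.free (hα : α.IsNorm) : Module.Free (GrRing v) α.Gr := by
  obtain ⟨ι, _, _, ⟨E⟩⟩ := hα.exists_basis
  exact Module.Free.of_basis E

theorem IsNorm.finrank_eq (hα : α.IsNorm) :
    Module.finrank (GrRing v) α.Gr = Module.finrank F V := by
  obtain ⟨ι, _, e, ⟨E⟩⟩ := hα.exists_basis
  rw [Module.finrank_eq_card_basis E, Module.finrank_eq_card_basis e]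

/-- The map of graded groups induced by an additive map. -/
def grMap {W : Type u} [AddCommGroup W] [Module F W] {β : ValueFunction v W} (f : V →+ W)
    (hf : ∀ x, α x ≤ β (f x)) : α.Gr →+ β.Gr :=
  DirectSum.map fun γ => QuotientAddGroup.map (α.gt γ) (β.gt γ)
    (AddMonoidHom.mk' (fun x : α.ge γ => (⟨f x, x.2.trans (hf x)⟩ : β.ge γ))
      fun x y => by ext; simp)
    fun x hx => lt_of_lt_of_le hx (hf x)

theorem grMap_sym {W : Type u} [AddCommGroup W] [Module F W] {β : ValueFunction v W} (f : V →+ W)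
    (hf : ∀ x, α x ≤ β (f x)) {γ : Γ} {x : V} (hx : (γ : WithTop Γ) ≤ α x) :
    grMap f hf (α.sym γ x hx) = β.sym γ (f x) (hx.trans (hf x)) :=
  DirectSum.map_of _ _ _

variable (α) in
/-- The value function `(x, y) ↦ min (α x) (β y)` on a direct sum. -/
def prod {W : Type u} [AddCommGroup W] [Module F W] (β : ValueFunction v W) :
    ValueFunction v (V × W) where
  toFun x := min (α x.1) (β x.2)
  eq_top_iff x := by
    rw [min_eq_top, α.eq_top_iff, β.eq_top_iff, Prod.ext_iff]; rfl
  smul a x := by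
    rw [Prod.smul_fst, Prod.smul_snd, α.smul, β.smul, min_add_add_right]
  min_le_add x y := by
    refine le_min ?_ ?_
    · exact (min_le_min (min_le_left _ _) (min_le_left _ _)).trans (α.min_le_add _ _)
    · exact (min_le_min (min_le_right _ _) (min_le_right _ _)).trans (β.min_le_add _ _)

section
variable {W : Type u} [AddCommGroup W] [Module F W] {β : ValueFunction v W}
  {r : QuadraticForm F W}

theorem IsNorm.prod (hα : α.IsNorm) (hβ : β.IsNorm) : (α.prod β).IsNorm := by
  obtain ⟨ι, _, e, he⟩ := hα
  obtain ⟨κ, _, f, hf⟩ := hβ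
  refine ⟨ι ⊕ κ, inferInstance, e.prod f, fun c => ?_⟩
  have h1 : ∀ i, (α.prod β) (c (.inl i) • (e.prod f) (.inl i)) = α (c (.inl i) • e i) := fun i => by
    change min (α _) (β _) = _
    simp [Module.Basis.prod_apply, β.map_zero]
  have h2 : ∀ i, (α.prod β) (c (.inr i) • (e.prod f) (.inr i)) = β (c (.inr i) • f i) := fun i => by
    change min (α _) (β _) = _
    simp [Module.Basis.prod_apply, α.map_zero]
  have h3 : (∑ i, c i • (e.prod f) i) =
      (∑ i, c (.inl i) • e i, ∑ i, c (.inr i) • f i) := by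
    rw [Fintype.sum_sum_type]
    ext <;> simp [Module.Basis.prod_apply, Prod.fst_sum, Prod.snd_sum]
  rw [h3]
  change min (α (∑ i, c (.inl i) • e i)) (β (∑ i, c (.inr i) • f i)) = _
  rw [he, hf]
  apply le_antisymm
  · refine Finset.le_inf fun i _ => ?_
    rcases i with i | i
    · rw [h1]; exact (min_le_left _ _).trans (Finset.inf_le (Finset.mem_univ i))
    · rw [h2]; exact (min_le_right _ _).trans (Finset.inf_le (Finset.mem_univ i))
  · refine le_min (Finset.le_inf fun i _ => ?_) (Finset.le_inf fun i _ => ?_)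
    · rw [← h1]; exact Finset.inf_le (Finset.mem_univ _)
    · rw [← h2]; exact Finset.inf_le (Finset.mem_univ _)

theorem BoundedBy.prod (hq : α.BoundedBy q) (hr : β.BoundedBy r) :
    (α.prod β).BoundedBy (QuadraticMap.prod q r) where
  polar_le x y := by
    rw [QuadraticMap.polar_prod]
    refine le_trans (le_min ?_ ?_) (v.map_add _ _)
    · exact (add_le_add (min_le_left _ _) (min_le_left _ _)).trans (hq.polar_le _ _)
    · exact (add_le_add (min_le_right _ _) (min_le_right _ _)).trans (hr.polar_le _ _)
  form_le x := by
    rw [QuadraticMap.prod_apply]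
    refine le_trans (le_min ?_ ?_) (v.map_add _ _)
    · exact (nsmul_le_nsmul_right (min_le_left _ _) 2).trans (hq.form_le _)
    · exact (nsmul_le_nsmul_right (min_le_right _ _) 2).trans (hr.form_le _)

theorem IsTameNorm.prod (hα : α.IsTameNorm q) (hβ : β.IsTameNorm r) :
    (α.prod β).IsTameNorm (QuadraticMap.prod q r) where
  isNorm := hα.isNorm.prod hβ.isNorm
  bounded := hα.bounded.prod hβ.bounded
  nonsingular := by
    intro z hz
    have hfst : ∀ x : V × W, (α.prod β) x ≤ α (AddMonoidHom.fst V W x) := fun x => min_le_left _ _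
    have hsnd : ∀ x : V × W, (α.prod β) x ≤ β (AddMonoidHom.snd V W x) := fun x => min_le_right _ _
    have hinl : ∀ x : V, α x ≤ (α.prod β) (AddMonoidHom.inl V W x) := fun x =>
      le_min le_rfl (by simp [β.map_zero])
    have hinr : ∀ x : W, β x ≤ (α.prod β) (AddMonoidHom.inr V W x) := fun x =>
      le_min (by simp [α.map_zero]) le_rfl
    have key1 : ∀ z y, (hα.bounded.prod hβ.bounded).grPolar z (grMap _ hinl y) =
        hα.bounded.grPolar (grMap _ hfst z) y := by
      intro z y
      induction z using gr_induction with
      | h0 => simp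
      | ha x z hx hz =>
        simp only [_root_.map_add, LinearMap.add_apply]; rw [hx, hz]
      | hs γ x hx =>
        induction y using gr_induction with
        | h0 => simp
        | ha y z hy hz => simp only [_root_.map_add]; rw [hy, hz]
        | hs δ y hy =>
          rw [grMap_sym, grMap_sym, BoundedBy.grPolar_sym_sym, BoundedBy.grPolar_sym_sym]
          exact sym_congr rfl (by simp)
    have key2 : ∀ z y, (hα.bounded.prod hβ.bounded).grPolar z (grMap _ hinr y) =
        hβ.bounded.grPolar (grMap _ hsnd z) y := by
      intro z y
      induction z using gr_induction with
      | h0 => simp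
      | ha x z hx hz =>
        simp only [_root_.map_add, LinearMap.add_apply]; rw [hx, hz]
      | hs γ x hx =>
        induction y using gr_induction with
        | h0 => simp
        | ha y z hy hz => simp only [_root_.map_add]; rw [hy, hz]
        | hs δ y hy =>
          rw [grMap_sym, grMap_sym, BoundedBy.grPolar_sym_sym, BoundedBy.grPolar_sym_sym]
          exact sym_congr rfl (by simp)
    have key3 : ∀ z, z = grMap _ hinl (grMap _ hfst z) + grMap _ hinr (grMap _ hsnd z) := by
      intro z
      induction z using gr_induction with
      | h0 => simp
      | ha x z hx hz =>
        simp only [_root_.map_add]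
        nth_rewrite 1 [hx, hz]
        abel
      | hs γ x hx =>
        rw [grMap_sym, grMap_sym, grMap_sym, grMap_sym, ← sym_add]
        exact sym_congr rfl (by ext <;> simp)
    have h1 : grMap _ hfst z = 0 := hα.nonsingular _ fun y => by
      rw [BoundedBy.polar_grForm, ← key1, ← BoundedBy.polar_grForm]; exact hz _
    have h2 : grMap _ hsnd z = 0 := hβ.nonsingular _ fun y => by
      rw [BoundedBy.polar_grForm, ← key2, ← BoundedBy.polar_grForm]; exact hz _
    rw [key3 z, h1, h2, _root_.map_zero, _root_.map_zero, add_zero]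

end

theorem BoundedBy.neg (h : α.BoundedBy q) : α.BoundedBy (-q) where
  polar_le x y := by
    rw [FunLike.coe_neg, QuadraticMap.polar_neg, v.map_neg]; exact h.polar_le x y
  form_le x := by
    rw [neg_apply, v.map_neg]; exact h.form_le x

theorem IsTameNorm.neg (hα : α.IsTameNorm q) : α.IsTameNorm (-q) where
  isNorm := hα.isNorm
  bounded := hα.bounded.neg
  nonsingular := by
    intro z hz
    have key : ∀ z y, hα.bounded.neg.grPolar z y = -hα.bounded.grPolar z y := by
      intro z y
      induction z using gr_induction with
      | h0 => simp
      | ha x z hx hz => simp only [_root_.map_add, LinearMap.add_apply]; rw [hx, hz]; abel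
      | hs γ x hx =>
        induction y using gr_induction with
        | h0 => simp
        | ha y z hy hz => simp only [_root_.map_add]; rw [hy, hz]; abel
        | hs δ y hy =>
          rw [BoundedBy.grPolar_sym_sym, BoundedBy.grPolar_sym_sym, eq_neg_iff_add_eq_zero,
            ← sym_add, sym_eq_zero]
          change _ < v (QuadraticMap.polar (-q) x y + QuadraticMap.polar q x y)
          rw [FunLike.coe_neg, QuadraticMap.polar_neg, neg_add_cancel, v.map_zero]
          exact WithTop.coe_lt_top _
    refine hα.nonsingular z fun y => ?_
    have := hz y
    rw [BoundedBy.polar_grForm, key, neg_eq_zero] at this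
    rw [BoundedBy.polar_grForm, this]

variable (v V) in
/-- The unique value function on a zero space. -/
def ofSubsingleton [Subsingleton V] : ValueFunction v V where
  toFun _ := ⊤
  eq_top_iff x := by simp [Subsingleton.elim x 0]
  smul a x := by simp
  min_le_add x y := by simp

theorem isTameNorm_ofSubsingleton [Subsingleton V] : (ofSubsingleton v V).IsTameNorm q where
  isNorm := ⟨Empty, inferInstance, Module.Basis.empty V, fun c => by simp [ofSubsingleton]⟩
  bounded :=
    { polar_le := fun x y => by simp [Subsingleton.elim x 0]
      form_le := fun x => by simp [Subsingleton.elim x 0] }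
  nonsingular := by
    intro z hz
    clear hz
    induction z using gr_induction with
    | h0 => rfl
    | ha x y hx hy => rw [hx, hy, add_zero]
    | hs γ x hx => exact (sym_eq_zero _).2 (WithTop.coe_lt_top _)

end ValueFunction

/-! ### The tame quadratic Witt group -/

variable (v) in
/-- The tame quadratic Witt group `I_qt(F)`: the subgroup of `I_q(F)` of the Witt classes of the
forms that admit a tame compatible norm. -/
def tameWittGroup : AddSubgroup (WittGroup F) where
  carrier := {c | ∃ X : QuadSpace F,
    (∃ α : ValueFunction v X.carrier, α.IsTameNorm X.form) ∧ X.wittClass = c}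
  zero_mem' := ⟨QuadSpace.zero,
    ⟨@ValueFunction.ofSubsingleton _ _ _ _ _ _ v PUnit.{u + 1} _ _ _,
      @ValueFunction.isTameNorm_ofSubsingleton _ _ _ _ _ _ v PUnit.{u + 1} _ _ _ _⟩, wittClass_zero⟩
  add_mem' := by
    rintro _ _ ⟨X, ⟨α, hα⟩, rfl⟩ ⟨Y, ⟨β, hβ⟩, rfl⟩
    exact ⟨X.sum Y, ⟨α.prod β, hα.prod hβ⟩, wittClass_sum X Y⟩
  neg_mem' := by
    rintro _ ⟨X, ⟨α, hα⟩, rfl⟩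
    exact ⟨X.neg, ⟨α, hα.neg⟩, wittClass_neg X⟩

/-- The graded quadratic space `(gr_α(V), q̃_α)` defined by a tame compatible norm. -/
noncomputable def grSpace (X : QuadSpace F) (α : ValueFunction v X.carrier)
    (hα : α.IsTameNorm X.form) : GradedQuadSpace (grGrading v) where
  carrier := α.Gr
  finite := hα.isNorm.finite
  free := hα.isNorm.free
  deg := α.deg
  form := hα.bounded.grForm
  form_mem := by
    intro γ z hz
    obtain ⟨x, hx, rfl⟩ := (ValueFunction.mem_deg_iff _).1 hz
    exact (ValueFunction.mem_deg_iff _).2 ⟨_, _, (hα.bounded.grFun_sym hx).symm⟩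
  polar_mem := by
    intro γ δ z t hz ht
    obtain ⟨x, hx, rfl⟩ := (ValueFunction.mem_deg_iff _).1 hz
    obtain ⟨y, hy, rfl⟩ := (ValueFunction.mem_deg_iff _).1 ht
    rw [ValueFunction.BoundedBy.polar_grForm]
    exact (ValueFunction.mem_deg_iff _).2 ⟨_, _, (hα.bounded.grPolar_sym_sym hx hy).symm⟩
  even_finrank := by
    rw [hα.isNorm.finrank_eq]
    exact X.even_finrank
  nonsingular := hα.nonsingular

/-- The Witt class of a quadratic space with a tame compatible norm, as an element of `I_qt(F)`. -/
noncomputable def tameClass (X : QuadSpace F) (α : ValueFunction v X.carrier)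
    (hα : α.IsTameNorm X.form) : tameWittGroup v :=
  ⟨X.wittClass, X, ⟨α, hα⟩, rfl⟩

end

end TameWitt

/-! The candidate for the isomorphism sends the class of a form with a tame norm to the class of its
graded form. Everything rests on one equivalence: a space with a tame norm is hyperbolic if and only
if its graded space is.

From the field to the graded field (`isHyperbolic_grSpace`): a totally isotropic subspace of at
least half the dimension has a base whose symbols are linearly independent
(`IsNorm.exists_adapted_basis`). These symbols form a homogeneous totally isotropic family of the
same size, which a dual family with corrected squares completes to a hyperbolic base.

From the graded field to the field (`isHyperbolic_of_grSpace`): a homogeneous hyperbolic base lifts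
to vectors satisfying the hyperbolic relations up to terms of higher value. Hensel's lemma corrects
one pair exactly, since the quadratic equation to be solved has a simple residue root in every
residue characteristic. Projecting the other vectors to the orthogonal complement of that pair keeps
them approximately hyperbolic, and induction finishes (`exists_isHyperbolicFamily_of_approx`).

Two more facts carry this to Witt groups. Every graded form is the graded form of a form with a tame
norm, obtained by lifting its coefficients in a homogeneous base (`exists_grSpace_equiv`); and the
graded space of an orthogonal sum is the orthogonal sum of the graded spaces (`grSpace_sum`). Witt
cancellation is not needed: a class vanishes exactly when the form becomes hyperbolic after adding a
hyperbolic form, and hyperbolic forms can be given tame norms or lifted. Hence a tame form has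
trivial class if and only if its graded form does. Applied to a difference of two forms
(`wittClass_eq_iff`), this gives well-definedness and injectivity at once; the lifting of graded
forms gives surjectivity, and sums of norms give additivity. -/

namespace TameWitt

/-! ### Homogeneous families and bases over a graded field -/

section GradedLinearAlgebra

/-- The homogeneous component of degree `γ`. -/
def component {ι : Type*} [DecidableEq ι] {M : Type*} [AddCommGroup M]
    (ℳ : ι → AddSubgroup M) [DirectSum.Decomposition ℳ] (γ : ι) : M →+ M :=
  AddMonoidHom.mk' (fun x => (DirectSum.decompose ℳ x γ : M)) fun x y => by simp

section component

variable {ι : Type*} [DecidableEq ι] {M : Type*} [AddCommGroup M]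
    {ℳ : ι → AddSubgroup M} [DirectSum.Decomposition ℳ]

theorem component_mem (γ : ι) (x : M) : component ℳ γ x ∈ ℳ γ :=
  (DirectSum.decompose ℳ x γ).2

theorem component_of_mem {γ δ : ι} {x : M} (hx : x ∈ ℳ δ) :
    component ℳ γ x = if δ = γ then x else 0 := by
  change (DirectSum.decompose ℳ x γ : M) = _
  split_ifs with h
  · subst h; exact DirectSum.decompose_of_mem_same ℳ hx
  · exact DirectSum.decompose_of_mem_ne ℳ hx h

theorem component_same {γ : ι} {x : M} (hx : x ∈ ℳ γ) : component ℳ γ x = x := by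
  rw [component_of_mem hx, if_pos rfl]

theorem homogeneous_induction (ℳ : ι → AddSubgroup M) [DirectSum.Decomposition ℳ]
    {p : M → Prop} (h0 : p 0) (hs : ∀ γ, ∀ x ∈ ℳ γ, p x)
    (ha : ∀ x y, p x → p y → p (x + y)) (z : M) : p z := by
  induction z using DirectSum.Decomposition.inductionOn ℳ with
  | zero => exact h0
  | homogeneous m => exact hs _ _ m.2
  | add x y hx hy => exact ha x y hx hy

theorem eq_zero_of_component {x : M} (hx : ∀ γ, component ℳ γ x = 0) : x = 0 := by
  classical
  rw [← DirectSum.sum_support_decompose ℳ x]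
  exact Finset.sum_eq_zero fun γ _ => hx γ

theorem mem_of_component {N : Type*} [SetLike N M] [AddSubmonoidClass N M] {P : N} {x : M}
    (hx : ∀ γ, component ℳ γ x ∈ P) : x ∈ P := by
  classical
  rw [← DirectSum.sum_support_decompose ℳ x]
  exact sum_mem fun γ _ => hx γ

end component

variable {ι : Type w} [AddCommGroup ι] [DecidableEq ι] {A : Type u} [CommRing A]
  {M : Type*} [AddCommGroup M] [Module A M] {ℳ : ι → AddSubgroup M} [DirectSum.Decomposition ℳ]

theorem component_smul {𝒜 : ι → AddSubgroup A} [GradedRing 𝒜]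
    [SetLike.GradedSMul 𝒜 ℳ] {γ δ : ι} (a : A) {x : M} (hx : x ∈ ℳ δ) :
    component ℳ γ (a • x) = component 𝒜 (γ - δ) a • x := by
  induction a using homogeneous_induction 𝒜 with
  | h0 => simp
  | ha a b iha ihb => rw [add_smul, map_add, map_add, add_smul, iha, ihb]
  | hs ε a ha =>
    have h1 : a • x ∈ ℳ (ε + δ) := SetLike.GradedSMul.smul_mem ha hx
    rw [component_of_mem h1, component_of_mem ha]
    have : ε + δ = γ ↔ ε = γ - δ := eq_sub_iff_add_eq.symm
    by_cases h : ε = γ - δ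
    · rw [if_pos (this.2 h), if_pos h]
    · rw [if_neg (mt this.1 h), if_neg h, zero_smul]

/-- A linear map that preserves the degrees of a generating family preserves all degrees. -/
theorem component_map (𝒜 : ι → AddSubgroup A) [GradedRing 𝒜]
    [SetLike.GradedSMul 𝒜 ℳ]
    {M' : Type*} [AddCommGroup M'] [Module A M']
    {ℳ' : ι → AddSubgroup M'} [DirectSum.Decomposition ℳ'] [SetLike.GradedSMul 𝒜 ℳ']
    {κ : Type*} {t : κ → M} {d : κ → ι} (ht : ∀ i, t i ∈ ℳ (d i))
    (hspan : Submodule.span A (Set.range t) = ⊤) (f : M →ₗ[A] M') (hf : ∀ i, f (t i) ∈ ℳ' (d i))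
    (γ : ι) (x : M) : component ℳ' γ (f x) = f (component ℳ γ x) := by
  have hx : x ∈ Submodule.span A (Set.range t) := hspan ▸ Submodule.mem_top
  induction hx using Submodule.closure_induction with
  | zero => simp
  | add x y _ _ hx hy => simp only [map_add, hx, hy]
  | smul_mem a x hx =>
    obtain ⟨i, rfl⟩ := hx
    rw [map_smul, component_smul (𝒜 := 𝒜) a (hf i), component_smul (𝒜 := 𝒜) a (ht i), map_smul]

theorem isHomogeneous_span (𝒜 : ι → AddSubgroup A) [GradedRing 𝒜]
    [SetLike.GradedSMul 𝒜 ℳ] {κ : Type*} {t : κ → M} {d : κ → ι} (ht : ∀ i, t i ∈ ℳ (d i)) :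
    (Submodule.span A (Set.range t)).IsHomogeneous ℳ := by
  intro γ x hx
  change component ℳ γ x ∈ Submodule.span A (Set.range t)
  change x ∈ Submodule.span A (Set.range t) at hx
  induction hx using Submodule.closure_induction with
  | zero => simp
  | add x y _ _ hx hy => rw [map_add]; exact add_mem hx hy
  | smul_mem a x hx =>
    obtain ⟨i, rfl⟩ := hx
    rw [component_smul (𝒜 := 𝒜) a (ht i)]
    exact Submodule.smul_mem _ _ (Submodule.subset_span ⟨i, rfl⟩)

/-- A nonzero component of `a` would be a unit. Its product with `x` is a component of `a • x`,
hence lies in the homogeneous submodule `N`, and dividing by the unit would put `x` into `N`. -/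
theorem eq_zero_of_smul_mem (𝒜 : ι → AddSubgroup A) [GradedRing 𝒜]
    [IsGradedField 𝒜] [SetLike.GradedSMul 𝒜 ℳ] {N : Submodule A M} (hN : N.IsHomogeneous ℳ) {δ : ι} {x : M}
    (hx : x ∈ ℳ δ) (hxN : x ∉ N) {a : A} (ha : a • x ∈ N) : a = 0 := by
  refine eq_zero_of_component (ℳ := 𝒜) fun γ => ?_
  by_contra h
  refine hxN ?_
  have h1 : component ℳ (γ + δ) (a • x) ∈ N := hN _ ha
  rw [component_smul (𝒜 := 𝒜) a hx, add_sub_cancel_right] at h1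
  obtain ⟨b, hb⟩ := IsGradedField.isUnit (𝒜 := 𝒜) γ _ (component_mem γ a) h
  have h2 := N.smul_mem (↑b⁻¹ : A) h1
  rwa [← hb, smul_smul, Units.inv_mul, one_smul] at h2

/-- A homogeneous linearly independent family remains so after adding a homogeneous vector outside
its span. -/
theorem linearIndependent_option_elim (𝒜 : ι → AddSubgroup A) [GradedRing 𝒜]
    [IsGradedField 𝒜] [SetLike.GradedSMul 𝒜 ℳ] {κ : Type*} {t : κ → M} {d : κ → ι}
    (ht : ∀ i, t i ∈ ℳ (d i)) (hli : LinearIndependent A t) {δ : ι} {x : M} (hx : x ∈ ℳ δ)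
    (hxt : x ∉ Submodule.span A (Set.range t)) :
    LinearIndependent A (fun o : Option κ => o.elim x t) := by
  rw [linearIndependent_iff]
  intro l hl
  rw [Finsupp.linearCombination_option] at hl
  change l none • x + Finsupp.linearCombination A t l.some = 0 at hl
  have h1 : l none • x ∈ Submodule.span A (Set.range t) := by
    rw [eq_neg_of_add_eq_zero_left hl]
    exact neg_mem (Finsupp.mem_span_range_iff_exists_finsupp.2 ⟨_, rfl⟩)
  have h2 := eq_zero_of_smul_mem 𝒜 (isHomogeneous_span 𝒜 ht) hx hxt h1
  rw [h2, zero_smul, zero_add] at hl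
  have h3 := linearIndependent_iff.1 hli _ hl
  ext o
  cases o with
  | none => exact h2
  | some i => exact DFunLike.congr_fun h3 i

/-- A homogeneous linearly independent family in a homogeneous submodule extends to a homogeneous
base. -/
theorem exists_extension (𝒜 : ι → AddSubgroup A) [GradedRing 𝒜]
    [IsGradedField 𝒜] [SetLike.GradedSMul 𝒜 ℳ] [Module.Finite A M] {N : Submodule A M} (hN : N.IsHomogeneous ℳ)
    {κ : Type} [Fintype κ] {t : κ → M} {d : κ → ι}
    (ht : ∀ i, t i ∈ ℳ (d i)) (htN : ∀ i, t i ∈ N) (hli : LinearIndependent A t) :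
    ∃ (κ' : Type) (_ : Fintype κ') (f : κ → κ') (t' : κ' → M) (d' : κ' → ι),
      t' ∘ f = t ∧ d' ∘ f = d ∧ (∀ i, t' i ∈ ℳ (d' i)) ∧ LinearIndependent A t' ∧
      Submodule.span A (Set.range t') = N := by
  have hnt := IsGradedField.nontrivial (𝒜 := 𝒜)
  -- Induction on the number of vectors still missing. It drops strictly when a vector is added,
  -- because an independent family has at most `finrank` members.
  obtain ⟨n, hn⟩ : ∃ n, Module.finrank A M - Fintype.card κ = n := ⟨_, rfl⟩
  induction n using Nat.strong_induction_on generalizing κ with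
  | _ n ih =>
    have hle : Submodule.span A (Set.range t) ≤ N := Submodule.span_le.2 (by
      rintro _ ⟨i, rfl⟩; exact htN i)
    by_cases hs : N ≤ Submodule.span A (Set.range t)
    · exact ⟨κ, inferInstance, id, t, d, rfl, rfl, ht, hli, le_antisymm hle hs⟩
    · obtain ⟨y, hyN, hy⟩ := Set.not_subset.1 hs
      -- If all components of `y` were in the span, so would be `y`; thus the new vector can be
      -- taken homogeneous.
      obtain ⟨γ, hγ⟩ : ∃ γ, component ℳ γ y ∉ Submodule.span A (Set.range t) := by
        by_contra! h
        exact hy (mem_of_component h)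
      have hxN : component ℳ γ y ∈ N := hN γ hyN
      have hli' := linearIndependent_option_elim 𝒜 ht hli (component_mem γ y) hγ
      have hc := hli'.fintype_card_le_finrank
      rw [Fintype.card_option] at hc
      obtain ⟨κ', i1, f, t', d', h1, h2, h3, h4, h5⟩ := ih (Module.finrank A M - (Fintype.card κ + 1))
        (by omega) (κ := Option κ) (t := fun o => o.elim (component ℳ γ y) t)
        (d := fun o => o.elim γ d)
        (by rintro (_ | i); exacts [component_mem γ y, ht i])
        (by rintro (_ | i); exacts [hxN, htN i]) hli' (by rw [Fintype.card_option])
      refine ⟨κ', i1, f ∘ some, t', d', ?_, ?_, h3, h4, h5⟩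
      · rw [← Function.comp_assoc, h1]; rfl
      · rw [← Function.comp_assoc, h2]; rfl

theorem exists_homogeneous_generators (𝒜 : ι → AddSubgroup A) [GradedRing 𝒜]
    [IsGradedField 𝒜] [SetLike.GradedSMul 𝒜 ℳ] [Module.Finite A M] {N : Submodule A M}
    (hN : N.IsHomogeneous ℳ) :
    ∃ (κ : Type) (_ : Fintype κ) (t : κ → M) (d : κ → ι), (∀ i, t i ∈ ℳ (d i)) ∧
      LinearIndependent A t ∧ Submodule.span A (Set.range t) = N := by
  obtain ⟨κ, i, -, t, d, -, -, h⟩ := exists_extension 𝒜 hN (κ := Empty) (t := Empty.elim)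
    (d := Empty.elim) (fun i : Empty => i.elim) (fun i : Empty => i.elim) linearIndependent_empty_type
  exact ⟨κ, i, t, d, h⟩

/-- The extension to a homogeneous base cannot add a vector, by cardinality. Homogeneity is
essential: over a ring that is not a field, an independent family of full size need not span. -/
theorem span_eq_top_of_card (𝒜 : ι → AddSubgroup A) [GradedRing 𝒜]
    [IsGradedField 𝒜] [SetLike.GradedSMul 𝒜 ℳ] [Module.Finite A M]
    {κ : Type} [Fintype κ] {t : κ → M} {d : κ → ι} (ht : ∀ i, t i ∈ ℳ (d i))
    (hli : LinearIndependent A t) (hc : Module.finrank A M ≤ Fintype.card κ) :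
    Submodule.span A (Set.range t) = ⊤ := by
  have hnt := IsGradedField.nontrivial (𝒜 := 𝒜)
  obtain ⟨κ', _, f, t', d', h1, -, h3, h4, h5⟩ := exists_extension 𝒜 (N := ⊤)
    (fun _ _ _ => Submodule.mem_top) ht
    (fun _ => Submodule.mem_top) hli
  have hf : Function.Injective f := fun i j hij => hli.injective (by
    rw [← h1, Function.comp_apply, Function.comp_apply, hij])
  have hf' : Function.Bijective f := (Fintype.bijective_iff_injective_and_card f).2
    ⟨hf, le_antisymm (Fintype.card_le_of_injective f hf) (h4.fintype_card_le_finrank.trans hc)⟩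
  rw [← h5, ← h1, Set.range_comp, hf'.2.range_eq, Set.image_univ]

end GradedLinearAlgebra

/-! ### Hyperbolic families over a commutative ring -/

section HyperbolicFamily

variable {R M : Type*} [CommRing R] [AddCommGroup M] [Module R M] {q : QuadraticForm R M}

theorem polar_sum_right {κ : Type*} (s : Finset κ) (x : M) (c : κ → R) (t : κ → M) :
    QuadraticMap.polar q x (∑ i ∈ s, c i • t i) = ∑ i ∈ s, c i * QuadraticMap.polar q x (t i) := by
  rw [← QuadraticMap.polarBilin_apply_apply, map_sum]
  exact Finset.sum_congr rfl fun i _ => QuadraticMap.polar_smul_right q _ _ _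

theorem polar_eq_zero_of_mem_span {s t : Set M}
    (h : ∀ x ∈ s, ∀ y ∈ t, QuadraticMap.polar q x y = 0) {x y : M} (hx : x ∈ Submodule.span R s)
    (hy : y ∈ Submodule.span R t) : QuadraticMap.polar q x y = 0 := by
  induction hx using Submodule.span_induction with
  | zero => simp
  | add x x' _ _ hx hx' => rw [QuadraticMap.polar_add_left, hx, hx', add_zero]
  | smul a x _ hx => rw [QuadraticMap.polar_smul_left, hx, smul_zero]
  | mem x hx =>
    induction hy using Submodule.span_induction with
    | zero => simp
    | add y y' _ _ hy hy' => rw [QuadraticMap.polar_add_right, hy, hy', add_zero]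
    | smul a y _ hy => rw [QuadraticMap.polar_smul_right, hy, smul_zero]
    | mem y hy => exact h x hx y hy

theorem form_eq_zero_of_mem_span {s : Set M} (hq : ∀ x ∈ s, q x = 0)
    (h : ∀ x ∈ s, ∀ y ∈ s, QuadraticMap.polar q x y = 0) {x : M} (hx : x ∈ Submodule.span R s) :
    q x = 0 := by
  induction hx using Submodule.span_induction with
  | zero => simp
  | add x y hxs hys hx hy =>
    rw [QuadraticMap.map_add q, hx, hy, polar_eq_zero_of_mem_span h hxs hys, add_zero, add_zero]
  | smul a x _ hx => rw [QuadraticMap.map_smul, hx, smul_zero]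
  | mem x hx => exact hq x hx

theorem polar_eq_zero_of_isotropic {U : Submodule R M} (hU : ∀ x ∈ U, q x = 0) {x y : M}
    (hx : x ∈ U) (hy : y ∈ U) : QuadraticMap.polar q x y = 0 := by
  rw [QuadraticMap.polar, hU _ (add_mem hx hy), hU _ hx, hU _ hy, sub_zero, sub_zero]

variable (q) in
/-- Two families of isotropic vectors that form hyperbolic pairs, orthogonal to each other. -/
structure IsHyperbolicFamily {κ : Type*} (e f : κ → M) : Prop where
  form_left : ∀ i, q (e i) = 0
  form_right : ∀ i, q (f i) = 0
  polar_left : ∀ i j, QuadraticMap.polar q (e i) (e j) = 0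
  polar_right : ∀ i j, QuadraticMap.polar q (f i) (f j) = 0
  polar_same : ∀ i, QuadraticMap.polar q (e i) (f i) = 1
  polar_ne : ∀ i j, i ≠ j → QuadraticMap.polar q (e i) (f j) = 0

namespace IsHyperbolicFamily

variable {κ : Type*} {e f : κ → M}

theorem symm (h : IsHyperbolicFamily q e f) : IsHyperbolicFamily q f e where
  form_left := h.form_right
  form_right := h.form_left
  polar_left := h.polar_right
  polar_right := h.polar_left
  polar_same i := by rw [QuadraticMap.polar_comm]; exact h.polar_same i
  polar_ne i j hij := by rw [QuadraticMap.polar_comm]; exact h.polar_ne j i hij.symm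

theorem map {M' : Type*} [AddCommGroup M'] [Module R M'] {q' : QuadraticForm R M'}
    (h : IsHyperbolicFamily q e f) (φ : q.IsometryEquiv q') :
    IsHyperbolicFamily q' (φ ∘ e) (φ ∘ f) := by
  have hp : ∀ x y, QuadraticMap.polar q' (φ x) (φ y) = QuadraticMap.polar q x y := fun x y => by
    simp only [QuadraticMap.polar, ← map_add, φ.map_app]
  constructor <;> intros <;> simp only [Function.comp_apply, hp, φ.map_app]
  exacts [h.form_left _, h.form_right _, h.polar_left _ _, h.polar_right _ _, h.polar_same _,
    h.polar_ne _ _ ‹_›]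

theorem form_span_left (h : IsHyperbolicFamily q e f) :
    ∀ x ∈ Submodule.span R (Set.range e), q x = 0 := fun _ hx =>
  form_eq_zero_of_mem_span (by rintro _ ⟨i, rfl⟩; exact h.form_left i)
    (by rintro _ ⟨i, rfl⟩ _ ⟨j, rfl⟩; exact h.polar_left i j) hx

variable [Fintype κ]

/-- Pairing with the partner of a vector reads off its coefficient. Independence of the family and
nonsingularity of its span both come from this. -/
theorem polar_combination_right (h : IsHyperbolicFamily q e f) (a b : κ → R) (j : κ) :
    QuadraticMap.polar q (f j) (∑ i, a i • e i + ∑ i, b i • f i) = a j := by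
  rw [QuadraticMap.polar_add_right, polar_sum_right, polar_sum_right,
    Finset.sum_eq_single j (fun i _ hi => by
      rw [QuadraticMap.polar_comm, h.polar_ne i j hi, mul_zero]) (by simp),
    QuadraticMap.polar_comm, h.polar_same, mul_one,
    Finset.sum_eq_zero (fun i _ => by rw [h.polar_right, mul_zero]), add_zero]

theorem polar_combination_left (h : IsHyperbolicFamily q e f) (a b : κ → R) (j : κ) :
    QuadraticMap.polar q (e j) (∑ i, a i • e i + ∑ i, b i • f i) = b j := by
  rw [add_comm]; exact h.symm.polar_combination_right b a j

theorem linearIndependent (h : IsHyperbolicFamily q e f) :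
    LinearIndependent R (Sum.elim e f) := by
  rw [Fintype.linearIndependent_iff]
  intro g hg
  simp only [Fintype.sum_sum_type, Sum.elim_inl, Sum.elim_inr] at hg
  rintro (j | j)
  · refine (h.polar_combination_right (g ∘ Sum.inl) (g ∘ Sum.inr) j).symm.trans ?_
    simp only [Function.comp_apply, hg, QuadraticMap.polar_zero_right]
  · refine (h.polar_combination_left (g ∘ Sum.inl) (g ∘ Sum.inr) j).symm.trans ?_
    simp only [Function.comp_apply, hg, QuadraticMap.polar_zero_right]

theorem isCompl (h : IsHyperbolicFamily q e f)
    (hs : Submodule.span R (Set.range (Sum.elim e f)) = ⊤) :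
    IsCompl (Submodule.span R (Set.range e)) (Submodule.span R (Set.range f)) where
  disjoint := (linearIndependent_sum.1 h.linearIndependent).2.2
  codisjoint := by
    rw [codisjoint_iff, ← Submodule.span_union, ← Set.Sum.elim_range, hs]

end IsHyperbolicFamily

/-- Dual isotropic families can be corrected to be isotropic as well. -/
theorem exists_isHyperbolicFamily {κ : Type*} [Fintype κ] [LinearOrder κ] {e f : κ → M}
    (h1 : ∀ i, q (e i) = 0) (h2 : ∀ i j, QuadraticMap.polar q (e i) (e j) = 0)
    (h3 : ∀ i, QuadraticMap.polar q (e i) (f i) = 1)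
    (h4 : ∀ i j, i ≠ j → QuadraticMap.polar q (e i) (f j) = 0) :
    IsHyperbolicFamily q e fun j => f j - ∑ i, (if i = j then q (f j) else
      if i < j then QuadraticMap.polar q (f i) (f j) else 0) • e i := by
  -- The matrix `c` is triangular, so that nothing is divided by two. Its diagonal entry cancels `q
  -- (f j)`, and for `i ≠ j` only one of `c i j` and `c j i` survives and cancels the polar value of
  -- `f i` and `f j`.
  set c : κ → κ → R := fun i j => if i = j then q (f j) else
      if i < j then QuadraticMap.polar q (f i) (f j) else 0 with hc
  change IsHyperbolicFamily q e fun j => f j - ∑ i, c i j • e i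
  have he : ∀ i j, QuadraticMap.polar q (e i) (∑ k, c k j • e k) = 0 := fun i j => by
    rw [polar_sum_right]
    exact Finset.sum_eq_zero fun k _ => by rw [h2, mul_zero]
  have hf : ∀ i j, QuadraticMap.polar q (f i) (∑ k, c k j • e k) = c i j := fun i j => by
    rw [polar_sum_right, Finset.sum_eq_single i (fun k _ hk => by
      rw [QuadraticMap.polar_comm, h4 _ _ hk, mul_zero]) (by simp), QuadraticMap.polar_comm, h3,
      mul_one]
  have hmem : ∀ j, ∑ k, c k j • e k ∈ Submodule.span R (Set.range e) := fun j =>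
    Submodule.sum_mem _ fun k _ => Submodule.smul_mem _ _ (Submodule.subset_span ⟨k, rfl⟩)
  have hiso : ∀ x ∈ Submodule.span R (Set.range e), q x = 0 := fun _ hx =>
    form_eq_zero_of_mem_span (by rintro _ ⟨i, rfl⟩; exact h1 i)
      (by rintro _ ⟨i, rfl⟩ _ ⟨j, rfl⟩; exact h2 i j) hx
  have hq : ∀ j, q (f j - ∑ i, c i j • e i) = 0 := fun j => by
    rw [sub_eq_add_neg, QuadraticMap.map_add q, QuadraticMap.map_neg, hiso _ (hmem j),
      QuadraticMap.polar_neg_right, hf]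
    simp [hc]
  refine ⟨h1, hq, h2, fun i j => ?_, fun i => ?_, fun i j hij => ?_⟩
  · by_cases hij : i = j
    · subst hij
      rw [QuadraticMap.polar_self, hq, smul_zero]
    · rw [QuadraticMap.polar_sub_left, QuadraticMap.polar_sub_right, QuadraticMap.polar_sub_right,
        hf, QuadraticMap.polar_comm _ (∑ k, c k i • e k), hf,
        polar_eq_zero_of_isotropic hiso (hmem i) (hmem j)]
      rcases lt_or_gt_of_ne hij with h | h
      · simp [hc, hij, Ne.symm hij, h, h.not_gt]
      · simp [hc, hij, Ne.symm hij, h, h.not_gt, QuadraticMap.polar_comm _ (f j) (f i)]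
  · rw [QuadraticMap.polar_sub_right, h3, he, sub_zero]
  · rw [QuadraticMap.polar_sub_right, h4 _ _ hij, he, sub_zero]

end HyperbolicFamily

/-! ### Gram determinants, dual families and hyperbolic graded spaces -/

theorem prod_mem_graded {ι : Type*} [AddCommMonoid ι] [DecidableEq ι] {A : Type*} [CommRing A]
    {𝒜 : ι → AddSubgroup A} [GradedRing 𝒜] {κ : Type*} (s : Finset κ) {a : κ → A} {d : κ → ι}
    (h : ∀ i, a i ∈ 𝒜 (d i)) : ∏ i ∈ s, a i ∈ 𝒜 (∑ i ∈ s, d i) := by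
  classical
  induction s using Finset.induction_on with
  | empty => simpa using SetLike.GradedOne.one_mem
  | insert i s hi ih =>
    rw [Finset.prod_insert hi, Finset.sum_insert hi]
    exact SetLike.GradedMul.mul_mem (h i) ih

/-- The determinant of a homogeneous matrix is homogeneous. -/
theorem det_mem_graded {ι : Type*} [AddCommMonoid ι] [DecidableEq ι] {A : Type*} [CommRing A]
    {𝒜 : ι → AddSubgroup A} [GradedRing 𝒜] {κ : Type*} [Fintype κ] [DecidableEq κ]
    {G : Matrix κ κ A} {d : κ → ι} (h : ∀ i j, G i j ∈ 𝒜 (d i + d j)) :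
    G.det ∈ 𝒜 (∑ i, d i + ∑ i, d i) := by
  rw [Matrix.det_apply]
  refine sum_mem fun σ _ => ?_
  rw [Units.smul_def]
  refine zsmul_mem ?_ _
  have := prod_mem_graded (𝒜 := 𝒜) Finset.univ (fun i => h (σ i) i)
  rwa [Finset.sum_add_distrib, Equiv.sum_comp] at this

section

variable {ι : Type w} [AddCommGroup ι] [LinearOrder ι] [IsOrderedAddMonoid ι] {A : Type u}
  [CommRing A] {𝒜 : ι → AddSubgroup A} [GradedRing 𝒜] [IsGradedField 𝒜]

/-- Since the degrees are totally ordered, primality of the homogeneous ideal zero can be tested on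
homogeneous elements, and these are zero or invertible. A domain is what is needed to get a kernel
vector from a vanishing determinant. -/
theorem IsGradedField.isDomain (𝒜 : ι → AddSubgroup A) [GradedRing 𝒜] [IsGradedField 𝒜] : IsDomain A := by
  have hnt := IsGradedField.nontrivial (𝒜 := 𝒜)
  have hb : (⊥ : Ideal A).IsHomogeneous 𝒜 := fun i r hr => by
    have hr : r = 0 := hr
    subst hr
    simp
  have : (⊥ : Ideal A).IsPrime := by
    refine hb.isPrime_of_homogeneous_mem_or_mem bot_ne_top ?_
    rintro x y ⟨i, hx⟩ - hxy
    by_cases h : x = 0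
    · exact Or.inl h
    · exact Or.inr ((IsGradedField.isUnit (𝒜 := 𝒜) i x hx h).mul_right_eq_zero.1 hxy)
  have : NoZeroDivisors A := ⟨fun {a b} h => this.mem_or_mem (x := a) (y := b) h⟩
  exact NoZeroDivisors.to_isDomain A

namespace GradedQuadSpace

variable (X : GradedQuadSpace 𝒜)

/-- By additivity it suffices to take `y` homogeneous; then both sides are the full polar value or
zero, according to the degree of `y`. -/
theorem polar_component {γ δ : ι} {x : X.carrier} (hx : x ∈ X.deg γ) (y : X.carrier) :
    QuadraticMap.polar X.form x (component X.deg δ y) =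
      component 𝒜 (γ + δ) (QuadraticMap.polar X.form x y) := by
  induction y using homogeneous_induction X.deg with
  | h0 => simp
  | ha y z hy hz => simp only [map_add, QuadraticMap.polar_add_right, hy, hz]
  | hs ε y hy =>
    rw [component_of_mem hy, component_of_mem (X.polar_mem γ ε x y hx hy)]
    by_cases h : ε = δ
    · rw [if_pos h, if_pos (by rw [h])]
    · rw [if_neg h, if_neg (by simpa using h), QuadraticMap.polar_zero_right]

/-- The Gram determinant of a homogeneous base is homogeneous, so it is a unit as soon as it is
nonzero; were it zero, a kernel vector of the Gram matrix would be a nonzero vector of the radical.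
-/
theorem isUnit_det {κ : Type} [Fintype κ] [DecidableEq κ] {t : κ → X.carrier} {d : κ → ι}
    (ht : ∀ i, t i ∈ X.deg (d i)) (hli : LinearIndependent A t)
    (hs : Submodule.span A (Set.range t) = ⊤) :
    IsUnit (Matrix.of fun i j => QuadraticMap.polar X.form (t i) (t j)).det := by
  have hdom := IsGradedField.isDomain 𝒜
  refine IsGradedField.isUnit (𝒜 := 𝒜) _ _
    (det_mem_graded (d := d) fun i j => X.polar_mem _ _ _ _ (ht i) (ht j)) fun h => ?_
  obtain ⟨c, hc, h⟩ := Matrix.exists_mulVec_eq_zero_iff.2 h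
  refine hc (funext (Fintype.linearIndependent_iff.1 hli c (X.nonsingular _ fun y => ?_)))
  rw [QuadraticMap.polar_comm]
  refine polar_eq_zero_of_mem_span (s := Set.range t) (t := {∑ i, c i • t i}) ?_
    (hs ▸ Submodule.mem_top) (Submodule.mem_span_singleton_self _)
  rintro _ ⟨i, rfl⟩ _ rfl
  rw [polar_sum_right]
  refine Eq.trans ?_ (congrFun h i)
  simp [Matrix.mulVec, dotProduct, mul_comm]

/-- Extend `t` to a homogeneous base: the columns of the inverse Gram matrix give the dual base. -/
theorem exists_dual_family {κ : Type} [Fintype κ] {t : κ → X.carrier} {d : κ → ι}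
    (ht : ∀ i, t i ∈ X.deg (d i)) (hli : LinearIndependent A t) :
    ∃ w : κ → X.carrier, (∀ i, w i ∈ X.deg (-d i)) ∧
      (∀ i, QuadraticMap.polar X.form (t i) (w i) = 1) ∧
      (∀ i j, i ≠ j → QuadraticMap.polar X.form (t i) (w j) = 0) := by
  classical
  obtain ⟨κ', _, f, t', d', rfl, rfl, h3, h4, h5⟩ :=
    exists_extension 𝒜 (N := ⊤) (fun _ _ _ => Submodule.mem_top) ht (fun _ => Submodule.mem_top) hli
  have hnt := IsGradedField.nontrivial (𝒜 := 𝒜)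
  have hf : Function.Injective f := hli.injective.of_comp
  have hdet := X.isUnit_det h3 h4 h5
  set G : Matrix κ' κ' A := Matrix.of fun i j => QuadraticMap.polar X.form (t' i) (t' j) with hG
  have hpol : ∀ i j, QuadraticMap.polar X.form (t' i) (∑ k, G⁻¹ k j • t' k) =
      (1 : Matrix κ' κ' A) i j := fun i j => by
    rw [polar_sum_right, ← Matrix.mul_nonsing_inv G hdet, Matrix.mul_apply]
    exact Finset.sum_congr rfl fun k _ => mul_comm _ _
  -- Taking the component of the expected degree makes the dual vectors homogeneous without studying
  -- the entries of the inverse matrix. By `polar_component` the pairings with `t'` are unchanged,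
  -- being `1` in degree zero or `0`.
  refine ⟨fun j => component X.deg (-d' (f j)) (∑ k, G⁻¹ k (f j) • t' k),
    fun j => component_mem _ _, fun i => ?_, fun i j hij => ?_⟩
  · rw [Function.comp_apply, X.polar_component (h3 _), hpol, Matrix.one_apply_eq, add_neg_cancel,
      component_same SetLike.GradedOne.one_mem]
  · rw [Function.comp_apply, X.polar_component (h3 _), hpol, Matrix.one_apply_ne (hf.ne hij),
      map_zero]

/-- The triangular correction respects degrees: the coefficient of `t i` in the correction of the
`j`-th dual vector has degree `-d i - d j`, so the product has degree `-d j`. -/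
theorem exists_isHyperbolicFamily {κ : Type} [Fintype κ] {t : κ → X.carrier} {d : κ → ι}
    (ht : ∀ i, t i ∈ X.deg (d i)) (hli : LinearIndependent A t) (hq : ∀ i, X.form (t i) = 0)
    (hb : ∀ i j, QuadraticMap.polar X.form (t i) (t j) = 0) :
    ∃ w : κ → X.carrier, (∀ i, w i ∈ X.deg (-d i)) ∧ IsHyperbolicFamily X.form t w := by
  obtain ⟨w, h1, h2, h3⟩ := X.exists_dual_family ht hli
  let : LinearOrder κ := LinearOrder.lift' (Fintype.equivFin κ) (Fintype.equivFin κ).injective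
  refine ⟨_, fun j => sub_mem (h1 j) (sum_mem fun i _ => ?_),
    TameWitt.exists_isHyperbolicFamily hq hb h2 h3⟩
  have key : ∀ {δ} {a : A}, a ∈ 𝒜 δ → δ + d i = -d j → a • t i ∈ X.deg (-d j) := by
    intro δ a ha h
    rw [← h]
    exact SetLike.GradedSMul.smul_mem ha (ht i)
  split_ifs with h h'
  · subst h
    exact key (X.form_mem _ _ (h1 i)) (by abel)
  · exact key (X.polar_mem _ _ _ _ (h1 i) (h1 j)) (by abel)
  · rw [zero_smul]; exact zero_mem _

/-- A homogeneous totally isotropic family of half the dimension makes a graded space hyperbolic. -/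
theorem isHyperbolic_of_isotropic_family {κ : Type} [Fintype κ] {t : κ → X.carrier} {d : κ → ι}
    (ht : ∀ i, t i ∈ X.deg (d i)) (hli : LinearIndependent A t) (hq : ∀ i, X.form (t i) = 0)
    (hb : ∀ i j, QuadraticMap.polar X.form (t i) (t j) = 0)
    (hc : Module.finrank A X.carrier ≤ Fintype.card κ + Fintype.card κ) : X.IsHyperbolic := by
  obtain ⟨w, hw, h⟩ := X.exists_isHyperbolicFamily ht hli hq hb
  have hs := span_eq_top_of_card 𝒜 (ℳ := X.deg) (t := Sum.elim t w)
    (d := Sum.elim d fun i => -d i) (by rintro (i | i); exacts [ht i, hw i]) h.linearIndependent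
    (by rwa [Fintype.card_sum])
  exact ⟨_, _, isHomogeneous_span 𝒜 ht, isHomogeneous_span 𝒜 hw, h.isCompl hs, h.form_span_left,
    h.symm.form_span_left⟩

/-- A homogeneous base of either isotropic summand is half of a hyperbolic family, so each summand
has at most half the rank. As the ranks add up to the whole, each is exactly half. -/
theorem IsHyperbolic.exists_family {X : GradedQuadSpace 𝒜} (hX : X.IsHyperbolic) :
    ∃ (κ : Type) (_ : Fintype κ) (t w : κ → X.carrier) (d : κ → ι), (∀ i, t i ∈ X.deg (d i)) ∧
      (∀ i, w i ∈ X.deg (-d i)) ∧ IsHyperbolicFamily X.form t w ∧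
      Module.finrank A X.carrier = Fintype.card κ + Fintype.card κ := by
  have hnt := IsGradedField.nontrivial (𝒜 := 𝒜)
  obtain ⟨U, W, hU, hW, hUW, hqU, hqW⟩ := hX
  have key : ∀ U : Submodule A X.carrier, U.IsHomogeneous X.deg → (∀ x ∈ U, X.form x = 0) →
      ∃ (κ : Type) (_ : Fintype κ) (t w : κ → X.carrier) (d : κ → ι),
      (∀ i, t i ∈ X.deg (d i)) ∧ (∀ i, w i ∈ X.deg (-d i)) ∧ IsHyperbolicFamily X.form t w ∧
      LinearIndependent A t ∧ Submodule.span A (Set.range t) = U ∧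
      Fintype.card κ + Fintype.card κ ≤ Module.finrank A X.carrier := by
    intro U hU hq
    obtain ⟨κ, _, t, d, ht, hli, rfl⟩ := exists_homogeneous_generators 𝒜 hU
    have hm : ∀ i, t i ∈ Submodule.span A (Set.range t) := fun i => Submodule.subset_span ⟨i, rfl⟩
    obtain ⟨w, hw, h⟩ := X.exists_isHyperbolicFamily ht hli (fun i => hq _ (hm i))
      (fun i j => polar_eq_zero_of_isotropic hq (hm i) (hm j))
    refine ⟨κ, inferInstance, t, w, d, ht, hw, h, hli, rfl, ?_⟩
    have := h.linearIndependent.fintype_card_le_finrank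
    rwa [Fintype.card_sum] at this
  obtain ⟨κ, _, t, w, d, ht, hw, h, hli, rfl, hc⟩ := key U hU hqU
  obtain ⟨κ', _, t', w', d', ht', hw', h', hli', rfl, hc'⟩ := key W hW hqW
  have hB := Module.finrank_eq_card_basis (Module.Basis.mk (v := Sum.elim t t')
    (linearIndependent_sum.2 ⟨hli, hli', hUW.disjoint⟩) (by
      rw [Set.Sum.elim_range, Submodule.span_union, hUW.sup_eq_top]))
  rw [Fintype.card_sum] at hB
  exact ⟨κ, inferInstance, t, w, d, ht, hw, h, by omega⟩

end GradedQuadSpace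

end

/-! ### Symbols, splitting bases and subspaces of a normed space -/

section

variable {Γ : Type w} [AddCommGroup Γ] [LinearOrder Γ] [IsOrderedAddMonoid Γ]
  {F : Type u} [Field F] {v : AddValuation F (WithTop Γ)}
  {V : Type u} [AddCommGroup V] [Module F V]

namespace ValueFunction

variable {α : ValueFunction v V} {q : QuadraticForm F V}

theorem le_smul_iff {d : Γ} {x : V} (hd : α x = d) (γ : Γ) (c : F) :
    (γ : WithTop Γ) ≤ α (c • x) ↔ ((γ - d : Γ) : WithTop Γ) ≤ selfValue v c := by
  change _ ↔ _ ≤ v c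
  rw [α.smul, hd]
  induction v c with
  | top => simp
  | coe t => rw [← WithTop.coe_add, WithTop.coe_le_coe, WithTop.coe_le_coe, sub_le_iff_le_add']

theorem lt_smul_iff {d : Γ} {x : V} (hd : α x = d) (γ : Γ) (c : F) :
    (γ : WithTop Γ) < α (c • x) ↔ ((γ - d : Γ) : WithTop Γ) < selfValue v c := by
  change _ ↔ _ < v c
  rw [α.smul, hd]
  induction v c with
  | top =>
    rw [add_top]
    exact iff_of_true (WithTop.coe_lt_top _) (WithTop.coe_lt_top _)
  | coe t => rw [← WithTop.coe_add, WithTop.coe_lt_coe, WithTop.coe_lt_coe, sub_lt_iff_lt_add']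

theorem eq_of_sym_ne_zero {γ : Γ} {x : V} {hx : (γ : WithTop Γ) ≤ α x} (h : α.sym γ x hx ≠ 0) :
    α x = γ :=
  le_antisymm (not_lt.1 (mt (sym_eq_zero _).2 h)) hx

theorem le_sum {κ : Type*} (s : Finset κ) {γ : Γ} {x : κ → V}
    (h : ∀ i ∈ s, (γ : WithTop Γ) ≤ α (x i)) : (γ : WithTop Γ) ≤ α (∑ i ∈ s, x i) :=
  sum_mem (S := α.ge γ) h

theorem inf_le_sum {κ : Type*} (s : Finset κ) (x : κ → V) :
    (s.inf fun i => α (x i)) ≤ α (∑ i ∈ s, x i) := by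
  classical
  induction s using Finset.induction_on with
  | empty => simp [α.map_zero]
  | insert i s hi ih =>
    rw [Finset.sum_insert hi, Finset.inf_insert]
    exact (min_le_min le_rfl ih).trans (α.min_le_add _ _)

theorem sym_smul {γ d : Γ} {c : F} {x : V} (hx : α x = d) (hc : (γ : WithTop Γ) ≤ α (c • x)) :
    α.sym γ (c • x) hc =
      (selfValue v).sym (γ - d) c ((le_smul_iff hx γ c).1 hc) • α.sym d x hx.ge := by
  rw [sym_smul_sym]
  exact sym_congr (sub_add_cancel _ _).symm rfl

theorem sym_sum_smul {κ : Type*} (s : Finset κ) {γ : Γ} {e : κ → V} {d : κ → Γ}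
    (hd : ∀ i, α (e i) = d i) {c : κ → F} (hc : ∀ i, (γ : WithTop Γ) ≤ α (c i • e i)) :
    α.sym γ (∑ i ∈ s, c i • e i) (le_sum s fun i _ => hc i) =
      ∑ i ∈ s, (selfValue v).sym (γ - d i) (c i) ((le_smul_iff (hd i) γ (c i)).1 (hc i)) •
        α.sym (d i) (e i) (hd i).ge := by
  rw [sym_sum s _ hc]
  exact Finset.sum_congr rfl fun i _ => sym_smul (hd i) _

theorem value_of_linearIndependent {κ : Type*} {e : κ → V} {d : κ → Γ}
    {hd : ∀ i, (d i : WithTop Γ) ≤ α (e i)}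
    (hli : LinearIndependent (GrRing v) fun i => α.sym (d i) (e i) (hd i)) (i : κ) :
    α (e i) = d i :=
  eq_of_sym_ne_zero (hli.ne_zero i)

/-- A family with linearly independent symbols splits the value function. -/
theorem split_of_linearIndependent {κ : Type*} [Fintype κ] {e : κ → V} {d : κ → Γ}
    {hd : ∀ i, (d i : WithTop Γ) ≤ α (e i)}
    (hli : LinearIndependent (GrRing v) fun i => α.sym (d i) (e i) (hd i)) (c : κ → F) :
    α (∑ i, c i • e i) = Finset.univ.inf fun i => α (c i • e i) := by
  -- If the sum had value above the minimum `γ` of the values of its terms, the degree `γ` part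
  -- would be a linear relation between the symbols. Its coefficients vanish, so each term has value
  -- above `γ`, which is absurd.
  refine le_antisymm (not_lt.1 fun h => ?_) (inf_le_sum _ _)
  obtain ⟨γ, hγ⟩ := WithTop.ne_top_iff_exists.1 h.ne_top
  have hv := value_of_linearIndependent hli
  have hc : ∀ i, (γ : WithTop Γ) ≤ α (c i • e i) := fun i =>
    hγ ▸ Finset.inf_le (Finset.mem_univ i)
  have h0 := (sym_eq_zero _ (hx := le_sum Finset.univ fun i _ => hc i)).2 (hγ ▸ h)
  rw [sym_sum_smul _ hv hc] at h0
  have h1 := Fintype.linearIndependent_iff.1 hli _ h0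
  refine lt_irrefl (γ : WithTop Γ) ?_
  conv_rhs => rw [hγ]
  rw [Finset.lt_inf_iff (WithTop.coe_lt_top _)]
  exact fun i _ => (lt_smul_iff (hv i) γ (c i)).2 ((sym_eq_zero _).1 (h1 i))

/-- The family splits the value function, so a combination that vanishes, hence has value `⊤`, has
all its terms equal to zero. -/
theorem linearIndependent_of_sym {κ : Type*} [Fintype κ] {e : κ → V} {d : κ → Γ}
    {hd : ∀ i, (d i : WithTop Γ) ≤ α (e i)}
    (hli : LinearIndependent (GrRing v) fun i => α.sym (d i) (e i) (hd i)) :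
    LinearIndependent F e := by
  rw [Fintype.linearIndependent_iff]
  intro c hc i
  have h := split_of_linearIndependent hli c
  rw [hc, α.map_zero] at h
  have h1 := top_le_iff.1 (h.trans_le (Finset.inf_le (Finset.mem_univ i)))
  rw [α.eq_top_iff, smul_eq_zero] at h1
  refine h1.resolve_right fun h0 => ?_
  have := value_of_linearIndependent hli i
  rw [h0, α.map_zero] at this
  exact WithTop.top_ne_coe this

/-- The symbols of a splitting base form a base of the associated graded space. -/
theorem exists_grBasis {κ : Type*} [Fintype κ] (e : Module.Basis κ F V)
    (he : ∀ c : κ → F, α (∑ i, c i • e i) = Finset.univ.inf fun i => α (c i • e i)) {d : κ → Γ}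
    (hd : ∀ i, α (e i) = d i) :
    ∃ B : Module.Basis κ (GrRing v) α.Gr, ∀ i, B i = α.sym (d i) (e i) (hd i).ge := by
  refine ⟨Module.Basis.mk (v := fun i => α.sym (d i) (e i) (hd i).ge) ?_ ?_,
    fun i => Module.Basis.mk_apply _ _ i⟩
  · rw [Fintype.linearIndependent_iff]
    intro a ha i
    refine eq_zero_of_part _ fun ε => ?_
    -- Degree `ε` in the coefficient of the `i`-th symbol is total degree `γ = ε + d i`. Lifting the
    -- part of the relation in this degree to `F` gives a combination of value above `γ`.
    obtain ⟨γ, rfl⟩ : ∃ γ, ε = γ - d i := ⟨ε + d i, by abel⟩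
    choose b hb hab using fun j => exists_part_eq (γ - d j) (a j)
    have hc := fun j => (le_smul_iff (hd j) γ (b j)).2 (hb j)
    have h1 : α.sym γ (∑ j, b j • e j) (le_sum Finset.univ fun i _ => hc i) = 0 := by
      rw [sym_sum_smul _ hd hc, ← _root_.map_zero (α.part γ), ← ha, _root_.map_sum]
      refine Finset.sum_congr rfl fun j _ => ?_
      rw [part_smul_sym, hab]
    rw [sym_eq_zero, he, Finset.lt_inf_iff (WithTop.coe_lt_top _)] at h1
    rw [hab, sym_eq_zero]
    exact (lt_smul_iff (hd i) γ (b i)).1 (h1 i (Finset.mem_univ i))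
  · intro z _
    induction z using gr_induction with
    | h0 => exact Submodule.zero_mem _
    | ha x y hx hy => exact Submodule.add_mem _ (hx trivial) (hy trivial)
    | hs γ x hx =>
      have hxs : ∑ i, e.repr x i • e i = x := e.sum_repr x
      have hi : ∀ i, (γ : WithTop Γ) ≤ α (e.repr x i • e i) := by
        intro i
        rw [← hxs, he] at hx
        exact hx.trans (Finset.inf_le (Finset.mem_univ i))
      rw [← sym_congr (hx := le_sum _ fun i _ => hi i) rfl hxs, sym_sum_smul _ hd hi]
      exact Submodule.sum_mem _ fun i _ =>
        Submodule.smul_mem _ _ (Submodule.subset_span ⟨i, rfl⟩)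

/-- The graded subspace spanned by the symbols of the vectors in a subspace. -/
def grSubmodule (α : ValueFunction v V) (U : Submodule F V) : Submodule (GrRing v) α.Gr :=
  Submodule.span _ (Set.range fun z : {p : Γ × V // (p.1 : WithTop Γ) ≤ α p.2 ∧ p.2 ∈ U} =>
    α.sym z.1.1 z.1.2 z.2.1)

theorem sym_mem_deg {γ : Γ} {x : V} (hx : (γ : WithTop Γ) ≤ α x) : α.sym γ x hx ∈ α.deg γ :=
  (mem_deg_iff _).2 ⟨x, hx, rfl⟩

theorem isHomogeneous_grSubmodule (U : Submodule F V) :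
    (grSubmodule α U).IsHomogeneous α.deg :=
  isHomogeneous_span (grGrading v) (d := fun z => z.1.1) fun z => sym_mem_deg z.2.1

theorem sym_mem_grSubmodule {U : Submodule F V} {γ : Γ} {x : V} (hx : (γ : WithTop Γ) ≤ α x)
    (hU : x ∈ U) : α.sym γ x hx ∈ grSubmodule α U :=
  Submodule.subset_span ⟨⟨(γ, x), hx, hU⟩, rfl⟩

/-- Each homogeneous component of an element of the span is a single symbol from `U`, not merely a
combination of such: lifts of equal degree can be added inside `U`, and scalars lift to `F`. -/
theorem exists_of_mem_grSubmodule {U : Submodule F V} {z : α.Gr} (hz : z ∈ grSubmodule α U)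
    (γ : Γ) : ∃ x, ∃ hx : (γ : WithTop Γ) ≤ α x, x ∈ U ∧ component α.deg γ z = α.sym γ x hx := by
  induction hz using Submodule.closure_induction with
  | zero =>
    refine ⟨0, by simp [α.map_zero], zero_mem _, ?_⟩
    rw [_root_.map_zero, eq_comm, sym_eq_zero, α.map_zero]
    exact WithTop.coe_lt_top _
  | add z z' _ _ hz hz' =>
    obtain ⟨x, hx, hxU, h⟩ := hz
    obtain ⟨x', hx', hxU', h'⟩ := hz'
    exact ⟨x + x', α.le_add hx hx', add_mem hxU hxU', by rw [_root_.map_add, h, h', sym_add]⟩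
  | smul_mem a z hz =>
    obtain ⟨⟨⟨δ, x⟩, hx, hxU⟩, rfl⟩ := hz
    obtain ⟨b, hb, h⟩ := (mem_deg_iff _).1 (component_mem (ℳ := grGrading v) (γ - δ) a)
    refine ⟨b • x, ?_, U.smul_mem b hxU, ?_⟩
    · exact (sub_add_cancel γ δ ▸ coe_add_le hb hx).trans (le_smul α b x)
    · rw [component_smul (𝒜 := grGrading v) a (sym_mem_deg hx), ← h, sym_smul_sym]
      exact sym_congr (sub_add_cancel _ _) rfl

/-- A subspace of a normed space has a base with linearly independent symbols. -/
theorem IsNorm.exists_adapted_basis (hα : α.IsNorm) (U : Submodule F V) :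
    ∃ (κ : Type) (_ : Fintype κ) (e : κ → V) (d : κ → Γ)
      (hd : ∀ i, (d i : WithTop Γ) ≤ α (e i)), (∀ i, e i ∈ U) ∧
      (LinearIndependent (GrRing v) fun i => α.sym (d i) (e i) (hd i)) ∧
      U ≤ Submodule.span F (Set.range e) := by
  classical
  have := hα.finite
  have := hα.free
  have hfin : FiniteDimensional F V := by
    obtain ⟨_, _, e, -⟩ := hα
    exact Module.Finite.of_basis e
  -- A homogeneous base of the graded space of `U` is extended to one of the whole graded space. All
  -- its members are then lifted, those in the graded space of `U` to vectors of `U`.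
  obtain ⟨κ, _, t, d, ht, hli, hs⟩ :=
    exists_homogeneous_generators (grGrading v) (isHomogeneous_grSubmodule (α := α) U)
  obtain ⟨κ', _, f, t', d', rfl, rfl, ht', hli', hs'⟩ :=
    exists_extension (grGrading v) (N := ⊤) (fun _ _ _ => Submodule.mem_top) ht
      (fun _ => Submodule.mem_top) hli
  have hlift : ∀ i, ∃ x, ∃ hx : (d' i : WithTop Γ) ≤ α x,
      (t' i ∈ grSubmodule α U → x ∈ U) ∧ α.sym (d' i) x hx = t' i := fun i => by
    by_cases h : t' i ∈ grSubmodule α U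
    · obtain ⟨x, hx, hxU, h'⟩ := exists_of_mem_grSubmodule h (d' i)
      exact ⟨x, hx, fun _ => hxU, by rw [← h', component_same (ht' i)]⟩
    · obtain ⟨x, hx, h'⟩ := (mem_deg_iff _).1 (ht' i)
      exact ⟨x, hx, fun h'' => absurd h'' h, h'⟩
  choose e hd heU he using hlift
  have het : t' = fun i => α.sym (d' i) (e i) (hd i) := funext fun i => (he i).symm
  subst het
  have hfU : ∀ i, e (f i) ∈ U := fun i => heU _ (hs ▸ Submodule.subset_span ⟨i, rfl⟩)
  refine ⟨κ, inferInstance, e ∘ f, d' ∘ f, fun i => hd (f i), hfU, hli, fun x hx => ?_⟩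
  have hc : Fintype.card κ' = Module.finrank F V := by
    rw [← hα.finrank_eq, Module.finrank_eq_card_basis (Module.Basis.mk hli' hs'.ge)]
  have htop := (linearIndependent_of_sym hli').span_eq_top_of_card_eq_finrank' hc
  obtain ⟨c, rfl⟩ := (Submodule.mem_span_range_iff_exists_fun F).1 (htop ▸ Submodule.mem_top (x := x))
  -- `c'` deletes the coordinates along the lifts chosen in `U`. What remains of `x` is still in
  -- `U`, and it is to be shown to vanish.
  set c' : κ' → F := fun i => if i ∈ Set.range f then 0 else c i with hc'
  have hsub : ∀ i, (c i - c' i) • e i = 0 ∨ i ∈ Set.range f := fun i => by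
    by_cases h : i ∈ Set.range f
    · exact Or.inr h
    · left; simp only [hc', if_neg h, sub_self, zero_smul]
  have hdiff : ∑ i, c i • e i = ∑ i, (c i - c' i) • e i + ∑ i, c' i • e i := by
    rw [← Finset.sum_add_distrib]
    exact Finset.sum_congr rfl fun i _ => by rw [← add_smul, sub_add_cancel]
  have hU' : ∑ i, (c i - c' i) • e i ∈ U := Submodule.sum_mem _ fun i _ => by
    rcases hsub i with h | ⟨j, rfl⟩
    · rw [h]; exact zero_mem _
    · exact U.smul_mem _ (hfU j)
  have hx' : ∑ i, c' i • e i ∈ U := by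
    rw [hdiff] at hx
    exact (Submodule.add_mem_iff_right _ hU').1 hx
  have h0 : ∑ i, c' i • e i = 0 := by
    by_contra hne
    obtain ⟨γ, hγ⟩ := WithTop.ne_top_iff_exists.1 (mt (α.eq_top_iff _).1 hne)
    have hi : ∀ i, (γ : WithTop Γ) ≤ α (c' i • e i) := fun i => by
      rw [hγ, split_of_linearIndependent hli']; exact Finset.inf_le (Finset.mem_univ i)
    refine ((sym_eq_zero _ (hx := hγ.le)).1 ?_).ne hγ
    -- The symbol of the remainder lies in the graded space of `U` and in the span of the
    -- complementary symbols. These meet in zero, but the symbol in the degree of its value is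
    -- nonzero.
    have h1 := sym_mem_grSubmodule hγ.le hx'
    rw [← hs, Set.range_comp] at h1
    refine Submodule.disjoint_def.1 (hli'.disjoint_span_image
      (disjoint_compl_right (a := Set.range f))) _ h1 ?_
    rw [sym_sum_smul Finset.univ (value_of_linearIndependent hli') hi]
    refine Submodule.sum_mem _ fun i _ => ?_
    by_cases h : i ∈ Set.range f
    · rw [(sym_eq_zero _).2, zero_smul]
      · exact zero_mem _
      · change _ < v (c' i)
        rw [show c' i = 0 from if_pos h, v.map_zero]
        exact WithTop.coe_lt_top _
    · exact Submodule.smul_mem _ _ (Submodule.subset_span ⟨i, h, rfl⟩)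
  rw [hdiff, h0, add_zero]
  refine Submodule.sum_mem _ fun i _ => ?_
  rcases hsub i with h | ⟨j, rfl⟩
  · rw [h]; exact zero_mem _
  · exact Submodule.smul_mem _ _ (Submodule.subset_span ⟨j, rfl⟩)

/-- A nonzero vector of the radical of `q` would have a nonzero symbol in the radical of the graded
form. -/
theorem IsTameNorm.isNonsingular (hα : α.IsTameNorm q) : IsNonsingular q := by
  intro x hx
  by_contra h0
  obtain ⟨γ, hγ⟩ := WithTop.ne_top_iff_exists.1 (mt (α.eq_top_iff x).1 h0)
  have h1 : α.sym γ x hγ.le = 0 := hα.nonsingular _ fun z => by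
    rw [BoundedBy.polar_grForm]
    induction z using gr_induction with
    | h0 => exact _root_.map_zero _
    | ha y z hy hz => rw [_root_.map_add, hy, hz, add_zero]
    | hs δ y hy =>
      rw [BoundedBy.grPolar_sym_sym, sym_eq_zero, hx]
      exact (WithTop.coe_lt_top _).trans_eq v.map_zero.symm
  exact ((sym_eq_zero _).1 h1).ne hγ

end ValueFunction

end

/-! ### From hyperbolic spaces to hyperbolic graded spaces -/

section

variable {Γ : Type w} [AddCommGroup Γ] [LinearOrder Γ] [IsOrderedAddMonoid Γ]
  {F : Type u} [Field F] {v : AddValuation F (WithTop Γ)}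
  {V : Type u} [AddCommGroup V] [Module F V]

/-- The graded space of a hyperbolic space with a tame norm is hyperbolic. -/
theorem isHyperbolic_grSpace {X : QuadSpace F} (hX : X.IsHyperbolic)
    {α : ValueFunction v X.carrier} (hα : α.IsTameNorm X.form) :
    (grSpace X α hα).IsHyperbolic := by
  obtain ⟨U, W, hUW, hU, hW⟩ := hX
  -- One isotropic subspace of at least half the dimension is enough, and one of the two given
  -- summands is such. The symbols of an adapted base are isotropic because zero has value `⊤`.
  have key : ∀ U : Submodule F X.carrier, (∀ x ∈ U, X.form x = 0) →
      Module.finrank F X.carrier ≤ Module.finrank F U + Module.finrank F U →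
      (grSpace X α hα).IsHyperbolic := by
    intro U hU hdim
    obtain ⟨κ, _, e, d, hd, heU, hli, hs⟩ := hα.isNorm.exists_adapted_basis U
    have hc : Module.finrank F U ≤ Fintype.card κ :=
      (Submodule.finrank_mono hs).trans (finrank_range_le_card e)
    refine (grSpace X α hα).isHyperbolic_of_isotropic_family
      (fun i => ValueFunction.sym_mem_deg (hd i)) hli (fun i => ?_) (fun i j => ?_) ?_
    · refine (hα.bounded.grFun_sym (hd i)).trans ((ValueFunction.sym_eq_zero _).2 ?_)
      rw [hU _ (heU i)]
      exact (WithTop.coe_lt_top _).trans_eq v.map_zero.symm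
    · refine (hα.bounded.polar_grForm _ _).trans ((hα.bounded.grPolar_sym_sym (hd i) (hd j)).trans
        ((ValueFunction.sym_eq_zero _).2 ?_))
      rw [polar_eq_zero_of_isotropic hU (heU i) (heU j)]
      exact (WithTop.coe_lt_top _).trans_eq v.map_zero.symm
    · have : Module.finrank (GrRing v) (grSpace X α hα).carrier = Module.finrank F X.carrier :=
        hα.isNorm.finrank_eq
      omega
  have hsum := Submodule.finrank_add_eq_of_isCompl hUW
  rcases le_total (Module.finrank F U) (Module.finrank F W) with h | h
  · exact key W hW (by omega)
  · exact key U hU (by omega)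

/-! ### Value estimates and Hensel's lemma for one hyperbolic pair -/

theorem lt_mul {γ δ ε : Γ} {a b : F} (ha : (γ : WithTop Γ) < v a) (hb : (δ : WithTop Γ) ≤ v b)
    (h : γ + δ = ε) : (ε : WithTop Γ) < v (a * b) := by
  rw [v.map_mul, ← h]; exact coe_add_lt ha hb

theorem lt_mul' {γ δ ε : Γ} {a b : F} (ha : (γ : WithTop Γ) ≤ v a) (hb : (δ : WithTop Γ) < v b)
    (h : γ + δ = ε) : (ε : WithTop Γ) < v (a * b) := by
  rw [mul_comm]; exact lt_mul hb ha (by rw [← h, add_comm])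

theorem le_mul {γ δ ε : Γ} {a b : F} (ha : (γ : WithTop Γ) ≤ v a) (hb : (δ : WithTop Γ) ≤ v b)
    (h : γ + δ = ε) : (ε : WithTop Γ) ≤ v (a * b) := by
  rw [v.map_mul, ← h]; exact coe_add_le ha hb

theorem lt_sub {γ : WithTop Γ} {a b : F} (ha : γ < v a) (hb : γ < v b) : γ < v (a - b) := by
  rw [sub_eq_add_neg]; exact v.map_lt_add ha (by rwa [v.map_neg])

theorem value_eq_zero {a : F} (ha : 0 < v (a - 1)) : v a = 0 := by
  have h := v.map_add_eq_of_lt_left (x := 1) (y := a - 1) (by rwa [v.map_one])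
  rwa [add_sub_cancel, v.map_one] at h

theorem value_inv_eq_zero {a : F} (ha : v a = 0) : v a⁻¹ = 0 := by
  have h0 : a ≠ 0 := by rintro rfl; simp at ha
  have := v.map_mul a a⁻¹
  rw [mul_inv_cancel₀ h0, v.map_one, ha, zero_add] at this
  exact this.symm

/-- Put `s = r⁻¹`: the equation becomes the monic `r ^ 2 + r + c = 0`. Modulo the maximal ideal `-1`
is a root, and a simple one in every residue characteristic, since the derivative `2 * r + 1` takes
the value `-1` there. -/
theorem exists_root_of_henselian (hv : HenselianLocalRing v.toValuation.valuationSubring)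
    {c : F} (hc : 0 < v c) : ∃ s, v s = 0 ∧ c * s ^ 2 + s + 1 = 0 := by
  -- `toValuation` reverses the order, so that membership in its valuation ring is `0 ≤ v a` by
  -- definition.
  have hmem : ∀ a : F, 0 ≤ v a → a ∈ v.toValuation.valuationSubring := fun a ha => ha
  have hmax : ∀ a : v.toValuation.valuationSubring,
      a ∈ IsLocalRing.maximalIdeal v.toValuation.valuationSubring ↔ 0 < v (a : F) := by
    intro a
    have ha : 0 ≤ v (a : F) := a.2
    rw [IsLocalRing.mem_maximalIdeal, mem_nonunits_iff]
    refine ⟨fun h => lt_of_le_of_ne ha fun h0 => h ?_, fun h hu => ?_⟩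
    · have ha0 : (a : F) ≠ 0 := by intro h1; simp [h1] at h0
      exact IsUnit.of_mul_eq_one ⟨(a : F)⁻¹, hmem _ (value_inv_eq_zero h0.symm).ge⟩
        (Subtype.ext (mul_inv_cancel₀ ha0))
    · obtain ⟨b, hb⟩ := hu.exists_right_inv
      have hb0 : 0 ≤ v (b : F) := b.2
      have h1 : (a : F) * b = 1 := congrArg Subtype.val hb
      have h2 := v.map_mul (a : F) b
      rw [h1, v.map_one] at h2
      exact (h.trans_le (le_add_of_nonneg_right hb0)).ne h2
  let C : v.toValuation.valuationSubring := ⟨c, hmem c hc.le⟩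
  obtain ⟨r, hr, hr1⟩ := hv.is_henselian (Polynomial.X ^ 2 + Polynomial.X + Polynomial.C C)
    (by monicity!) (-1) (by rw [hmax]; simpa [C] using hc)
    (by simp)
  have h1 : 0 < v ((r : F) - -1) := (hmax _).1 hr1
  have h2 : v (r : F) = 0 := by
    rw [← v.map_neg]
    refine value_eq_zero ?_
    rw [← v.map_neg]
    convert h1 using 2
    ring
  have h3 : (r : F) ^ 2 + r + c = 0 := by
    have := congrArg Subtype.val hr.eq_zero
    simpa [C] using this
  have hr0 : (r : F) ≠ 0 := by intro h; simp [h] at h2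
  refine ⟨(r : F)⁻¹, value_inv_eq_zero h2, ?_⟩
  field_simp
  linear_combination h3

variable {α : ValueFunction v V} {q : QuadraticForm F V}

/-- Two vectors that form a hyperbolic pair up to vectors of higher value can be corrected to a
hyperbolic pair, over a Henselian field. -/
theorem exists_hyperbolic_pair (hv : HenselianLocalRing v.toValuation.valuationSubring)
    (h : α.BoundedBy q) {x y : V} {γ : Γ} (hy : ((-γ : Γ) : WithTop Γ) ≤ α y)
    (hxy : 0 < v (QuadraticMap.polar q x y - 1)) (hqx : ((2 • γ : Γ) : WithTop Γ) < v (q x)) :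
    ∃ t a c : F, ((2 • γ : Γ) : WithTop Γ) < v t ∧ 0 ≤ v a ∧
      ((-(2 • γ) : Γ) : WithTop Γ) ≤ v c ∧ q (x + t • y) = 0 ∧
      q (a • y + c • (x + t • y)) = 0 ∧
      QuadraticMap.polar q (x + t • y) (a • y + c • (x + t • y)) = 1 := by
  set b := QuadraticMap.polar q x y with hb
  have hqy : ((-(2 • γ) : Γ) : WithTop Γ) ≤ v (q y) := by
    have := h.le_form hy
    rwa [smul_neg] at this
  have hvb := value_eq_zero hxy
  have hb0 : b ≠ 0 := by intro h; simp [h] at hvb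
  have hz : ∀ {a : F}, v a = 0 → ((0 : Γ) : WithTop Γ) ≤ v a := fun h => by rw [h, WithTop.coe_zero]
  -- With `t = s * b⁻¹ * q x` one has `q (x + t • y) = q x * (c * s ^ 2 + s + 1)`. Here `v c > 0`
  -- because `v b = 0`, `v (q x) > 2 • γ` and `v (q y) ≥ -(2 • γ)`.
  obtain ⟨s, hs, hs'⟩ := exists_root_of_henselian hv (c := q x * q y * b⁻¹ ^ 2) (by
    rw [← WithTop.coe_zero]
    refine lt_mul (δ := 0) (lt_mul (ε := 0) hqx hqy (by abel)) ?_ (by abel)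
    exact hz (by rw [v.map_pow, value_inv_eq_zero hvb, smul_zero]))
  have ht : ((2 • γ : Γ) : WithTop Γ) < v (s * b⁻¹ * q x) := by
    refine lt_mul' (γ := 0) (hz ?_) hqx (by abel)
    rw [v.map_mul, hs, value_inv_eq_zero hvb, add_zero]
  set t := s * b⁻¹ * q x with htdef
  have hqx' : q (x + t • y) = 0 := by
    rw [QuadraticMap.map_add q, QuadraticMap.map_smul, QuadraticMap.polar_smul_right, ← hb,
      smul_eq_mul, smul_eq_mul]
    have : q x + t * t * q y + t * b =
        q x * (q x * q y * b⁻¹ ^ 2 * s ^ 2 + s * (b⁻¹ * b) + 1) := by rw [htdef]; ring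
    rw [this, inv_mul_cancel₀ hb0, mul_one, hs', mul_zero]
  -- The correction changes `b` by `2 * t * q y`, of positive value, so `b'` is still a unit.
  set b' := QuadraticMap.polar q (x + t • y) y with hb'
  have hb'eq : b' = b + t * (2 * q y) := by
    rw [hb', QuadraticMap.polar_add_left, QuadraticMap.polar_smul_left, QuadraticMap.polar_self,
      ← hb, smul_eq_mul, two_nsmul, two_mul]
  have hvb' : v b' = 0 := by
    refine value_eq_zero ?_
    rw [hb'eq, add_sub_right_comm]
    refine v.map_lt_add hxy ?_
    rw [← WithTop.coe_zero]
    refine lt_mul ht ?_ (add_neg_cancel (2 • γ))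
    rw [two_mul]
    exact v.map_le_add hqy hqy
  have hb'0 : b' ≠ 0 := by intro h; simp [h] at hvb'
  -- Scaling `y` by `b'⁻¹` normalizes the polar value; subtracting the multiple `b'⁻¹ ^ 2 * q y` of
  -- the isotropic vector then makes the second vector isotropic.
  refine ⟨t, b'⁻¹, -(b'⁻¹ ^ 2 * q y), ht, (value_inv_eq_zero hvb').ge, ?_, hqx', ?_, ?_⟩
  · rw [v.map_neg]
    refine le_mul (γ := 0) (hz ?_) hqy (by abel)
    rw [v.map_pow, value_inv_eq_zero hvb', smul_zero]
  · rw [QuadraticMap.map_add q, QuadraticMap.map_smul, QuadraticMap.map_smul, hqx',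
      QuadraticMap.polar_smul_right, QuadraticMap.polar_smul_left, QuadraticMap.polar_comm, ← hb']
    simp only [smul_eq_mul]
    field_simp
    ring
  · rw [QuadraticMap.polar_add_right, QuadraticMap.polar_smul_right,
      QuadraticMap.polar_smul_right, QuadraticMap.polar_self, hqx', ← hb']
    simp [hb'0]

/-- The vectors on the left are the projections of `z` and `w` to the orthogonal complement of the
hyperbolic plane of `x` and `y`. Each error term is a product of two pairings with the plane, hence
small when one factor is small and the other bounded. -/
theorem polar_project {x y : V} (hx : q x = 0) (hy : q y = 0) (hxy : QuadraticMap.polar q x y = 1)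
    (z w : V) :
    QuadraticMap.polar q (z - QuadraticMap.polar q z y • x - QuadraticMap.polar q z x • y)
      (w - QuadraticMap.polar q w y • x - QuadraticMap.polar q w x • y) =
    QuadraticMap.polar q z w - QuadraticMap.polar q z y * QuadraticMap.polar q w x -
      QuadraticMap.polar q z x * QuadraticMap.polar q w y := by
  simp only [QuadraticMap.polar_sub_left, QuadraticMap.polar_sub_right,
    QuadraticMap.polar_smul_left, QuadraticMap.polar_smul_right, QuadraticMap.polar_self, hx, hy,
    hxy, QuadraticMap.polar_comm q y x, QuadraticMap.polar_comm q x w,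
    QuadraticMap.polar_comm q y w, smul_eq_mul]
  ring

theorem form_project {x y : V} (hx : q x = 0) (hy : q y = 0) (hxy : QuadraticMap.polar q x y = 1)
    (z : V) :
    q (z - QuadraticMap.polar q z y • x - QuadraticMap.polar q z x • y) =
      q z - QuadraticMap.polar q z y * QuadraticMap.polar q z x := by
  simp only [sub_eq_add_neg, QuadraticMap.map_add q, QuadraticMap.map_neg, QuadraticMap.map_smul,
    QuadraticMap.polar_add_left, QuadraticMap.polar_neg_left, QuadraticMap.polar_neg_right,
    QuadraticMap.polar_smul_left, QuadraticMap.polar_smul_right, hx, hy, hxy, smul_eq_mul]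
  ring

end

/-! ### Lifting hyperbolic graded spaces over a Henselian field -/

section

variable {Γ : Type w} [AddCommGroup Γ] [LinearOrder Γ] [IsOrderedAddMonoid Γ]
  {F : Type u} [Field F] {v : AddValuation F (WithTop Γ)}
  {V : Type u} [AddCommGroup V] [Module F V] {α : ValueFunction v V} {q : QuadraticForm F V}

namespace ValueFunction

theorem le_smul_of_le {γ δ ε : Γ} {a : F} {x : V} (ha : (γ : WithTop Γ) ≤ v a)
    (hx : (δ : WithTop Γ) ≤ α x) (h : γ + δ = ε) : (ε : WithTop Γ) ≤ α (a • x) := by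
  rw [← h]; exact (coe_add_le ha hx).trans (le_smul α a x)

theorem le_sub {γ : Γ} {x y : V} (hx : (γ : WithTop Γ) ≤ α x) (hy : (γ : WithTop Γ) ≤ α y) :
    (γ : WithTop Γ) ≤ α (x - y) := by
  rw [sub_eq_add_neg]; exact α.le_add hx (by rwa [α.map_neg])

/-- The two degrees are kept apart because it is applied to degrees such as `γ + -γ` and `0`, whose
equality is not definitional. -/
theorem lt_sub_of_sym_eq {γ δ : Γ} {x y : V} {hx : (γ : WithTop Γ) ≤ α x}
    {hy : (δ : WithTop Γ) ≤ α y} (h : α.sym γ x hx = α.sym δ y hy) (e : γ = δ) :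
    (γ : WithTop Γ) < α (x - y) := by
  subst e
  have h1 := α.sym_add (le_sub hx hy) hy
  rw [sym_congr (hy := hx) rfl (sub_add_cancel x y), h] at h1
  exact (sym_eq_zero _).1 (right_eq_add.1 h1)

theorem BoundedBy.le_polar (h : α.BoundedBy q) {γ δ ε : Γ} {x y : V} (hx : (γ : WithTop Γ) ≤ α x)
    (hy : (δ : WithTop Γ) ≤ α y) (e : γ + δ = ε) :
    (ε : WithTop Γ) ≤ v (QuadraticMap.polar q x y) := by
  rw [← e]; exact (coe_add_le hx hy).trans (h.polar_le x y)

end ValueFunction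

/-- Over a Henselian field, a family that is hyperbolic up to vectors of higher value gives rise to
a hyperbolic family. -/
theorem exists_isHyperbolicFamily_of_approx
    (hv : HenselianLocalRing v.toValuation.valuationSubring) (h : α.BoundedBy q) (m : ℕ)
    (N : Submodule F V) (e f : Fin m → V) (γ : Fin m → Γ) (heN : ∀ i, e i ∈ N)
    (hfN : ∀ i, f i ∈ N) (he : ∀ i, (γ i : WithTop Γ) ≤ α (e i))
    (hf : ∀ i, ((-γ i : Γ) : WithTop Γ) ≤ α (f i))
    (hef : ∀ i j, ((γ i - γ j : Γ) : WithTop Γ) <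
      v (QuadraticMap.polar q (e i) (f j) - if i = j then 1 else 0))
    (hee : ∀ i j, ((γ i + γ j : Γ) : WithTop Γ) < v (QuadraticMap.polar q (e i) (e j)))
    (hqe : ∀ i, ((2 • γ i : Γ) : WithTop Γ) < v (q (e i))) :
    ∃ e' f' : Fin m → V, (∀ i, e' i ∈ N) ∧ (∀ i, f' i ∈ N) ∧ IsHyperbolicFamily q e' f' := by
  -- The subspace `N` records orthogonality to the pairs already corrected: at each step it is cut
  -- down by the orthogonal complement of the new plane.
  induction m generalizing N with
  | zero => exact ⟨e, f, heN, hfN, by constructor <;> exact fun i => i.elim0⟩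
  | succ m ih =>
    -- The first pair is corrected exactly. The estimates that follow show that the corrected pair
    -- still satisfies the norm bounds and is orthogonal to the other vectors up to higher value,
    -- except for one pairing.
    obtain ⟨t, a, c, ht, ha, hc, hqx, hqy, hxy⟩ := exists_hyperbolic_pair hv h (hf 0)
      (by simpa using hef 0 0) (hqe 0)
    have ha' : ((0 : Γ) : WithTop Γ) ≤ v a := by rwa [WithTop.coe_zero]
    have hxα : (γ 0 : WithTop Γ) ≤ α (e 0 + t • f 0) :=
      α.le_add (he 0) (ValueFunction.le_smul_of_le ht.le (hf 0) (by abel))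
    have hxN : e 0 + t • f 0 ∈ N := add_mem (heN 0) (N.smul_mem t (hfN 0))
    have hex : ∀ i : Fin m, ((γ i.succ + γ 0 : Γ) : WithTop Γ) <
        v (QuadraticMap.polar q (e i.succ) (e 0 + t • f 0)) := fun i => by
      rw [QuadraticMap.polar_add_right, QuadraticMap.polar_smul_right, smul_eq_mul]
      refine v.map_lt_add (hee _ _) (lt_mul ht (δ := γ i.succ - γ 0) ?_ (by abel))
      simpa [Fin.succ_ne_zero] using (hef i.succ 0).le
    have hfx : ∀ i : Fin m, ((γ 0 - γ i.succ : Γ) : WithTop Γ) <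
        v (QuadraticMap.polar q (f i.succ) (e 0 + t • f 0)) := fun i => by
      rw [QuadraticMap.polar_add_right, QuadraticMap.polar_smul_right, smul_eq_mul]
      refine v.map_lt_add ?_ (lt_mul ht (h.le_polar (hf _) (hf _) rfl) (by abel))
      rw [QuadraticMap.polar_comm]
      simpa [(Fin.succ_ne_zero i).symm] using hef 0 i.succ
    have hyα : ((-γ 0 : Γ) : WithTop Γ) ≤ α (a • f 0 + c • (e 0 + t • f 0)) :=
      α.le_add (ValueFunction.le_smul_of_le ha' (hf 0) (by abel))
        (ValueFunction.le_smul_of_le hc hxα (by abel))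
    have hyN : a • f 0 + c • (e 0 + t • f 0) ∈ N :=
      add_mem (N.smul_mem _ (hfN 0)) (N.smul_mem _ hxN)
    have hey : ∀ i : Fin m, ((γ i.succ - γ 0 : Γ) : WithTop Γ) <
        v (QuadraticMap.polar q (e i.succ) (a • f 0 + c • (e 0 + t • f 0))) := fun i => by
      rw [QuadraticMap.polar_add_right, QuadraticMap.polar_smul_right,
        QuadraticMap.polar_smul_right, smul_eq_mul, smul_eq_mul]
      refine v.map_lt_add (lt_mul' ha' (δ := γ i.succ - γ 0) ?_ (by abel))
        (lt_mul' hc (hex i) (by abel))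
      simpa [Fin.succ_ne_zero] using hef i.succ 0
    -- Only a weak bound is available here, as nothing is assumed about the vectors `f` among
    -- themselves. It suffices, because in the new hypotheses this pairing occurs only multiplied by
    -- a strictly small factor or in a norm bound.
    have hfy : ∀ i : Fin m, ((-γ i.succ - γ 0 : Γ) : WithTop Γ) ≤
        v (QuadraticMap.polar q (f i.succ) (a • f 0 + c • (e 0 + t • f 0))) := fun i =>
      h.le_polar (hf _) hyα (by abel)
    -- From here on only the estimates and the exact hyperbolic relations matter, not the formulas
    -- for the corrected pair.
    generalize a • f 0 + c • (e 0 + t • f 0) = y at *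
    generalize e 0 + t • f 0 = x at *
    let π : V → V := fun z => z - QuadraticMap.polar q z y • x - QuadraticMap.polar q z x • y
    let N' : Submodule F V := N ⊓ LinearMap.ker (QuadraticMap.polarBilin q x) ⊓
      LinearMap.ker (QuadraticMap.polarBilin q y)
    have hN' : ∀ z ∈ N', z ∈ N ∧ QuadraticMap.polar q x z = 0 ∧ QuadraticMap.polar q y z = 0 :=
      fun z hz => ⟨hz.1.1, hz.1.2, hz.2⟩
    have hπ : ∀ z ∈ N, π z ∈ N' := fun z hz => by
      refine ⟨⟨sub_mem (sub_mem hz (N.smul_mem _ hxN)) (N.smul_mem _ hyN), ?_⟩, ?_⟩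
      · change QuadraticMap.polar q x (π z) = 0
        simp [π, QuadraticMap.polar_sub_right, QuadraticMap.polar_self, hqx, hxy,
          QuadraticMap.polar_comm q x z]
      · change QuadraticMap.polar q y (π z) = 0
        simp [π, QuadraticMap.polar_sub_right, QuadraticMap.polar_self, hqy,
          QuadraticMap.polar_comm q y x, hxy, QuadraticMap.polar_comm q y z]
    obtain ⟨e', f', he', hf', H⟩ := ih N' (fun i => π (e i.succ)) (fun i => π (f i.succ))
      (fun i => γ i.succ) (fun i => hπ _ (heN _)) (fun i => hπ _ (hfN _))
      (fun i => ValueFunction.le_sub (ValueFunction.le_sub (he _)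
        (ValueFunction.le_smul_of_le (hey i).le hxα (by abel)))
        (ValueFunction.le_smul_of_le (hex i).le hyα (by abel)))
      (fun i => ValueFunction.le_sub (ValueFunction.le_sub (hf _)
        (ValueFunction.le_smul_of_le (hfy i) hxα (by abel)))
        (ValueFunction.le_smul_of_le (hfx i).le hyα (by abel)))
      (fun i j => by
        rw [polar_project hqx hqy hxy, sub_right_comm, sub_right_comm _ _ (ite _ _ _)]
        refine lt_sub (lt_sub ?_ (lt_mul (hey i) (hfx j).le (by abel)))
          (lt_mul (hex i) (hfy j) (by abel))
        simpa using hef i.succ j.succ)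
      (fun i j => by
        rw [polar_project hqx hqy hxy]
        exact lt_sub (lt_sub (hee _ _) (lt_mul (hey i) (hex j).le (by abel)))
          (lt_mul (hex i) (hey j).le (by abel)))
      (fun i => by
        rw [form_project hqx hqy hxy]
        exact lt_sub (hqe _) (lt_mul (hey i) (hex i).le (by abel)))
    refine ⟨Fin.cons x e', Fin.cons y f', ?_, ?_, ?_, ?_, ?_, ?_, ?_, ?_⟩
    · exact Fin.cases hxN fun i => (hN' _ (he' i)).1
    · exact Fin.cases hyN fun i => (hN' _ (hf' i)).1
    · exact Fin.cases hqx H.form_left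
    · exact Fin.cases hqy H.form_right
    · refine Fin.cases (Fin.cases ?_ fun j => (hN' _ (he' j)).2.1) fun i =>
        Fin.cases ?_ (H.polar_left i)
      · simp [QuadraticMap.polar_self, hqx]
      · rw [QuadraticMap.polar_comm]; exact (hN' _ (he' i)).2.1
    · refine Fin.cases (Fin.cases ?_ fun j => (hN' _ (hf' j)).2.2) fun i =>
        Fin.cases ?_ (H.polar_right i)
      · simp [QuadraticMap.polar_self, hqy]
      · rw [QuadraticMap.polar_comm]; exact (hN' _ (hf' i)).2.2
    · exact Fin.cases hxy H.polar_same
    · refine Fin.cases (Fin.cases (fun h => absurd rfl h) fun j _ => (hN' _ (hf' j)).2.1) fun i =>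
        Fin.cases (fun _ => ?_) fun j hij => H.polar_ne i j fun h => hij (by rw [h])
      rw [QuadraticMap.polar_comm]; exact (hN' _ (he' i)).2.2

/-- Over a Henselian field, a space with a tame norm whose graded space is hyperbolic is
hyperbolic. -/
theorem isHyperbolic_of_grSpace (hv : HenselianLocalRing v.toValuation.valuationSubring)
    {X : QuadSpace F} {α : ValueFunction v X.carrier} (hα : α.IsTameNorm X.form)
    (hX : (grSpace X α hα).IsHyperbolic) : X.IsHyperbolic := by
  obtain ⟨κ, _, t, w, d, ht, hw, H, hc⟩ := hX.exists_family
  choose e he het using fun i => (ValueFunction.mem_deg_iff α).1 (ht i)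
  choose f hf hfw using fun i => (ValueFunction.mem_deg_iff α).1 (hw i)
  have hq : ∀ z : α.Gr, (grSpace X α hα).form z = hα.bounded.grFun z := fun z => rfl
  have hp : ∀ z z' : α.Gr, QuadraticMap.polar (grSpace X α hα).form z z' =
    hα.bounded.grPolar z z' := hα.bounded.polar_grForm
  -- An equality of symbols in the graded space says that the lifts agree up to strictly higher
  -- value, which is the form of the approximate relations.
  obtain ⟨e', f', -, -, H'⟩ := exists_isHyperbolicFamily_of_approx hv hα.bounded (Fintype.card κ) ⊤
    (e ∘ (Fintype.equivFin κ).symm) (f ∘ (Fintype.equivFin κ).symm)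
    (d ∘ (Fintype.equivFin κ).symm) (fun _ => Submodule.mem_top) (fun _ => Submodule.mem_top)
    (fun i => he _) (fun i => hf _)
    (fun i j => by
      split_ifs with hij
      · subst hij
        have := H.polar_same ((Fintype.equivFin κ).symm i)
        rw [← het, ← hfw, hp, ValueFunction.BoundedBy.grPolar_sym_sym, one_eq_sym] at this
        rw [sub_eq_add_neg]
        exact ValueFunction.lt_sub_of_sym_eq this (add_neg_cancel _)
      · have := H.polar_ne _ _ ((Fintype.equivFin κ).symm.injective.ne hij)
        rw [← het, ← hfw, hp, ValueFunction.BoundedBy.grPolar_sym_sym,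
          ValueFunction.sym_eq_zero] at this
        rw [sub_zero, sub_eq_add_neg]
        exact this)
    (fun i j => by
      have := H.polar_left ((Fintype.equivFin κ).symm i) ((Fintype.equivFin κ).symm j)
      rw [← het, ← het, hp, ValueFunction.BoundedBy.grPolar_sym_sym,
        ValueFunction.sym_eq_zero] at this
      exact this)
    (fun i => by
      have := H.form_left ((Fintype.equivFin κ).symm i)
      rw [← het, hq, ValueFunction.BoundedBy.grFun_sym, ValueFunction.sym_eq_zero] at this
      exact this)
  -- The lifted family has as many members as the graded one, and the graded space has the same
  -- dimension as the space.
  have hs := H'.linearIndependent.span_eq_top_of_card_eq_finrank' (by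
    rw [Fintype.card_sum, Fintype.card_fin, ← hc]; exact hα.isNorm.finrank_eq)
  exact ⟨_, _, H'.isCompl hs, H'.form_span_left, H'.symm.form_span_left⟩

end

/-! ### Comparing gradings and forms on generators -/

/-- By `component_map` the isomorphism commutes with taking components; injectivity then gives the
converse direction. -/
theorem mem_iff_of_map_generators {ι : Type w} [AddCommGroup ι] [DecidableEq ι] {A : Type u}
    [CommRing A] {M : Type*} [AddCommGroup M] [Module A M] {ℳ : ι → AddSubgroup M}
    [DirectSum.Decomposition ℳ] (𝒜 : ι → AddSubgroup A) [GradedRing 𝒜] [SetLike.GradedSMul 𝒜 ℳ]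
    {M' : Type*} [AddCommGroup M'] [Module A M'] {ℳ' : ι → AddSubgroup M'}
    [DirectSum.Decomposition ℳ'] [SetLike.GradedSMul 𝒜 ℳ'] {κ : Type*} {t : κ → M} {d : κ → ι}
    (ht : ∀ i, t i ∈ ℳ (d i)) (hspan : Submodule.span A (Set.range t) = ⊤) (f : M ≃ₗ[A] M')
    (hf : ∀ i, f (t i) ∈ ℳ' (d i)) (γ : ι) (x : M) : x ∈ ℳ γ ↔ f x ∈ ℳ' γ := by
  have h := component_map 𝒜 ht hspan (f : M →ₗ[A] M') hf γ x
  simp only [LinearEquiv.coe_coe] at h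
  constructor
  · intro hx
    rw [component_same hx] at h
    rw [← h]; exact component_mem _ _
  · intro hx
    rw [component_same hx] at h
    rw [f.injective h]; exact component_mem _ _

section

variable {R M : Type*} [CommRing R] [AddCommGroup M] [Module R M] {q : QuadraticForm R M}

/-- The difference of the forms vanishes on generators together with its polar form. Off-diagonal
polar values suffice, since a diagonal one is twice the value of the form. -/
theorem quadraticForm_ext {q' : QuadraticForm R M} {κ : Type*} {t : κ → M}
    (hspan : Submodule.span R (Set.range t) = ⊤) (h1 : ∀ i, q (t i) = q' (t i))
    (h2 : ∀ i j, i ≠ j → QuadraticMap.polar q (t i) (t j) = QuadraticMap.polar q' (t i) (t j)) :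
    q = q' := by
  refine sub_eq_zero.1 (QuadraticMap.ext fun x => ?_)
  have h3 : ∀ x y, QuadraticMap.polar (q - q') x y =
      QuadraticMap.polar q x y - QuadraticMap.polar q' x y := fun x y => by
    simp only [QuadraticMap.polar, _root_.sub_apply]; abel
  refine form_eq_zero_of_mem_span (s := Set.range t) ?_ ?_ (hspan ▸ Submodule.mem_top)
  · rintro _ ⟨i, rfl⟩
    rw [_root_.sub_apply, h1, sub_self]
  · rintro _ ⟨i, rfl⟩ _ ⟨j, rfl⟩
    rw [h3]
    by_cases h : i = j
    · subst h
      rw [QuadraticMap.polar_self, QuadraticMap.polar_self, h1, sub_self]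
    · rw [h2 i j h, sub_self]

theorem IsNonsingular.of_equiv {M' : Type*} [AddCommGroup M'] [Module R M']
    {q' : QuadraticForm R M'} (h : IsNonsingular q) (φ : q'.IsometryEquiv q) :
    IsNonsingular q' := by
  intro x hx
  refine (map_eq_zero_iff φ (EquivLike.injective φ)).1 (h _ fun y => ?_)
  obtain ⟨y, rfl⟩ := EquivLike.surjective φ y
  rw [← hx y]
  simp only [QuadraticMap.polar, ← map_add, φ.map_app]

theorem IsHyperbolicFamily.isNonsingular {κ : Type*} [Fintype κ] {e f : κ → M}
    (h : IsHyperbolicFamily q e f)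
    (hs : Submodule.span R (Set.range (Sum.elim e f)) = ⊤) : IsNonsingular q := by
  intro x hx
  obtain ⟨c, rfl⟩ :=
    (Submodule.mem_span_range_iff_exists_fun R).1 (hs ▸ Submodule.mem_top (x := x))
  simp only [Fintype.sum_sum_type, Sum.elim_inl, Sum.elim_inr] at hx ⊢
  have h1 : ∀ j, c (Sum.inl j) = 0 := fun j => by
    rw [← h.polar_combination_right (fun i => c (Sum.inl i)) (fun i => c (Sum.inr i)) j,
      QuadraticMap.polar_comm, hx]
  have h2 : ∀ j, c (Sum.inr j) = 0 := fun j => by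
    rw [← h.polar_combination_left (fun i => c (Sum.inl i)) (fun i => c (Sum.inr i)) j,
      QuadraticMap.polar_comm, hx]
  simp [h1, h2]

end

/-! ### Norms with prescribed values on a base -/

section

variable {Γ : Type w} [AddCommGroup Γ] [LinearOrder Γ] [IsOrderedAddMonoid Γ]
  {F : Type u} [Field F] {v : AddValuation F (WithTop Γ)}
  {V : Type u} [AddCommGroup V] [Module F V]

namespace ValueFunction

variable {κ : Type} [Fintype κ]

variable (v) in
/-- The norm split by a given base, with given values on the base. -/
noncomputable def ofBasis (e : Module.Basis κ F V) (d : κ → Γ) : ValueFunction v V where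
  toFun x := Finset.univ.inf fun i => d i + v (e.repr x i)
  eq_top_iff x := by
    simp only [Finset.inf_eq_top_iff, Finset.mem_univ, true_implies, WithTop.add_eq_top,
      WithTop.coe_ne_top, false_or, AddValuation.top_iff]
    rw [← e.repr.map_eq_zero_iff, Finsupp.ext_iff]
    rfl
  smul a x := by
    have := Finset.apply_inf_eq_inf_comp_of_linearOrder (fun y => y + v a) (s := Finset.univ)
      (f := fun i => d i + v (e.repr x i)) (fun y z h => add_le_add_left h _) (top_add _)
    refine Eq.trans ?_ this.symm
    refine Finset.inf_congr rfl fun i _ => ?_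
    simp only [Function.comp_apply, map_smul, Finsupp.smul_apply, smul_eq_mul, v.map_mul]
    rw [add_assoc, add_comm (v a)]
  min_le_add x y := by
    refine Finset.le_inf fun i _ => ?_
    rw [_root_.map_add, Finsupp.add_apply]
    refine le_trans ?_ (add_le_add_right (v.map_add _ _) _)
    rw [← min_add_add_left]
    exact min_le_min (Finset.inf_le (Finset.mem_univ i)) (Finset.inf_le (Finset.mem_univ i))

variable (e : Module.Basis κ F V) (d : κ → Γ)

theorem ofBasis_smul_basis (c : F) (i : κ) : ofBasis v e d (c • e i) = d i + v c := by
  classical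
  refine le_antisymm ?_ (Finset.le_inf fun j _ => ?_)
  · refine (Finset.inf_le (Finset.mem_univ i)).trans ?_
    simp
  · by_cases h : i = j
    · subst h; simp
    · simp [h]

theorem ofBasis_basis (i : κ) : ofBasis v e d (e i) = d i := by
  have := ofBasis_smul_basis (v := v) e d 1 i
  rwa [one_smul, v.map_one, add_zero] at this

theorem ofBasis_sum (c : κ → F) :
    ofBasis v e d (∑ i, c i • e i) = Finset.univ.inf fun i => ofBasis v e d (c i • e i) := by
  simp only [ofBasis_smul_basis]
  change (Finset.univ.inf fun i => _) = _
  simp only [e.repr_sum_self]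

theorem isNorm_ofBasis : (ofBasis v e d).IsNorm :=
  ⟨κ, inferInstance, e, ofBasis_sum e d⟩

variable {e d} {q : QuadraticForm F V}

/-- The bound for the polar form follows by expanding in the base. The bound for `q` is not a
consequence when `2` is not a unit, so it is proved separately by adding the base components of `x`
one at a time. -/
theorem boundedBy_ofBasis (h1 : ∀ i, ((2 • d i : Γ) : WithTop Γ) ≤ v (q (e i)))
    (h2 : ∀ i j, i ≠ j → ((d i + d j : Γ) : WithTop Γ) ≤ v (QuadraticMap.polar q (e i) (e j))) :
    (ofBasis v e d).BoundedBy q := by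
  classical
  have h2' : ∀ i j, ((d i + d j : Γ) : WithTop Γ) ≤ v (QuadraticMap.polar q (e i) (e j)) := by
    intro i j
    by_cases h : i = j
    · subst h
      -- The two rewrites act in different places: the value `2 • q (e i)` is split into a sum and
      -- `d i + d i` is folded to `2 • d i`.
      rw [QuadraticMap.polar_self, two_nsmul, ← two_nsmul]
      exact v.map_le_add (h1 i) (h1 i)
    · exact h2 i j h
  have hp : ∀ x y, ofBasis v e d x + ofBasis v e d y ≤ v (QuadraticMap.polar q x y) := by
    intro x y
    conv_rhs => rw [← e.sum_repr x, ← e.sum_repr y]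
    rw [polar_sum_right]
    refine v.map_le_sum fun j _ => ?_
    rw [QuadraticMap.polar_comm, polar_sum_right, Finset.mul_sum]
    refine v.map_le_sum fun i _ => ?_
    rw [v.map_mul, v.map_mul]
    refine (add_le_add (Finset.inf_le (Finset.mem_univ i))
      (Finset.inf_le (Finset.mem_univ j))).trans ?_
    refine le_trans (le_of_eq ?_) (add_le_add_right (add_le_add_right (h2' j i) _) _)
    rw [WithTop.coe_add]
    abel
  refine ⟨hp, fun x => ?_⟩
  have key : ∀ s : Finset κ, 2 • ofBasis v e d x ≤ v (q (∑ i ∈ s, e.repr x i • e i)) := by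
    intro s
    induction s using Finset.induction_on with
    | empty => simp
    | insert i s hi ih =>
      rw [Finset.sum_insert hi, QuadraticMap.map_add q]
      have hle : ∀ i, ofBasis v e d x ≤ ofBasis v e d (e.repr x i • e i) := fun i => by
        rw [ofBasis_smul_basis]; exact Finset.inf_le (Finset.mem_univ i)
      refine v.map_le_add (v.map_le_add ?_ ih) ?_
      · rw [QuadraticMap.map_smul, smul_eq_mul, v.map_mul, v.map_mul, two_nsmul]
        refine (add_le_add (hle i) (hle i)).trans ?_
        rw [ofBasis_smul_basis]
        refine le_trans (le_of_eq ?_) (add_le_add_right (h1 i) _)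
        rw [two_nsmul, WithTop.coe_add]
        abel
      · rw [two_nsmul]
        refine (add_le_add (hle i) ?_).trans (hp _ _)
        exact (Finset.le_inf fun i _ => hle i).trans (inf_le_sum _ _)
  have := key Finset.univ
  rwa [e.sum_repr] at this

theorem span_sym (α : ValueFunction v V) : grSubmodule α ⊤ = ⊤ := by
  rw [Submodule.eq_top_iff']
  intro z
  induction z using gr_induction with
  | h0 => exact zero_mem _
  | ha x y hx hy => exact add_mem hx hy
  | hs γ x hx => exact sym_mem_grSubmodule hx Submodule.mem_top

end ValueFunction

end

/-! ### Realizing graded forms, and graded spaces of orthogonal sums -/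

section

variable {Γ : Type w} [AddCommGroup Γ] [LinearOrder Γ] [IsOrderedAddMonoid Γ]
  {F : Type u} [Field F] {v : AddValuation F (WithTop Γ)}

open ValueFunction

/-- Every graded quadratic space is the graded space of a space with a tame norm. -/
theorem exists_grSpace_equiv (Y : GradedQuadSpace (grGrading v)) :
    ∃ (X : QuadSpace F) (α : ValueFunction v X.carrier) (hα : α.IsTameNorm X.form),
      grSpace X α hα ≈ Y := by
  obtain ⟨κ, _, t, d, ht, hli, hs⟩ := exists_homogeneous_generators (grGrading v)
    (N := (⊤ : Submodule (GrRing v) Y.carrier)) (ℳ := Y.deg) (fun _ _ _ => Submodule.mem_top)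
  let : LinearOrder κ := LinearOrder.lift' (Fintype.equivFin κ) (Fintype.equivFin κ).injective
  -- The coefficients of the graded form in a homogeneous base are lifted to `F`.
  choose a ha hat using fun i => (mem_deg_iff (selfValue v)).1 (Y.form_mem _ _ (ht i))
  choose b hb hbt using fun i j =>
    (mem_deg_iff (selfValue v)).1 (Y.polar_mem _ _ _ _ (ht i) (ht j))
  -- An upper triangular bilinear form realizes prescribed values and off-diagonal polar values in
  -- every characteristic; a symmetric one would require halving.
  let m : Matrix κ κ F := Matrix.of fun i j => if i = j then a i else if i < j then b i j else 0
  let q : QuadraticForm F (κ → F) := LinearMap.BilinMap.toQuadraticMap (Matrix.toLinearMap₂' F m)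
  let e : Module.Basis κ F (κ → F) := Pi.basisFun F κ
  have hm : ∀ i j, Matrix.toLinearMap₂' F m (e i) (e j) = m i j := fun i j => by
    rw [Matrix.toLinearMap₂'_apply]
    simp [e, Pi.single_apply]
  have hqe : ∀ i, q (e i) = a i := fun i => by
    change Matrix.toLinearMap₂' F m (e i) (e i) = _
    rw [hm]
    simp [m]
  have hpe : ∀ i j, QuadraticMap.polar q (e i) (e j) = m i j + m j i := fun i j => by
    rw [LinearMap.BilinMap.polar_toQuadraticMap, hm, hm]
  have hpe' : ∀ i j, i ≠ j → ∃ hx : ((d i + d j : Γ) : WithTop Γ) ≤ selfValue v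
      (QuadraticMap.polar q (e i) (e j)), (selfValue v).sym (d i + d j) _ hx =
      QuadraticMap.polar Y.form (t i) (t j) := fun i j hij => by
    rw [hpe]
    rcases lt_or_gt_of_ne hij with h | h
    · have h1 : m i j + m j i = b i j := by simp [m, hij, hij.symm, h, h.not_gt]
      rw [h1]
      exact ⟨hb i j, hbt i j⟩
    · have h1 : m i j + m j i = b j i := by simp [m, hij, hij.symm, h, h.not_gt]
      rw [h1, add_comm (d i), QuadraticMap.polar_comm]
      exact ⟨hb j i, hbt j i⟩
  have hbd : (ofBasis v e d).BoundedBy q :=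
    boundedBy_ofBasis (fun i => hqe i ▸ ha i) fun i j hij => (hpe' i j hij).1
  obtain ⟨B, hB⟩ := exists_grBasis e (ofBasis_sum e d) (ofBasis_basis e d)
  let φ : (ofBasis v e d).Gr ≃ₗ[GrRing v] Y.carrier :=
    B.equiv (Module.Basis.mk hli hs.ge) (Equiv.refl κ)
  have hφ : ∀ i, φ (B i) = t i := fun i => by simp [φ]
  have hform : hbd.grForm = Y.form.comp φ.toLinearMap := by
    refine quadraticForm_ext B.span_eq (fun i => ?_) fun i j hij => ?_
    · rw [QuadraticMap.comp_apply]
      refine Eq.trans ?_ (congrArg Y.form (hφ i)).symm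
      rw [← hat, hB]
      exact (hbd.grFun_sym _).trans (sym_congr rfl (hqe i))
    · have h1 : ∀ x y, QuadraticMap.polar (Y.form.comp φ.toLinearMap) x y =
          QuadraticMap.polar Y.form (φ x) (φ y) := fun x y => by
        simp [QuadraticMap.polar]
      obtain ⟨hx, h⟩ := hpe' i j hij
      rw [h1, hφ, hφ, ← h, hbd.polar_grForm, hB, hB]
      exact hbd.grPolar_sym_sym _ _
  let Φ : hbd.grForm.IsometryEquiv Y.form :=
    { φ with map_app' := fun x => by rw [hform]; rfl }
  -- Nonsingularity of the graded form is transported from `Y`; that of the lifted form then follows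
  -- from tameness of the norm.
  have htame : (ofBasis v e d).IsTameNorm q := ⟨isNorm_ofBasis e d, hbd, Y.nonsingular.of_equiv Φ⟩
  refine ⟨⟨κ → F, q, ?_, htame.isNonsingular⟩, ofBasis v e d, htame, Φ, ?_⟩
  · rw [← htame.isNorm.finrank_eq, φ.finrank_eq]
    exact Y.even_finrank
  · refine mem_iff_of_map_generators (grGrading v) (ℳ := (ofBasis v e d).deg) (t := B) (d := d) (fun i => ?_) B.span_eq φ
      fun i => ?_
    · rw [hB]; exact sym_mem_deg _
    · rw [hφ]; exact ht i

/-- The associated graded space of an orthogonal sum, as a graded vector space. -/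
theorem exists_grProdEquiv {V W : Type u} [AddCommGroup V] [Module F V] [AddCommGroup W]
    [Module F W] (α : ValueFunction v V) (β : ValueFunction v W) :
    ∃ φ : (α.prod β).Gr ≃ₗ[GrRing v] α.Gr × β.Gr, ∀ γ x hx, φ ((α.prod β).sym γ x hx) =
      (α.sym γ x.1 (hx.trans (min_le_left _ _)), β.sym γ x.2 (hx.trans (min_le_right _ _))) := by
  have hfst : ∀ x : V × W, (α.prod β) x ≤ α (AddMonoidHom.fst V W x) := fun x => min_le_left _ _
  have hsnd : ∀ x : V × W, (α.prod β) x ≤ β (AddMonoidHom.snd V W x) := fun x => min_le_right _ _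
  have hinl : ∀ x, α x ≤ (α.prod β) (AddMonoidHom.inl V W x) := fun x =>
    le_min le_rfl (by simp [β.map_zero])
  have hinr : ∀ x, β x ≤ (α.prod β) (AddMonoidHom.inr V W x) := fun x =>
    le_min (by simp [α.map_zero]) le_rfl
  -- The two projections induce the map and the two inclusions its inverse `g`; none of them lowers
  -- values, and all identities are checked on symbols.
  let f : (α.prod β).Gr →+ α.Gr × β.Gr := (grMap _ hfst).prod (grMap _ hsnd)
  have hf : ∀ γ x hx, f ((α.prod β).sym γ x hx) =
      (α.sym γ x.1 (hx.trans (hfst x)), β.sym γ x.2 (hx.trans (hsnd x))) := fun γ x hx =>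
    Prod.ext (grMap_sym _ hfst hx) (grMap_sym _ hsnd hx)
  let g : α.Gr × β.Gr →+ (α.prod β).Gr := (grMap _ hinl).coprod (grMap _ hinr)
  have hgf : ∀ z, g (f z) = z := by
    intro z
    induction z using gr_induction with
    | h0 => rw [_root_.map_zero, _root_.map_zero]
    | ha x z hx hz => rw [_root_.map_add, _root_.map_add, hx, hz]
    | hs γ x hx =>
      rw [hf]
      refine (congrArg₂ (· + ·) (grMap_sym _ hinl _) (grMap_sym _ hinr _)).trans ?_
      rw [← sym_add]
      exact sym_congr rfl (by ext <;> simp)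
  have hfg1 : ∀ z, f (grMap _ hinl z) = (z, 0) := by
    intro z
    induction z using gr_induction with
    | h0 => rw [_root_.map_zero, _root_.map_zero]; rfl
    | ha x z hx hz =>
      rw [_root_.map_add, _root_.map_add, hx, hz, Prod.mk_add_mk, add_zero]
    | hs γ x hx =>
      rw [grMap_sym, hf]
      refine Prod.ext rfl ((sym_eq_zero _).2 ?_)
      rw [AddMonoidHom.inl_apply, β.map_zero]
      exact WithTop.coe_lt_top _
  have hfg2 : ∀ z, f (grMap _ hinr z) = (0, z) := by
    intro z
    induction z using gr_induction with
    | h0 => rw [_root_.map_zero, _root_.map_zero]; rfl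
    | ha x z hx hz =>
      rw [_root_.map_add, _root_.map_add, hx, hz, Prod.mk_add_mk, add_zero]
    | hs γ x hx =>
      rw [grMap_sym, hf]
      refine Prod.ext ((sym_eq_zero _).2 ?_) rfl
      rw [AddMonoidHom.inr_apply, α.map_zero]
      exact WithTop.coe_lt_top _
  have hfg : ∀ z, f (g z) = z := by
    rintro ⟨x, y⟩
    change f (grMap _ hinl x + grMap _ hinr y) = _
    rw [_root_.map_add, hfg1, hfg2, Prod.mk_add_mk, add_zero, zero_add]
  have hsmul : ∀ (a : GrRing v) z, f (a • z) = a • f z := by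
    intro a z
    induction a using gr_induction with
    | h0 => rw [zero_smul, _root_.map_zero, zero_smul]
    | ha a b iha ihb => rw [add_smul, _root_.map_add, iha, ihb, add_smul]
    | hs γ a ha =>
      induction z using gr_induction with
      | h0 => rw [smul_zero, _root_.map_zero, smul_zero]
      | ha x z hx hz => rw [smul_add, _root_.map_add, hx, hz, _root_.map_add, smul_add]
      | hs δ x hx =>
        rw [sym_smul_sym, hf, hf]
        exact Prod.ext (sym_smul_sym _ ha _).symm (sym_smul_sym _ ha _).symm
  exact ⟨{ f with
      map_smul' := hsmul
      invFun := g
      left_inv := hgf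
      right_inv := hfg }, hf⟩

theorem polar_comp_linearMap {R M N : Type*} [CommRing R] [AddCommGroup M] [Module R M]
    [AddCommGroup N] [Module R N] (q : QuadraticForm R N) (φ : M →ₗ[R] N) (x y : M) :
    QuadraticMap.polar (q.comp φ) x y = QuadraticMap.polar q (φ x) (φ y) := by
  simp only [QuadraticMap.polar, QuadraticMap.comp_apply, _root_.map_add]

theorem grForm_prod {V W : Type u} [AddCommGroup V] [Module F V] [AddCommGroup W]
    [Module F W] {α : ValueFunction v V} {β : ValueFunction v W} {q : QuadraticForm F V}
    {r : QuadraticForm F W} (hq : α.BoundedBy q) (hr : β.BoundedBy r)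
    (φ : (α.prod β).Gr ≃ₗ[GrRing v] α.Gr × β.Gr)
    (hφ : ∀ γ x hx, φ ((α.prod β).sym γ x hx) =
      (α.sym γ x.1 (hx.trans (min_le_left _ _)), β.sym γ x.2 (hx.trans (min_le_right _ _)))) :
    (hq.prod hr).grForm =
      (QuadraticMap.prod hq.grForm hr.grForm).comp (φ : (α.prod β).Gr →ₗ[GrRing v] _) := by
  refine quadraticForm_ext (span_sym (α.prod β)) (fun z => ?_) fun z z' _ => ?_
  · rw [QuadraticMap.comp_apply, LinearEquiv.coe_coe, hφ, QuadraticMap.prod_apply]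
    refine ((hq.prod hr).grFun_sym z.2.1).trans ?_
    refine Eq.trans ?_ (congrArg₂ (· + ·) (hq.grFun_sym _) (hr.grFun_sym _)).symm
    exact sym_add _ _ _
  · rw [polar_comp_linearMap, LinearEquiv.coe_coe, hφ, hφ, QuadraticMap.polar_prod,
      BoundedBy.polar_grForm, BoundedBy.polar_grForm, BoundedBy.polar_grForm,
      BoundedBy.grPolar_sym_sym, BoundedBy.grPolar_sym_sym, BoundedBy.grPolar_sym_sym, ← sym_add]
    exact sym_congr rfl (QuadraticMap.polar_prod _ _ _ _)


end

section

variable {Γ : Type w} [AddCommGroup Γ] [LinearOrder Γ] [IsOrderedAddMonoid Γ]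
  {F : Type u} [Field F] {v : AddValuation F (WithTop Γ)}

open ValueFunction

/-- The graded space of an orthogonal sum. -/
theorem grSpace_sum {X Y : QuadSpace F} {α : ValueFunction v X.carrier}
    {β : ValueFunction v Y.carrier} (hα : α.IsTameNorm X.form) (hβ : β.IsTameNorm Y.form) :
    grSpace (X.sum Y) (α.prod β) (hα.prod hβ) ≈ (grSpace X α hα).sum (grSpace Y β hβ) := by
  obtain ⟨φ, hφ⟩ := exists_grProdEquiv α β
  have hform := grForm_prod hα.bounded hβ.bounded φ hφ
  have hdeg : ∀ γ z, z ∈ (α.prod β).deg γ ↔ φ z ∈ (α.deg γ).prod (β.deg γ) := fun γ z => by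
    constructor
    · intro hz
      obtain ⟨x, hx, rfl⟩ := (mem_deg_iff _).1 hz
      rw [hφ]
      exact ⟨sym_mem_deg _, sym_mem_deg _⟩
    · rintro ⟨h1, h2⟩
      obtain ⟨x, hx, hx'⟩ := (mem_deg_iff _).1 h1
      obtain ⟨y, hy, hy'⟩ := (mem_deg_iff _).1 h2
      have : z = (α.prod β).sym γ (x, y) (le_min hx hy) :=
        φ.injective ((hφ γ (x, y) (le_min hx hy)).trans (Prod.ext hx' hy')).symm
      rw [this]
      exact sym_mem_deg _
  let Φ : (hα.bounded.prod hβ.bounded).grForm.IsometryEquiv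
      (QuadraticMap.prod hα.bounded.grForm hβ.bounded.grForm) :=
    { φ with map_app' := fun x => (DFunLike.congr_fun hform x).symm }
  exact ⟨Φ, hdeg⟩

end

/-! ### Hyperbolic spaces over a field -/

section

variable {F : Type u} [Field F]

/-- A left inverse of the combination map of `t` provides coordinate functionals on `V`, and the
nondegenerate polar form represents each of them by a vector. -/
theorem exists_dual_family_of_field {V : Type*} [AddCommGroup V] [Module F V]
    [FiniteDimensional F V] {q : QuadraticForm F V} (hq : IsNonsingular q) {κ : Type*} {t : κ → V}
    (hli : LinearIndependent F t) :
    ∃ w : κ → V, (∀ i, QuadraticMap.polar q (t i) (w i) = 1) ∧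
      (∀ i j, i ≠ j → QuadraticMap.polar q (t i) (w j) = 0) := by
  have hinj : Function.Injective (QuadraticMap.polarBilin q) := by
    rw [injective_iff_map_eq_zero]
    exact fun x hx => hq x fun y => by simpa using LinearMap.congr_fun hx y
  let B : V ≃ₗ[F] Module.Dual F V :=
    LinearEquiv.ofInjectiveOfFinrankEq (QuadraticMap.polarBilin q) hinj
      (Subspace.dual_finrank_eq).symm
  have hB : ∀ x y, B x y = QuadraticMap.polar q x y := fun x y => rfl
  obtain ⟨g, hg⟩ := (Finsupp.linearCombination F t).exists_leftInverse_of_injective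
    (LinearMap.ker_eq_bot.2 hli)
  have hgt : ∀ i, g (t i) = Finsupp.single i 1 := fun i => by
    have := LinearMap.congr_fun hg (Finsupp.single i 1)
    simpa using this
  have hw : ∀ i j, QuadraticMap.polar q (t i) (B.symm (Finsupp.lapply j ∘ₗ g)) =
      Finsupp.single i 1 j := fun i j => by
    rw [QuadraticMap.polar_comm, ← hB, LinearEquiv.apply_symm_apply, LinearMap.comp_apply, hgt,
      Finsupp.lapply_apply]
  exact ⟨fun j => B.symm (Finsupp.lapply j ∘ₗ g), fun i => by rw [hw, Finsupp.single_eq_same],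
    fun i j hij => by rw [hw, Finsupp.single_eq_of_ne' hij]⟩

namespace QuadSpace

theorem IsHyperbolic.exists_family {X : QuadSpace F} (hX : X.IsHyperbolic) :
    ∃ (κ : Type) (_ : Fintype κ) (t w : κ → X.carrier), IsHyperbolicFamily X.form t w ∧
      Submodule.span F (Set.range (Sum.elim t w)) = ⊤ := by
  obtain ⟨U, W, hUW, hU, hW⟩ := hX
  -- An isotropic subspace of at least half the dimension yields a hyperbolic family so large that,
  -- being independent, it is a base.
  have key : ∀ U : Submodule F X.carrier, (∀ x ∈ U, X.form x = 0) →
      Module.finrank F X.carrier ≤ Module.finrank F U + Module.finrank F U →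
      ∃ (κ : Type) (_ : Fintype κ) (t w : κ → X.carrier), IsHyperbolicFamily X.form t w ∧
        Submodule.span F (Set.range (Sum.elim t w)) = ⊤ := by
    intro U hU hdim
    have hli : LinearIndependent F fun i => (Module.finBasis F U i : X.carrier) :=
      (Module.finBasis F U).linearIndependent.map' U.subtype U.ker_subtype
    obtain ⟨w, h1, h2⟩ := exists_dual_family_of_field X.nonsingular hli
    have h := exists_isHyperbolicFamily (fun i => hU _ (Module.finBasis F U i).2)
      (fun i j => polar_eq_zero_of_isotropic hU (Module.finBasis F U i).2
        (Module.finBasis F U j).2) h1 h2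
    refine ⟨_, inferInstance, _, _, h, h.linearIndependent.span_eq_top_of_card_eq_finrank' ?_⟩
    refine le_antisymm h.linearIndependent.fintype_card_le_finrank ?_
    rwa [Fintype.card_sum, Fintype.card_fin]
  have hsum := Submodule.finrank_add_eq_of_isCompl hUW
  rcases le_total (Module.finrank F U) (Module.finrank F W) with h | h
  · exact key W hW (by omega)
  · exact key U hU (by omega)

theorem IsHyperbolic.of_equiv {X Y : QuadSpace F} (hX : X.IsHyperbolic) (h : X ≈ Y) :
    Y.IsHyperbolic := by
  obtain ⟨U, W, hUW, hU, hW⟩ := hX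
  obtain ⟨e⟩ := h
  refine ⟨Submodule.orderIsoMapComap e.toLinearEquiv U, Submodule.orderIsoMapComap e.toLinearEquiv W,
    OrderIso.isCompl _ hUW, ?_, ?_⟩
  · rintro _ ⟨x, hx, rfl⟩
    exact (e.map_app x).trans (hU x hx)
  · rintro _ ⟨x, hx, rfl⟩
    exact (e.map_app x).trans (hW x hx)

theorem IsHyperbolic.sum {X Y : QuadSpace F} (hX : X.IsHyperbolic) (hY : Y.IsHyperbolic) :
    (X.sum Y).IsHyperbolic := by
  obtain ⟨U, W, hUW, hU, hW⟩ := hX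
  obtain ⟨U', W', hUW', hU', hW'⟩ := hY
  have hq : ∀ {U : Submodule F X.carrier} {U' : Submodule F Y.carrier}, (∀ x ∈ U, X.form x = 0) →
      (∀ x ∈ U', Y.form x = 0) → ∀ x ∈ U.prod U', (X.sum Y).form x = 0 := by
    rintro U U' hU hU' x ⟨h1, h2⟩
    exact (congrArg₂ (· + ·) (hU _ h1) (hU' _ h2)).trans (add_zero _)
  refine ⟨U.prod U', W.prod W', ⟨?_, ?_⟩, hq hU hU', hq hW hW'⟩
  · refine disjoint_iff.2 ((Submodule.prod_inf_prod U W U' W').trans ?_)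
    rw [hUW.inf_eq_bot, hUW'.inf_eq_bot, Submodule.prod_bot]
    rfl
  · refine codisjoint_iff.2 ((Submodule.prod_sup_prod U W U' W').trans ?_)
    rw [hUW.sup_eq_top, hUW'.sup_eq_top, Submodule.prod_top]
    rfl

theorem IsHyperbolic.zero : (QuadSpace.zero : QuadSpace F).IsHyperbolic :=
  ⟨⊤, ⊥, isCompl_top_bot, fun _ _ => rfl, fun _ _ => rfl⟩

end QuadSpace

end

/-! ### Isometry invariance of graded hyperbolicity -/

section

variable {ι : Type w} [AddCommGroup ι] [LinearOrder ι] [IsOrderedAddMonoid ι] {A : Type u}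
  [CommRing A] {𝒜 : ι → AddSubgroup A} [GradedRing 𝒜] [IsGradedField 𝒜]

/-- It is enough to transport half of a hyperbolic base, which recovers both homogeneous summands in
`Y`. -/
theorem GradedQuadSpace.IsHyperbolic.of_equiv {X Y : GradedQuadSpace 𝒜} (hX : X.IsHyperbolic)
    (h : X ≈ Y) : Y.IsHyperbolic := by
  obtain ⟨κ, _, t, w, d, ht, -, H, hc⟩ := hX.exists_family
  obtain ⟨e, he⟩ := h
  have H' := H.map e
  refine Y.isHyperbolic_of_isotropic_family (fun i => (he _ _).1 (ht i))
    (linearIndependent_sum.1 H'.linearIndependent).1 H'.form_left H'.polar_left ?_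
  rw [← hc, e.toLinearEquiv.finrank_eq]

end

/-! ### Vanishing in a Witt quotient -/

namespace WittQuotient

/-- Since `H` is closed under sums, the subgroup it generates consists of differences of elements of
`H`. A complement from `hneg` replaces cancellation in `M`. -/
theorem exists_add_mem {M : Type*} [AddCommMonoid M] {H : Set M} (h0 : 0 ∈ H)
    (hadd : ∀ a ∈ H, ∀ b ∈ H, a + b ∈ H) (hneg : ∀ a, ∃ b, a + b ∈ H) {m : M}
    (hm : WittQuotient.mk H m = 0) : ∃ h ∈ H, m + h ∈ H := by
  have hm' := (QuotientAddGroup.eq_zero_iff _).1 hm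
  have key : ∀ x ∈ AddSubgroup.closure ((Algebra.GrothendieckAddGroup.of : M →+ _) '' H),
      ∃ h ∈ H, ∃ h' ∈ H, x + Algebra.GrothendieckAddGroup.of h = Algebra.GrothendieckAddGroup.of h' := by
    intro x hx
    induction hx using AddSubgroup.closure_induction with
    | mem x hx =>
      obtain ⟨h, hh, rfl⟩ := hx
      exact ⟨0, h0, h, hh, by rw [map_zero, add_zero]⟩
    | zero => exact ⟨0, h0, 0, h0, zero_add _⟩
    | add x y _ _ hx hy =>
      obtain ⟨a, ha, a', ha', hx⟩ := hx
      obtain ⟨b, hb, b', hb', hy⟩ := hy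
      exact ⟨a + b, hadd a ha b hb, a' + b', hadd a' ha' b' hb', by
        rw [map_add, map_add, ← hx, ← hy]; abel⟩
    | neg x _ hx =>
      obtain ⟨a, ha, a', ha', hx⟩ := hx
      exact ⟨a', ha', a, ha, by rw [← hx]; abel⟩
  obtain ⟨h, hh, h', hh', he⟩ := key _ hm'
  rw [← map_add] at he
  -- Equality in the Grothendieck group only means equality after adding some `c`. Adding also `c'`
  -- with `c + c'` in `H` brings everything back to elements of `H`.
  obtain ⟨c, hc⟩ := (AddLocalization.addMonoidOf (⊤ : AddSubmonoid M)).eq_iff_exists.1 he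
  obtain ⟨c', hc'⟩ := hneg c
  refine ⟨h + (c + c'), hadd _ hh _ hc', ?_⟩
  have : m + (h + (c + c')) = h' + (c + c') := by
    calc m + (h + (c + c')) = (c + (m + h)) + c' := by abel
      _ = (c + h') + c' := by rw [hc]
      _ = h' + (c + c') := by abel
  rw [this]
  exact hadd _ hh' _ hc'

theorem exists_eq_sub {M : Type*} [AddCommMonoid M] {H : Set M} (z : WittQuotient M H) :
    ∃ a b, z = WittQuotient.mk H a - WittQuotient.mk H b := by
  obtain ⟨z, rfl⟩ := QuotientAddGroup.mk_surjective z
  induction z using AddLocalization.induction_on with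
  | H y =>
    refine ⟨y.1, y.2, ?_⟩
    refine eq_sub_of_add_eq ?_
    change QuotientAddGroup.mk' _ _ + QuotientAddGroup.mk' _ _ = QuotientAddGroup.mk' _ _
    rw [← map_add]
    congr 1
    rw [AddLocalization.mk_eq_addMonoidOf_mk']
    exact (AddLocalization.addMonoidOf (⊤ : AddSubmonoid M)).mk'_spec y.1 y.2

end WittQuotient

/-! ### Witt classes of tame forms and of their graded forms -/

section

variable {Γ : Type w} [AddCommGroup Γ] [LinearOrder Γ] [IsOrderedAddMonoid Γ]
  {F : Type u} [Field F] {v : AddValuation F (WithTop Γ)}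

open ValueFunction

/-- Hyperbolic spaces admit tame norms. -/
theorem exists_isTameNorm_of_isHyperbolic {X : QuadSpace F} (hX : X.IsHyperbolic) :
    ∃ α : ValueFunction v X.carrier, α.IsTameNorm X.form := by
  obtain ⟨κ, _, t, w, H, hs⟩ := hX.exists_family
  let e : Module.Basis (κ ⊕ κ) F X.carrier := Module.Basis.mk H.linearIndependent hs.ge
  have he1 : ∀ i, e (Sum.inl i) = t i := fun i => by simp [e]
  have he2 : ∀ i, e (Sum.inr i) = w i := fun i => by simp [e]
  have h0 : ∀ γ : Γ, (γ : WithTop Γ) < v 0 := fun γ => by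
    rw [v.map_zero]; exact WithTop.coe_lt_top _
  -- All vectors of a hyperbolic base get value `0`; since the entries of the Gram matrix are `0`
  -- and `1`, their symbols again form a hyperbolic base.
  have hbd : (ofBasis v e fun _ => 0).BoundedBy X.form := by
    refine boundedBy_ofBasis ?_ ?_
    · rintro (i | i)
      · rw [he1, H.form_left]; exact (h0 _).le
      · rw [he2, H.form_right]; exact (h0 _).le
    · have h1 : ∀ i j, ((0 + 0 : Γ) : WithTop Γ) ≤ v (QuadraticMap.polar X.form (t i) (w j)) := by
        intro i j
        by_cases hij : i = j
        · subst hij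
          rw [H.polar_same, v.map_one, add_zero, WithTop.coe_zero]
        · rw [H.polar_ne i j hij]; exact (h0 _).le
      rintro (i | i) (j | j) -
      · rw [he1, he1, H.polar_left]; exact (h0 _).le
      · rw [he1, he2]; exact h1 i j
      · rw [he1, he2, QuadraticMap.polar_comm]; exact h1 j i
      · rw [he2, he2, H.polar_right]; exact (h0 _).le
  obtain ⟨B, hB⟩ := exists_grBasis e (ofBasis_sum e fun _ => 0) (ofBasis_basis (v := v) e fun _ => 0)
  have hform : ∀ i, X.form (e i) = 0 → hbd.grForm (B i) = 0 := fun i h => by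
    rw [hB]
    refine (hbd.grFun_sym _).trans ((sym_eq_zero _).2 ?_)
    rw [h]; exact h0 _
  have hpolar : ∀ i j, QuadraticMap.polar X.form (e i) (e j) = 0 →
      QuadraticMap.polar hbd.grForm (B i) (B j) = 0 := fun i j h => by
    rw [hbd.polar_grForm, hB, hB]
    refine (hbd.grPolar_sym_sym _ _).trans ((sym_eq_zero _).2 ?_)
    rw [h]; exact h0 _
  have HB : IsHyperbolicFamily hbd.grForm (B ∘ Sum.inl) (B ∘ Sum.inr) := by
    refine ⟨fun i => hform _ ?_, fun i => hform _ ?_, fun i j => hpolar _ _ ?_,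
      fun i j => hpolar _ _ ?_, fun i => ?_, fun i j hij => hpolar _ _ ?_⟩
    · rw [he1, H.form_left]
    · rw [he2, H.form_right]
    · rw [he1, he1, H.polar_left]
    · rw [he2, he2, H.polar_right]
    · rw [hbd.polar_grForm, Function.comp_apply, Function.comp_apply, hB, hB, one_eq_sym]
      refine (hbd.grPolar_sym_sym _ _).trans (sym_congr (add_zero 0) ?_)
      rw [he1, he2, H.polar_same]
    · rw [he1, he2, H.polar_ne i j hij]
  exact ⟨_, isNorm_ofBasis e _, hbd, HB.isNonsingular (by
    rw [Sum.elim_comp_inl_inr, B.span_eq])⟩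

theorem wittClass_eq_zero {X : QuadSpace F} (hX : X.IsHyperbolic) : X.wittClass = 0 :=
  WittQuotient.mk_eq_zero ⟨X, hX, rfl⟩

theorem exists_hyperbolic_sum {X : QuadSpace F} (hX : X.wittClass = 0) :
    ∃ H : QuadSpace F, H.IsHyperbolic ∧ (X.sum H).IsHyperbolic := by
  obtain ⟨_, ⟨H, hH, rfl⟩, H', hH', h⟩ := WittQuotient.exists_add_mem
    (H := {c | ∃ X : QuadSpace F, X.IsHyperbolic ∧ c = X.isoClass}) ⟨_, QuadSpace.IsHyperbolic.zero, rfl⟩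
    (by
      rintro _ ⟨X, hX, rfl⟩ _ ⟨Y, hY, rfl⟩
      exact ⟨X.sum Y, hX.sum hY, rfl⟩)
    (by
      rintro ⟨X⟩
      exact ⟨X.neg.isoClass, X.sum X.neg, isHyperbolic_sum_neg X, rfl⟩) hX
  have h' : H' ≈ X.sum H := Setoid.symm (Quotient.exact (s := QuadSpace.isometrySetoid F) h)
  exact ⟨H, hH, hH'.of_equiv h'⟩

theorem gradedWittClass_eq_zero {X : GradedQuadSpace (grGrading v)} (hX : X.IsHyperbolic) :
    X.wittClass = 0 :=
  WittQuotient.mk_eq_zero ⟨X, hX, rfl⟩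

theorem gradedWittClass_sum (X Y : GradedQuadSpace (grGrading v)) :
    (X.sum Y).wittClass = X.wittClass + Y.wittClass :=
  map_add (WittQuotient.mk _) X.isoClass Y.isoClass

theorem gradedWittClass_congr {X Y : GradedQuadSpace (grGrading v)} (h : X ≈ Y) :
    X.wittClass = Y.wittClass :=
  congrArg (WittQuotient.mk _) (Quotient.sound h)

theorem gradedSum_congr {X X' Y Y' : GradedQuadSpace (grGrading v)} (h : X ≈ X') (h' : Y ≈ Y') :
    X.sum Y ≈ X'.sum Y' := by
  obtain ⟨e, he⟩ := h
  obtain ⟨f, hf⟩ := h'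
  exact ⟨QuadraticMap.IsometryEquiv.prod e f, fun γ x => and_congr (he γ x.1) (hf γ x.2)⟩

/-- Both graded spaces are lifted to `F`, where they are hyperbolic by the Henselian property; the
graded space of the sum of the lifts is hyperbolic in turn. -/
theorem GradedQuadSpace.IsHyperbolic.sum
    (hv : HenselianLocalRing v.toValuation.valuationSubring)
    {X Y : GradedQuadSpace (grGrading v)} (hX : X.IsHyperbolic) (hY : Y.IsHyperbolic) :
    (X.sum Y).IsHyperbolic := by
  obtain ⟨X', α, hα, hXX'⟩ := exists_grSpace_equiv X
  obtain ⟨Y', β, hβ, hYY'⟩ := exists_grSpace_equiv Y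
  have h1 := isHyperbolic_of_grSpace hv hα (hX.of_equiv (Setoid.symm hXX'))
  have h2 := isHyperbolic_of_grSpace hv hβ (hY.of_equiv (Setoid.symm hYY'))
  exact (isHyperbolic_grSpace (h1.sum h2) (hα.prod hβ)).of_equiv
    (Setoid.trans (grSpace_sum hα hβ) (gradedSum_congr hXX' hYY'))

theorem exists_graded_hyperbolic_sum (hv : HenselianLocalRing v.toValuation.valuationSubring)
    {X : GradedQuadSpace (grGrading v)} (hX : X.wittClass = 0) :
    ∃ H : GradedQuadSpace (grGrading v), H.IsHyperbolic ∧ (X.sum H).IsHyperbolic := by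
  obtain ⟨_, ⟨H, hH, rfl⟩, H', hH', h⟩ := WittQuotient.exists_add_mem
    (H := {c | ∃ X : GradedQuadSpace (grGrading v), X.IsHyperbolic ∧ c = X.isoClass})
    ⟨GradedQuadSpace.zero _, ⟨⊤, ⊥, fun _ _ _ => Submodule.mem_top, fun _ _ _ => rfl,
      isCompl_top_bot, fun _ _ => rfl, fun _ _ => rfl⟩, rfl⟩
    (by
      rintro _ ⟨X, hX, rfl⟩ _ ⟨Y, hY, rfl⟩
      exact ⟨X.sum Y, hX.sum hv hY, rfl⟩)
    (by
      rintro ⟨X⟩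
      -- The complement of a graded class is found by lifting it and taking the graded space of the
      -- opposite form, with the same norm.
      obtain ⟨X', α, hα, h⟩ := exists_grSpace_equiv X
      refine ⟨(grSpace X'.neg α hα.neg).isoClass, _,
        isHyperbolic_grSpace (isHyperbolic_sum_neg X') (hα.prod hα.neg), ?_⟩
      exact Quotient.sound (Setoid.trans (gradedSum_congr (Setoid.symm h) (Setoid.refl _))
        (Setoid.symm (grSpace_sum hα hα.neg)))) hX
  have h' : H' ≈ X.sum H :=
    Setoid.symm (Quotient.exact (s := GradedQuadSpace.isometrySetoid (grGrading v)) h)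
  exact ⟨H, hH, hH'.of_equiv h'⟩

theorem gradedWittClass_grSpace_sum {X Y : QuadSpace F} {α : ValueFunction v X.carrier}
    {β : ValueFunction v Y.carrier} (hα : α.IsTameNorm X.form) (hβ : β.IsTameNorm Y.form) :
    (grSpace (X.sum Y) (α.prod β) (hα.prod hβ)).wittClass =
      (grSpace X α hα).wittClass + (grSpace Y β hβ).wittClass :=
  (gradedWittClass_congr (grSpace_sum hα hβ)).trans (gradedWittClass_sum _ _)

/-- The norm is `α` itself. The sum of a form and its opposite is hyperbolic, hence so is its graded
space, and the two graded classes are opposite. -/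
theorem exists_isTameNorm_neg {X : QuadSpace F} {α : ValueFunction v X.carrier}
    (hα : α.IsTameNorm X.form) :
    ∃ (β : ValueFunction v X.neg.carrier) (hβ : β.IsTameNorm X.neg.form),
      (grSpace X.neg β hβ).wittClass = -(grSpace X α hα).wittClass := by
  obtain ⟨β, hβ⟩ : ∃ β : ValueFunction v X.neg.carrier, β.IsTameNorm X.neg.form := ⟨α, hα.neg⟩
  refine ⟨β, hβ, eq_neg_of_add_eq_zero_right ?_⟩
  exact (gradedWittClass_grSpace_sum hα hβ).symm.trans
    (gradedWittClass_eq_zero (isHyperbolic_grSpace (isHyperbolic_sum_neg X) _))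

/-- On either side a trivial class means hyperbolic after adding a hyperbolic space. That summand is
given a tame norm in one direction and lifted to `F` in the other, and hyperbolicity of the sum is
transferred. -/
theorem wittClass_eq_zero_iff (hv : HenselianLocalRing v.toValuation.valuationSubring)
    {X : QuadSpace F} {α : ValueFunction v X.carrier} (hα : α.IsTameNorm X.form) :
    X.wittClass = 0 ↔ (grSpace X α hα).wittClass = 0 := by
  constructor
  · intro hX
    obtain ⟨H, hH, hXH⟩ := exists_hyperbolic_sum hX
    obtain ⟨β, hβ⟩ := exists_isTameNorm_of_isHyperbolic (v := v) hH
    have h := gradedWittClass_grSpace_sum hα hβ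
    rwa [gradedWittClass_eq_zero (isHyperbolic_grSpace hH hβ),
      gradedWittClass_eq_zero (isHyperbolic_grSpace hXH (hα.prod hβ)), add_zero, eq_comm] at h
  · intro hX
    obtain ⟨H, hH, hXH⟩ := exists_graded_hyperbolic_sum hv hX
    obtain ⟨H', β, hβ, h⟩ := exists_grSpace_equiv H
    have h1 := isHyperbolic_of_grSpace hv hβ (hH.of_equiv (Setoid.symm h))
    have h2 := isHyperbolic_of_grSpace hv (hα.prod hβ) (hXH.of_equiv (Setoid.symm
      (Setoid.trans (grSpace_sum hα hβ) (gradedSum_congr (Setoid.refl _) h))))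
    have h3 := wittClass_sum X H'
    rwa [wittClass_eq_zero h1, wittClass_eq_zero h2, add_zero, eq_comm] at h3

/-- The vanishing criterion is applied to `X.sum Y.neg`. One direction makes the isomorphism well
defined, even as the norm varies, and the other makes it injective. -/
theorem wittClass_eq_iff (hv : HenselianLocalRing v.toValuation.valuationSubring)
    {X Y : QuadSpace F} {α : ValueFunction v X.carrier} {β : ValueFunction v Y.carrier}
    (hα : α.IsTameNorm X.form) (hβ : β.IsTameNorm Y.form) :
    X.wittClass = Y.wittClass ↔ (grSpace X α hα).wittClass = (grSpace Y β hβ).wittClass := by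
  obtain ⟨β', hβ', h⟩ := exists_isTameNorm_neg hβ
  have key := wittClass_eq_zero_iff hv (X := X.sum Y.neg) (α := α.prod β') (hα.prod hβ')
  rwa [gradedWittClass_grSpace_sum hα hβ', h, wittClass_sum X Y.neg, wittClass_neg,
    ← sub_eq_add_neg, ← sub_eq_add_neg, sub_eq_zero, sub_eq_zero] at key

theorem exists_gradedWittClass_eq (z : GradedWittGroup (grGrading v)) :
    ∃ (X : QuadSpace F) (α : ValueFunction v X.carrier) (hα : α.IsTameNorm X.form),
      (grSpace X α hα).wittClass = z := by
  obtain ⟨⟨A⟩, ⟨B⟩, rfl⟩ := WittQuotient.exists_eq_sub z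
  obtain ⟨X, α, hα, hX⟩ := exists_grSpace_equiv A
  obtain ⟨Y, β, hβ, hY⟩ := exists_grSpace_equiv B
  obtain ⟨β', hβ', h⟩ := exists_isTameNorm_neg hβ
  refine ⟨X.sum Y.neg, α.prod β', hα.prod hβ', (gradedWittClass_grSpace_sum hα hβ').trans ?_⟩
  rw [h, ← sub_eq_add_neg, gradedWittClass_congr hX, gradedWittClass_congr hY]
  rfl

end

end TameWitt

/-! ### The isomorphism -/

theorem mainTheorem2 {Γ : Type*} [AddCommGroup Γ] [LinearOrder Γ] [IsOrderedAddMonoid Γ]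
    (hΓ : ∀ n : ℕ, n ≠ 0 → ∀ γ : Γ, ∃ δ : Γ, n • δ = γ)
    {F : Type*} [Field F] (v : AddValuation F (WithTop Γ))
    (hv : HenselianLocalRing v.toValuation.valuationSubring) :
    ∃! res : TameWitt.tameWittGroup v ≃+ TameWitt.GradedWittGroup (TameWitt.grGrading v),
      ∀ (X : TameWitt.QuadSpace F) (α : TameWitt.ValueFunction v X.carrier)
        (hα : α.IsTameNorm X.form),
        res (TameWitt.tameClass X α hα) = (TameWitt.grSpace X α hα).wittClass := by
  have hex : ∀ c : TameWitt.tameWittGroup v, ∃ (X : TameWitt.QuadSpace F)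
      (α : TameWitt.ValueFunction v X.carrier) (hα : α.IsTameNorm X.form),
      TameWitt.tameClass X α hα = c := by
    rintro ⟨_, X, ⟨α, hα⟩, rfl⟩
    exact ⟨X, α, hα, rfl⟩
  choose X α hα hc using hex
  let f : TameWitt.tameWittGroup v → TameWitt.GradedWittGroup (TameWitt.grGrading v) :=
    fun c => (TameWitt.grSpace (X c) (α c) (hα c)).wittClass
  have hcv : ∀ c, (X c).wittClass = c.1 := fun c => congrArg Subtype.val (hc c)
  -- The value of `f` does not depend on the chosen representative or its norm. Additivity,
  -- surjectivity and the required formula all come from picking convenient representatives.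
  have hf : ∀ c (Y : TameWitt.QuadSpace F) (β : TameWitt.ValueFunction v Y.carrier)
      (hβ : β.IsTameNorm Y.form), Y.wittClass = c.1 →
      f c = (TameWitt.grSpace Y β hβ).wittClass := fun c Y β hβ h =>
    (TameWitt.wittClass_eq_iff hv (hα c) hβ).1 ((hcv c).trans h.symm)
  let g := AddMonoidHom.mk' f fun c d => by
    rw [hf (c + d) ((X c).sum (X d)) _ ((hα c).prod (hα d))
      ((TameWitt.wittClass_sum _ _).trans (congrArg₂ (· + ·) (hcv c) (hcv d))),
      TameWitt.gradedWittClass_grSpace_sum]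
  have hg : Function.Bijective g := by
    refine ⟨fun c d h => Subtype.ext ?_, fun z => ?_⟩
    · rw [← hcv c, ← hcv d]
      exact (TameWitt.wittClass_eq_iff hv (hα c) (hα d)).2 h
    · obtain ⟨Y, β, hβ, rfl⟩ := TameWitt.exists_gradedWittClass_eq z
      exact ⟨TameWitt.tameClass Y β hβ, hf _ Y β hβ rfl⟩
  refine ⟨AddEquiv.ofBijective g hg, fun Y β hβ => hf _ Y β hβ rfl, fun res hres => ?_⟩
  -- Uniqueness holds because every element of the tame Witt group is the class of a single form
  -- with a tame norm.
  refine AddEquiv.ext fun c => ?_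
  rw [← hc c, hres]
  exact (hf _ _ _ (hα c) rfl).symm
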